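/- **Definitions.** Let $d\ge 0$. A *finite subdivision rule $R$ of dimension $d$* consists of (1) a finite $d$-dimensional CW complex $S_R$ that is the union of its closed $d$-cells, together with, for each $d$-cell $e$, a finite CW structure $s_e$ (the *tile type* of $e$) on the closed $d$-disk that is the domain of the characteristic map of $e$, such that the open disk is one open cell of $s_e$, all other cells lie in the boundary sphere, any two distinct closed cells that intersect do so in a single closed cell of lower dimension than the larger of the two, and the characteristic map is a homeomorphism of each open cell of $s_e$ onto an open cell of $S_R$; (2) a finite CW complex $R(S_R)$ of dimension at most $d$ that is a subdivision of $S_R$; (3) a continuous cellular map $\varphi_R\colon R(S_R)\to S_R$ that maps each open cell homeomorphically onto an open cell. An *$R$-complex* is a CW complex $X$ of dimension at most $d$ that is the union of its closed $d$-cells, with a continuous map $f\colon X\to S_R$ mapping each open cell homeomorphically onto an open cell; $R(X)$ is the subdivision of $X$ obtained by pulling back the cells of $R(S_R)$ along $f$, an $R$-complex with map $\varphi_R\circ f$; and $R^k(X)$ denotes the $k$-th iterate. A $d$-cell of an $R$-complex has type $e$ if it is mapped onto the open cell $e$. For $n\ge1$, the universal cover of the $n$-torus $\mathbb R^n/\mathbb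 Z^n$ is $\mathbb R^n$, with fundamental domain $[0,1]^n$. For $k\ge 0$ let $B(k)$ be the union of the cubes $Q_b=b+[0,1]^n$, where $b\in\mathbb Z^n$ has word length at most $k$ in the standard generators, and $S(k)=\partial B(k)$. Refine the cubical structure of $\mathbb R^n$ as follows: write a face of a cube as $I^{p}\times I^{q}$, where $I^p$ is the product of its coordinate intervals $[m,m+1]$ with $m\neq0$ and $I^q$ is the product of its intervals $[0,1]$, and replace $I^p$ by its standard simplicial decomposition into $p!$ simplices (one for each ordering of the coordinates, measured from the vertex of $I^p$ nearest to the origin). Give $S(k)$, a union of cells, the resulting cell structure. **Theorem.** For every $n\ge1$ there is a finite subdivision rule $R$ of dimension $n-1$ (a subdivision rule for the $n$-torus) with exactly $n$ tile types $t_1,\dots,t_n$, such that: 1. $t_p$ is, as a CW complex, $\Delta^{p-1}\times I^{q}$ with $q=n-p$, for $1\le p\le n$. 2. The subdivision of $t_p$ has exactly one tile of type $t_p$ and, if $q\geq 1$, exactly $2q$ tiles of type $t_{p+1}$ (that is, $\Delta^{p}\times I^{q-1}$), and no other tiles. 3. The iterates of $R$ realise the spheres $S(k)$: there are an $R$-complex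 $X$ whose space is an $(n-1)$-sphere and homeomorphisms $h_k\colon X\to S(k)$, $k\ge0$, such that for every $k$ (a) $h_k$ carries the open cells of $R^k(X)$ exactly to the open cells of $S(k)$; (b) for each tile of $R^k(X)$ of type $t_p$, its image under $h_k$ lies in $Q_b$ for some $b$ of word length $k+1$ with exactly $p$ nonzero coordinates; (c) $h_{k+1}(x)=h_k(x)$ whenever $h_k(x)\in S(k+1)$, and $h_{k+1}(x)\in Q_b$ whenever $h_k(x)\in Q_b$ for some $b$ of word length $k+1$. -/

import Mathlib

open Set Topology

namespace TorusFSR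

/-! ### Vocabulary for CW structures handled as explicit terms -/

section CW

variable {X Y : Type*} [TopologicalSpace X] [TopologicalSpace Y] {C : Set X} {D : Set Y}

/-- The `m`-cells of a CW structure `K`. -/
abbrev Cell (K : CWComplex C) (m : ℕ) : Type _ := @CWComplex.cell X _ C K m

/-- The characteristic map of an `m`-cell; it is defined on the closed unit ball of `Fin m → ℝ`. -/
def charMap (K : CWComplex C) (m : ℕ) (c : Cell K m) : (Fin m → ℝ) → X :=
  @CWComplex.map X _ C K m c

/-- The open cell. -/
def openCell (K : CWComplex C) (m : ℕ) (c : Cell K m) : Set X :=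
  charMap K m c '' Metric.ball 0 1

/-- The closed cell. -/
def closedCell (K : CWComplex C) (m : ℕ) (c : Cell K m) : Set X :=
  charMap K m c '' Metric.closedBall 0 1

/-- Finitely many cells in all. -/
def FinitelyManyCells (K : CWComplex C) : Prop := Finite (Σ m, Cell K m)

/-- All cells have dimension at most `d`. -/
def DimLE (K : CWComplex C) (d : ℕ) : Prop := ∀ m, d < m → IsEmpty (Cell K m)

/-- The space is the union of the closed `d`-cells. -/
def UnionOfClosed (K : CWComplex C) (d : ℕ) : Prop := ⋃ c : Cell K d, closedCell K d c = C

/-- Two points lie in a common open cell. -/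
def SameOpenCell (K : CWComplex C) (x y : X) : Prop :=
  ∃ (m : ℕ) (c : Cell K m), x ∈ openCell K m c ∧ y ∈ openCell K m c

/-- `f` restricts to a homeomorphism from `A` onto `B`. -/
def HomeoOnto (f : X → Y) (A : Set X) (B : Set Y) : Prop :=
  ∃ h : A ≃ₜ B, ∀ x : A, (h x : Y) = f x

/-- `f` maps every open cell of `K` homeomorphically onto an open cell of `L` (of the same
dimension; in particular `f` is cellular when it is continuous). -/
def HomeoOnCells (K : CWComplex C) (L : CWComplex D) (f : X → Y) : Prop :=
  ∀ (m : ℕ) (c : Cell K m), ∃ c' : Cell L m, HomeoOnto f (openCell K m c) (openCell L m c')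

/-- `K'` is a subdivision of `K`: same space, and every open cell of `K'` lies in an open cell
of `K`. -/
def IsSubdivision (K' K : CWComplex C) : Prop :=
  ∀ (m : ℕ) (c : Cell K' m), ∃ (m' : ℕ) (c' : Cell K m'), openCell K' m c ⊆ openCell K m' c'

end CW

/-! ### Finite subdivision rules of dimension `d` -/

/-- The conditions on a CW structure on the closed `d`-disk that make it a tile type: the open disk
is a single cell, all other cells lie in the boundary sphere, and two different closed cells that
intersect do so in a single closed cell of lower dimension (lower than that of the larger one). -/
structure IsTileType (d : ℕ) (s : CWComplex (Metric.closedBall (0 : Fin d → ℝ) 1)) : Prop where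
  top_cell : ∃ e : Cell s d, openCell s d e = Metric.ball 0 1 ∧
    ∀ (m : ℕ) (c : Cell s m), (⟨m, c⟩ : Σ m, Cell s m) ≠ ⟨d, e⟩ →
      closedCell s m c ⊆ Metric.sphere 0 1
  inter_cell : ∀ (m m' : ℕ) (c : Cell s m) (c' : Cell s m'),
    (⟨m, c⟩ : Σ m, Cell s m) ≠ ⟨m', c'⟩ →
      (closedCell s m c ∩ closedCell s m' c').Nonempty →
        ∃ (r : ℕ) (c'' : Cell s r), r < max m m' ∧
          closedCell s m c ∩ closedCell s m' c' = closedCell s r c''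

/-- A finite subdivision rule of dimension `d`. -/
structure FiniteSubdivisionRule (d : ℕ) where
  /-- The space underlying the subdivision complex and its subdivision. -/
  S : Type
  [topS : TopologicalSpace S]
  [t2S : T2Space S]
  /-- The subdivision complex. -/
  cw : CWComplex (univ : Set S)
  finite_cw : FinitelyManyCells cw
  dim_cw : DimLE cw d
  union_cw : UnionOfClosed cw d
  /-- For every `d`-cell, a CW structure on the closed `d`-disk, the domain of its characteristic
  map: the tile type. -/
  tile : Cell cw d → CWComplex (Metric.closedBall (0 : Fin d → ℝ) 1)
  finite_tile : ∀ e, FinitelyManyCells (tile e)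
  isTileType : ∀ e, IsTileType d (tile e)
  /-- The characteristic map of the `d`-cell is a homeomorphism from every open cell of its tile
  type onto an open cell of the subdivision complex. -/
  charMap_tile : ∀ e, HomeoOnCells (tile e) cw (charMap cw d e)
  /-- The subdivision of the subdivision complex. -/
  sub : CWComplex (univ : Set S)
  finite_sub : FinitelyManyCells sub
  dim_sub : DimLE sub d
  isSubdivision : IsSubdivision sub cw
  /-- The subdivision map. -/
  subMap : C(S, S)
  homeo_subMap : HomeoOnCells sub cw subMap

attribute [instance] FiniteSubdivisionRule.topS FiniteSubdivisionRule.t2S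

variable {d : ℕ}

/-- An `R`-complex structure on a space `X`. -/
structure RComplex (R : FiniteSubdivisionRule d) (X : Type) [TopologicalSpace X] where
  cw : CWComplex (univ : Set X)
  dim_cw : DimLE cw d
  union_cw : UnionOfClosed cw d
  map : C(X, R.S)
  homeo_map : HomeoOnCells cw R.cw map

/-- `A'` is the subdivision `R(A)` of the `R`-complex `A`: its cell structure is the one pulled back
from the subdivision of the subdivision complex along `A.map` (these conditions determine the open
cells of `A'`), and its structure map is the composition with the subdivision map. -/
structure IsSubdivided (R : FiniteSubdivisionRule d) {X : Type} [TopologicalSpace X]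
    (A A' : RComplex R X) : Prop where
  isSubdivision : IsSubdivision A'.cw A.cw
  pullback : HomeoOnCells A'.cw R.sub A.map
  map_eq : A'.map = R.subMap.comp A.map

/-- The number of `d`-cells of type `e'` in the subdivision of the tile type `e`: the `d`-cells of
the subdivided subdivision complex which lie in the open cell `e` and are mapped onto the open cell
`e'` by the subdivision map. -/
noncomputable def tileCount (R : FiniteSubdivisionRule d) (e e' : Cell R.cw d) : ℕ :=
  Nat.card {c : Cell R.sub d //
    openCell R.sub d c ⊆ openCell R.cw d e ∧
      R.subMap '' openCell R.sub d c = openCell R.cw d e'}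

/-! ### The polytope `Δ^{p-1} × I^q` -/

/-- `Δ^{p-1} × I^q`, with the simplex in barycentric coordinates. -/
def simplexCube (p q : ℕ) : Set ((Fin p → ℝ) × (Fin q → ℝ)) :=
  stdSimplex ℝ (Fin p) ×ˢ Icc 0 1

/-- Two points of `Δ^{p-1} × I^q` lie in the relative interior of the same face. -/
def SameOpenFace {p q : ℕ} (x y : (Fin p → ℝ) × (Fin q → ℝ)) : Prop :=
  (∀ i, x.1 i = 0 ↔ y.1 i = 0) ∧
    ∀ j, (x.2 j = 0 ↔ y.2 j = 0) ∧ (x.2 j = 1 ↔ y.2 j = 1)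

/-- The tile type of `e` is, as a CW complex, `Δ^{p-1} × I^q` with its usual faces as cells. -/
def IsSimplexCube (R : FiniteSubdivisionRule d) (e : Cell R.cw d) (p q : ℕ) : Prop :=
  ∃ h : Metric.closedBall (0 : Fin d → ℝ) 1 ≃ₜ simplexCube p q,
    ∀ x y : Metric.closedBall (0 : Fin d → ℝ) 1,
      SameOpenCell (R.tile e) (x : Fin d → ℝ) (y : Fin d → ℝ) ↔
      SameOpenFace (h x : (Fin p → ℝ) × (Fin q → ℝ)) (h y : (Fin p → ℝ) × (Fin q → ℝ))

/-! ### The universal cover of the `n`-torus, balls and spheres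

The universal cover of the torus `ℝⁿ / ℤⁿ` is `ℝⁿ`; its fundamental group `ℤⁿ` acts by translations,
and `[0,1]ⁿ` is a fundamental domain. -/

/-- The ball of radius `k` about the neutral element for the word metric given by `gens`. -/
def wordBall {G : Type*} [AddGroup G] (gens : Set G) (k : ℕ) : Set G :=
  {g | ∃ l : List G, l.length ≤ k ∧ (∀ x ∈ l, x ∈ gens ∨ -x ∈ gens) ∧ l.sum = g}

/-- The standard generators of `ℤⁿ`. -/
def stdGens (n : ℕ) : Set (Fin n → ℤ) := range fun i => Pi.single i 1

/-- The translate of the fundamental domain `[0,1]ⁿ` by `b`. -/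
def cube {n : ℕ} (b : Fin n → ℤ) : Set (Fin n → ℝ) :=
  {x | ∀ i, (b i : ℝ) ≤ x i ∧ x i ≤ b i + 1}

/-- `B(k)`: the union of the fundamental domains at word distance at most `k` from `[0,1]ⁿ`. -/
def ballB (n k : ℕ) : Set (Fin n → ℝ) := ⋃ b ∈ wordBall (stdGens n) k, cube b

/-- `S(k) = ∂B(k)`. -/
def sphereS (n k : ℕ) : Set (Fin n → ℝ) := frontier (ballB n k)

/-- The position of a real number in its unit interval `[m, m + 1]`, measured in the direction away
from `[0,1]` (used for `m ≠ 0` only). -/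
noncomputable def outward (x : ℝ) : ℝ := if 0 < ⌊x⌋ then Int.fract x else 1 - Int.fract x

/-- Two points of `ℝⁿ` lie in the same open cell of the cubical structure of `ℝⁿ` by unit cubes,
refined as follows. A cube, written as `I^p × I^q` where `I^p` collects the intervals `[m, m + 1]`
with `m ≠ 0` and `I^q` the intervals `[0,1]`, is decomposed as the product of the standard simplicial
decomposition of `I^p` (the simplices being given by the orderings of the coordinates, measured
from the vertex of `I^p` nearest to the origin) with the cube `I^q`; and likewise for its faces.
The floors and ceilings fix the open face of the cubical structure. -/
def SameTorusCell {n : ℕ} (x y : Fin n → ℝ) : Prop :=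
  (∀ i, ⌊x i⌋ = ⌊y i⌋ ∧ ⌈x i⌉ = ⌈y i⌉) ∧
    ∀ i j, ⌊x i⌋ ≠ 0 → ⌊x j⌋ ≠ 0 →
      (outward (x i) < outward (x j) ↔ outward (y i) < outward (y j))

/-- The iterates of `R` on some `R`-complex realise the spheres `S(k)`; `t p` is the tile type that
occurs at the elements of `ℤⁿ` with exactly `p` nonzero exponents. -/
def RealisesSpheres (n : ℕ) (R : FiniteSubdivisionRule d) (t : Icc 1 n ≃ Cell R.cw d) : Prop :=
  ∃ (X : Type) (_ : TopologicalSpace X) (_ : T2Space X) (A : ℕ → RComplex R X)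
    (h : ∀ k, X ≃ₜ sphereS n k),
    -- `X` is an `(n-1)`-sphere
    Nonempty (X ≃ₜ Metric.sphere (0 : EuclideanSpace ℝ (Fin n)) 1) ∧
    -- `A k = R^k(A 0)`
    (∀ k, IsSubdivided R (A k) (A (k + 1))) ∧
    -- `h k` carries the cells of `R^k(A 0)` to those of `S(k)`
    (∀ k x y, SameOpenCell (A k).cw x y ↔
      SameTorusCell (h k x : Fin n → ℝ) (h k y : Fin n → ℝ)) ∧
    -- the tiles of type `p` are those covered in the next stage by a fundamental domain that
    -- belongs to an element with exactly `p` nonzero exponents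
    (∀ (k : ℕ) (e : Cell (A k).cw d) (p : Icc 1 n),
      (A k).map '' openCell (A k).cw d e = openCell R.cw d (t p) →
        ∃ b ∈ wordBall (stdGens n) (k + 1) \ wordBall (stdGens n) k,
          Nat.card {i // b i ≠ 0} = p ∧
            ∀ x ∈ openCell (A k).cw d e, (h k x : Fin n → ℝ) ∈ cube b) ∧
    -- the part of `S(k)` that is still exposed in `S(k + 1)` does not change
    (∀ k x, (h k x : Fin n → ℝ) ∈ sphereS n (k + 1) →
      (h (k + 1) x : Fin n → ℝ) = h k x) ∧
    -- the part of `S(k)` covered by a new fundamental domain is replaced by boundary of that domain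
    (∀ k x, ∀ b ∈ wordBall (stdGens n) (k + 1) \ wordBall (stdGens n) k,
      (h k x : Fin n → ℝ) ∈ cube b → (h (k + 1) x : Fin n → ℝ) ∈ cube b)

end TorusFSR

/-! Call a coordinate of a point near if it lies in `(0,1)`, integral if it is an integer, and far
otherwise. The lengths of the `b` with `x ∈ cube b` fill an interval from `lo x` to `hi x`, and
`S(k)` is the set where `lo x ≤ k < hi x` (`mem_sphereS`). Hence, inside a cube `b` of length `k +
1`, the part of `S(k)` is the union of the inner faces of the cube and the part of `S(k + 1)` is the
union of its outer faces.

Place a centre `ctr b` one unit before the inner face in each direction with `b i ≠ 0`, and in the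
middle of the interval when `b i = 0`. Distances from the centre then run from 1 to 2 in the first
kind of direction. Radial projection from this centre carries inner faces to outer faces and fixes
what is common to both. The projections of all cubes of length `k + 1` glue to a homeomorphism
`stage` from `S(k)` to `S(k + 1)`. Since a projection multiplies all distances by one factor, it
preserves their order, and that order is what defines the simplicial decomposition. The cell of the
image is therefore known from the cell of the point together with the set of coordinates that reach
an outer face (`sameTorusCell_push_iff`).

The subdivision complex is the quotient of all spheres by `datum`: the near coordinates in order,
the multiset of outward coordinates of the far ones, and a countdown `hi x - 1 - k`, which is zero
exactly for the points covered by a new cube at the next step. The projection factor is a function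
of the datum (`scale_eq`), hence so is the datum of the projected point (`datum_stage`), and this
gives the subdivision map. On an open cell of a sphere the quotient map is a bijection onto an open
cell (`bijOn_toType`). That the quotient is Hausdorff is shown by explicit continuous functions
separating any two data. All CW structures come from one construction, `HasCharMaps.cw`, which turns
finitely many classes with characteristic maps into a complex.

In dimension `n - 1` exactly one coordinate is integral, the far values are distinct and the
countdown is zero, so the number `p - 1` of far coordinates is the only invariant, and there are `n`
tiles. The closed tile is given by `1 = y₀ ≤ … ≤ y_{p-1} ≤ 2` and `q` coordinates in `[0,1]`;
successive differences identify it with `Δ^{p-1} × I^q` (`tileHomeo`). At a generic point exactly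
one coordinate reaches an outer face. If it is `y_{p-1}`, the image has again `p - 1` far
coordinates, which gives one tile of type `p`. If it is one of the `q` near coordinates, at either
end of its interval, the old integral coordinate becomes far and the type is `p + 1`, which gives
`2q` tiles (`card_subtiles`). -/

namespace TorusFSR

/-! ### CW structures from labelled partitions -/

section Builder

variable {X Y : Type*}

section

variable [TopologicalSpace X] [TopologicalSpace Y]

/-- A continuous map on a compact set is an embedding on a subset on which it is injective and
whose image misses the image of the rest. -/
lemma isEmbedding_restrict_of_isCompact [T2Space X] [T2Space Y] {f : X → Y} {K s : Set X}
    (hK : IsCompact K) (hf : ContinuousOn f K) (hs : s ⊆ K) (hinj : InjOn f s)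
    (hdisj : ∀ x ∈ K, x ∉ s → f x ∉ f '' s) : IsEmbedding (s.domRestrict f) := by
  have hcont : Continuous (s.domRestrict f) := (hf.mono hs).domRestrict
  have hi : Function.Injective (s.domRestrict f) := injOn_iff_injective.1 hinj
  refine ⟨isInducing_iff_nhds.2 fun x => le_antisymm hcont.continuousAt.le_comap ?_, hi⟩
  intro U hU
  rw [mem_nhds_induced] at hU
  obtain ⟨V, hV, hVU⟩ := hU
  obtain ⟨W, hWV, hW, hxW⟩ := mem_nhds_iff.1 hV
  -- The complement of the compact image of `K \ W` is the required neighbourhood: by injectivity on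
  -- `s` and disjointness from the rest, `f x` is not in that image.
  have hcl : IsClosed (f '' (K \ W)) :=
    ((hK.inter_right hW.isClosed_compl).image_of_continuousOn (hf.mono inter_subset_left)).isClosed
  refine ⟨(f '' (K \ W))ᶜ, hcl.isOpen_compl.mem_nhds ?_, ?_⟩
  · rintro ⟨y, ⟨hyK, hyW⟩, hyx⟩
    by_cases hys : y ∈ s
    · exact hyW (hinj hys x.2 hyx ▸ hxW)
    · exact hdisj y hyK hys ⟨x, x.2, hyx.symm⟩
  · intro y hy
    by_contra hyU
    exact hy ⟨y, ⟨hs y.2, fun h => hyU (hVU (hWV h))⟩, rfl⟩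

lemma homeoOnto_of_isEmbedding {f : X → Y} {s : Set X} {t : Set Y}
    (h : IsEmbedding (s.domRestrict f)) (ht : f '' s = t) : HomeoOnto f s t := by
  have hr : range (s.domRestrict f) = t := by rw [range_domRestrict, ht]
  exact ⟨h.toHomeomorph.trans (Homeomorph.setCongr hr), fun x => rfl⟩

end

/-- The class of `x` inside `C`. -/
def classIn (C : Set X) (r : Setoid X) (x : X) : Set X := {y | y ∈ C ∧ r x y}

/-- `s` is the class of a point of dimension `m`. -/
def IsClassOfDim (C : Set X) (r : Setoid X) (dim : X → ℕ) (m : ℕ) (s : Set X) : Prop :=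
  ∃ x ∈ C, dim x = m ∧ s = classIn C r x

section

variable {C : Set X} {r : Setoid X} {dim : X → ℕ}

lemma mem_classIn_self {x : X} (hx : x ∈ C) : x ∈ classIn C r x := ⟨hx, r.refl x⟩

lemma classIn_eq {x y : X} (h : r x y) : classIn C r x = classIn C r y := by
  ext z; exact ⟨fun hz => ⟨hz.1, r.trans (r.symm h) hz.2⟩, fun hz => ⟨hz.1, r.trans h hz.2⟩⟩

lemma rel_of_mem_classIn {x y z : X} (hy : y ∈ classIn C r x) (hz : z ∈ classIn C r x) : r y z :=
  r.trans (r.symm hy.2) hz.2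

lemma IsClassOfDim.dim_eq {m : ℕ} {s : Set X} (hd : ∀ x y, r x y → dim x = dim y)
    (h : IsClassOfDim C r dim m s) {x : X} (hx : x ∈ s) : dim x = m ∧ s = classIn C r x := by
  obtain ⟨y, hy, rfl, rfl⟩ := h
  exact ⟨(hd _ _ hx.2).symm, classIn_eq hx.2⟩

lemma isClassOfDim_classIn {x : X} (hx : x ∈ C) : IsClassOfDim C r dim (dim x) (classIn C r x) :=
  ⟨x, hx, rfl, rfl⟩

lemma finite_sigma_classes (hd : ∀ x y, r x y → dim x = dim y)
    (h : (classIn C r '' C).Finite) :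
    Finite (Σ m, {s : Set X // IsClassOfDim C r dim m s}) := by
  have := h.to_subtype
  refine Finite.of_injective (fun c : (Σ m, {s : Set X // IsClassOfDim C r dim m s}) =>
    (⟨c.2.1, by obtain ⟨x, hx, -, hs⟩ := c.2.2; exact ⟨x, hx, hs.symm⟩⟩ : classIn C r '' C)) ?_
  rintro ⟨m, s, hs⟩ ⟨m', s', hs'⟩ h
  simp only [Subtype.mk.injEq] at h
  subst h
  obtain ⟨x, hx, rfl, rfl⟩ := hs
  obtain ⟨h1, -⟩ := hs'.dim_eq hd (mem_classIn_self hx)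
  subst h1
  rfl

end

variable [TopologicalSpace X]

/-- `f` is a characteristic map for the class `s` of dimension `m`. -/
structure IsCharMap (C : Set X) (dim : X → ℕ) (m : ℕ) (s : Set X) (f : (Fin m → ℝ) → X) :
    Prop where
  continuousOn : ContinuousOn f (Metric.closedBall 0 1)
  injOn : InjOn f (Metric.ball 0 1)
  image_ball : f '' Metric.ball 0 1 = s
  sphere : ∀ v ∈ Metric.sphere (0 : Fin m → ℝ) 1, f v ∈ C ∧ dim (f v) < m

variable {C : Set X} {r : Setoid X} {dim : X → ℕ}

/-- Characteristic maps are available for all classes. -/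
def HasCharMaps (C : Set X) (r : Setoid X) (dim : X → ℕ)
    (E : ∀ m : ℕ, Set X → ((Fin m → ℝ) → X) → Prop) : Prop :=
  ∀ m (s : {s : Set X // IsClassOfDim C r dim m s}), ∃ f, IsCharMap C dim m s.1 f ∧ E m s.1 f

variable {E : ∀ m : ℕ, Set X → ((Fin m → ℝ) → X) → Prop}

/-- The chosen characteristic map. -/
noncomputable def HasCharMaps.char (H : HasCharMaps C r dim E) (m : ℕ)
    (s : {s : Set X // IsClassOfDim C r dim m s}) : (Fin m → ℝ) → X :=
  Classical.choose (H m s)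

lemma HasCharMaps.isCharMap (H : HasCharMaps C r dim E) (m : ℕ)
    (s : {s : Set X // IsClassOfDim C r dim m s}) :
    IsCharMap C dim m s.1 (H.char m s) := (Classical.choose_spec (H m s)).1

/-- The chosen characteristic map, as a partial equivalence. -/
noncomputable def HasCharMaps.partialEquiv (H : HasCharMaps C r dim E) (m : ℕ)
    (s : {s : Set X // IsClassOfDim C r dim m s}) : PartialEquiv (Fin m → ℝ) X :=
  haveI : Nonempty (Fin m → ℝ) := ⟨0⟩
  (H.isCharMap m s).injOn.toPartialEquiv _ _

@[simp] lemma HasCharMaps.coe_partialEquiv (H : HasCharMaps C r dim E) (m : ℕ)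
    (s : {s : Set X // IsClassOfDim C r dim m s}) :
    ⇑(H.partialEquiv m s) = H.char m s := rfl

lemma HasCharMaps.mem_image_closedBall (H : HasCharMaps C r dim E) {x : X} (hx : x ∈ C) :
    x ∈ H.partialEquiv _ ⟨_, isClassOfDim_classIn hx⟩ '' Metric.closedBall 0 1 := by
  apply image_mono Metric.ball_subset_closedBall
  rw [HasCharMaps.coe_partialEquiv, (H.isCharMap _ _).image_ball]
  exact mem_classIn_self hx

/-- The CW structure on `C` whose open cells are the classes of a setoid. -/
@[reducible]
noncomputable def HasCharMaps.cw [T2Space X] (H : HasCharMaps C r dim E)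
    (hd : ∀ x y, r x y → dim x = dim y)
    (hfin : Finite (Σ m, {s : Set X // IsClassOfDim C r dim m s})) : CWComplex C where
  cell m := {s : Set X // IsClassOfDim C r dim m s}
  map m s := H.partialEquiv m s
  source_eq m s := rfl
  continuousOn m s := (H.isCharMap m s).continuousOn
  continuousOn_symm m s := by
    have h := H.isCharMap m s
    -- The inverse is continuous by compactness of the closed ball, because boundary points go to
    -- points of smaller dimension and so never into the class.
    have hemb := isEmbedding_restrict_of_isCompact (isCompact_closedBall 0 1) h.continuousOn
      Metric.ball_subset_closedBall h.injOn (by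
        intro v hv hv' hmem
        have hvs : v ∈ Metric.sphere (0 : Fin m → ℝ) 1 := by
          rw [← Metric.closedBall_sdiff_ball]; exact ⟨hv, hv'⟩
        rw [h.image_ball] at hmem
        exact (h.sphere v hvs).2.ne (s.2.dim_eq hd hmem).1)
    rw [continuousOn_iff_continuous_domRestrict]
    have htarget : (H.partialEquiv m s).target = range ((Metric.ball (0 : Fin m → ℝ) 1).domRestrict
        (H.char m s)) := by
      rw [range_domRestrict]; rfl
    have hc : Continuous fun y : (H.partialEquiv m s).target =>
        ((hemb.toHomeomorph.symm ⟨y.1, htarget ▸ y.2⟩ : Metric.ball (0 : Fin m → ℝ) 1) :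
          Fin m → ℝ) :=
      continuous_subtype_val.comp (hemb.toHomeomorph.symm.continuous.comp
        (continuous_subtype_val.subtype_mk _))
    refine hc.congr ?_
    rintro ⟨y, hy⟩
    have hy' : y ∈ (H.char m s) '' Metric.ball 0 1 := hy
    obtain ⟨v, hv, rfl⟩ := hy'
    have h1 : (H.partialEquiv m s).symm ((H.partialEquiv m s) v) = v :=
      (H.partialEquiv m s).left_inv hv
    have h2 : hemb.toHomeomorph.symm ⟨(H.char m s) v, htarget ▸ hy⟩ = ⟨v, hv⟩ := by
      rw [Homeomorph.symm_apply_eq]; rfl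
    simp only [h2, domRestrict_apply]
    exact h1.symm
  pairwiseDisjoint' := by
    rintro ⟨m, s⟩ - ⟨m', s'⟩ - hne
    have hs := H.isCharMap m s
    have hs' := H.isCharMap m' s'
    simp only [Function.onFun, HasCharMaps.coe_partialEquiv, hs.image_ball, hs'.image_ball]
    rw [Set.disjoint_left]
    intro x hx hx'
    apply hne
    obtain ⟨h1, h2⟩ := s.2.dim_eq hd hx
    obtain ⟨h3, h4⟩ := s'.2.dim_eq hd hx'
    subst h1
    subst h3
    congr 1
    exact Subtype.ext (h2.trans h4.symm)
  mapsTo' m s := by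
    classical
    have h := H.isCharMap m s
    have hfm : ∀ m, Finite {s : Set X // IsClassOfDim C r dim m s} := fun m =>
      Finite.of_injective (fun c => (⟨m, c⟩ : Σ m, {s : Set X // IsClassOfDim C r dim m s}))
        fun a b h => by simpa using h
    have := fun m => Fintype.ofFinite {s : Set X // IsClassOfDim C r dim m s}
    refine ⟨fun m => Finset.univ, fun v hv => ?_⟩
    obtain ⟨h1, h2⟩ := h.sphere v hv
    simp only [mem_iUnion]
    exact ⟨_, h2, ⟨_, isClassOfDim_classIn h1⟩, Finset.mem_univ _, H.mem_image_closedBall h1⟩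
  -- With finitely many cells the weak topology condition is just closedness of a finite union.
  closed' A hA h := by
    have : A = ⋃ c : (Σ m, {s : Set X // IsClassOfDim C r dim m s}),
        A ∩ (H.partialEquiv c.1 c.2) '' Metric.closedBall 0 1 := by
      ext x
      simp only [mem_iUnion, mem_inter_iff]
      exact ⟨fun hx => ⟨⟨_, _, isClassOfDim_classIn (hA hx)⟩, hx, H.mem_image_closedBall (hA hx)⟩,
        fun ⟨_, h, _⟩ => h⟩
    rw [this]
    exact isClosed_iUnion_of_finite fun c => h c.1 c.2
  union' := by
    ext x
    simp only [mem_iUnion]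
    constructor
    · rintro ⟨m, s, v, hv, rfl⟩
      have h := H.isCharMap m s
      by_cases hvb : v ∈ Metric.ball (0 : Fin m → ℝ) 1
      · have h1 : H.char m s v ∈ s.1 := by
          rw [← h.image_ball]; exact mem_image_of_mem _ hvb
        have h2 := (s.2.dim_eq hd h1).2
        rw [h2] at h1
        exact h1.1
      · have hvs : v ∈ Metric.sphere (0 : Fin m → ℝ) 1 := by
          rw [← Metric.closedBall_sdiff_ball]; exact ⟨hv, hvb⟩
        exact (h.sphere v hvs).1
    · intro hx
      exact ⟨_, ⟨_, isClassOfDim_classIn hx⟩, H.mem_image_closedBall hx⟩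

section

variable [T2Space X] (H : HasCharMaps C r dim E) (hd : ∀ x y, r x y → dim x = dim y)
    (hfin : Finite (Σ m, {s : Set X // IsClassOfDim C r dim m s}))

lemma HasCharMaps.openCell_cw (m : ℕ) (c : Cell (H.cw hd hfin) m) :
    openCell (H.cw hd hfin) m c = c.1 :=
  (H.isCharMap m c).image_ball

/-- The predicate `E` lets a property of the characteristic maps survive their arbitrary choice. It
is used for the top cells of the subdivision complex, whose maps must come from charts of standard
cells. -/
lemma HasCharMaps.extra_cw (m : ℕ) (c : Cell (H.cw hd hfin) m) :
    E m c.1 (charMap (H.cw hd hfin) m c) := (Classical.choose_spec (H m c)).2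

lemma HasCharMaps.finitelyManyCells_cw : FinitelyManyCells (H.cw hd hfin) := hfin

lemma HasCharMaps.dimLE_cw {d : ℕ} (h : ∀ x ∈ C, dim x ≤ d) : DimLE (H.cw hd hfin) d := by
  intro m hm
  refine ⟨fun c => ?_⟩
  obtain ⟨x, hx, hxm, -⟩ := c.2
  exact absurd (h x hx) (by omega)

/-- The cell containing `x`. -/
def HasCharMaps.cellOf {x : X} (hx : x ∈ C) : Cell (H.cw hd hfin) (dim x) :=
  ⟨_, isClassOfDim_classIn hx⟩

lemma HasCharMaps.openCell_cellOf {x : X} (hx : x ∈ C) :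
    openCell (H.cw hd hfin) (dim x) (H.cellOf hd hfin hx) = classIn C r x :=
  H.openCell_cw hd hfin _ _

lemma HasCharMaps.exists_of_cell (m : ℕ) (c : Cell (H.cw hd hfin) m) :
    ∃ x ∈ C, dim x = m ∧ openCell (H.cw hd hfin) m c = classIn C r x := by
  rw [H.openCell_cw]; exact c.2

lemma HasCharMaps.sameOpenCell_cw {x y : X} :
    SameOpenCell (H.cw hd hfin) x y ↔ x ∈ C ∧ y ∈ C ∧ r x y := by
  constructor
  · rintro ⟨m, c, hx, hy⟩
    obtain ⟨z, hz, -, hc⟩ := H.exists_of_cell hd hfin m c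
    rw [hc] at hx hy
    exact ⟨hx.1, hy.1, rel_of_mem_classIn hx hy⟩
  · rintro ⟨hx, hy, h⟩
    refine ⟨_, H.cellOf hd hfin hx, ?_, ?_⟩
    · rw [H.openCell_cellOf]; exact mem_classIn_self hx
    · rw [H.openCell_cellOf]; exact ⟨hy, h⟩

end

end Builder

/-! ### General facts about CW structures -/

section Cells

variable {X Y : Type*} [TopologicalSpace X] [TopologicalSpace Y] {C : Set X} {D : Set Y}

lemma closedCell_subset_union_openCell (K : CWComplex C) (m : ℕ) (c : Cell K m) {x : X}
    (hx : x ∈ closedCell K m c) (hx' : x ∉ openCell K m c) :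
    ∃ m' < m, ∃ c' : Cell K m', x ∈ openCell K m' c' := by
  obtain ⟨v, hv, rfl⟩ := hx
  have hvs : v ∈ Metric.sphere (0 : Fin m → ℝ) 1 := by
    rw [← Metric.closedBall_sdiff_ball]
    exact ⟨hv, fun h => hx' ⟨v, h, rfl⟩⟩
  obtain ⟨I, hI⟩ := @CWComplex.cellFrontier_subset_finite_openCell X _ C K m c
  have := hI ⟨v, hvs, rfl⟩
  simp only [mem_iUnion] at this
  obtain ⟨m', hm', c', -, h⟩ := this
  exact ⟨m', hm', c', h⟩

lemma cell_eq_of_mem_openCell (K : CWComplex C) {m m' : ℕ} {c : Cell K m} {c' : Cell K m'} {x : X}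
    (hx : x ∈ openCell K m c) (hx' : x ∈ openCell K m' c') :
    (⟨m, c⟩ : Σ m, Cell K m) = ⟨m', c'⟩ :=
  @RelCWComplex.eq_of_not_disjoint_openCell X _ C ∅ K.instRelCWComplex m c m' c'
    (Set.not_disjoint_iff.2 ⟨x, hx, hx'⟩)

lemma dim_lt_of_mem_closedCell (K : CWComplex C) {m m' : ℕ} {c : Cell K m} {c' : Cell K m'} {x : X}
    (hx : x ∈ closedCell K m c) (hx' : x ∈ openCell K m' c')
    (hne : (⟨m, c⟩ : Σ m, Cell K m) ≠ ⟨m', c'⟩) : m' < m := by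
  by_cases h : x ∈ openCell K m c
  · exact absurd (cell_eq_of_mem_openCell K h hx') hne
  · obtain ⟨m₁, hm₁, c₁, h₁⟩ := closedCell_subset_union_openCell K m c hx h
    have := cell_eq_of_mem_openCell K h₁ hx'
    cases this
    exact hm₁

lemma openCell_subset_closedCell (K : CWComplex C) (m : ℕ) (c : Cell K m) :
    openCell K m c ⊆ closedCell K m c := image_mono Metric.ball_subset_closedBall

lemma closedCell_subset (K : CWComplex C) (m : ℕ) (c : Cell K m) : closedCell K m c ⊆ C :=
  @CWComplex.closedCell_subset_complex X _ C ∅ K.instRelCWComplex m c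

lemma isCompact_closedCell (K : CWComplex C) (m : ℕ) (c : Cell K m) :
    IsCompact (closedCell K m c) :=
  @CWComplex.isCompact_closedCell X _ C ∅ K.instRelCWComplex m c

lemma closure_openCell [T2Space X] (K : CWComplex C) (m : ℕ) (c : Cell K m) :
    closure (openCell K m c) = closedCell K m c :=
  @CWComplex.closure_openCell_eq_closedCell X _ C ∅ K.instRelCWComplex _ m c

/-- A continuous map that maps open cells bijectively to open cells of the same dimension does so
homeomorphically. -/
lemma homeoOnCells_of_bijOn [T2Space X] [T2Space Y] (K : CWComplex C) (L : CWComplex D) {f : X → Y}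
    (hf : ContinuousOn f C)
    (h : ∀ m (c : Cell K m), ∃ c' : Cell L m, BijOn f (openCell K m c) (openCell L m c')) :
    HomeoOnCells K L f := by
  intro m c
  obtain ⟨c', hc'⟩ := h m c
  refine ⟨c', homeoOnto_of_isEmbedding (isEmbedding_restrict_of_isCompact
    (isCompact_closedCell K m c) (hf.mono (closedCell_subset K m c))
    (openCell_subset_closedCell K m c) hc'.injOn ?_) hc'.image_eq⟩
  -- A boundary point lies in an open cell of smaller dimension, and `f` sends that cell to an open
  -- cell of the same smaller dimension, which is disjoint from the target.
  intro x hx hx' hmem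
  rw [hc'.image_eq] at hmem
  obtain ⟨m₁, hm₁, c₁, h₁⟩ := closedCell_subset_union_openCell K m c hx hx'
  obtain ⟨c₂, h₂⟩ := h m₁ c₁
  have := cell_eq_of_mem_openCell L (h₂.mapsTo h₁) hmem
  have h3 : m₁ = m := congrArg Sigma.fst this
  omega

/-- If the points of a dense set lie in open `d`-cells, then the closed `d`-cells cover. -/
lemma unionOfClosed_of_dense [T2Space X] (K : CWComplex C) (hK : FinitelyManyCells K) (d : ℕ)
    (hdense : ∀ x ∈ C, x ∈ closure (⋃ c : Cell K d, openCell K d c)) : UnionOfClosed K d := by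
  have hfd : Finite (Cell K d) := by
    have : Finite (Σ m, Cell K m) := hK
    exact Finite.of_injective (fun c => (⟨d, c⟩ : Σ m, Cell K m)) fun a b h => by simpa using h
  apply subset_antisymm
  · exact iUnion_subset fun c => closedCell_subset K d c
  · intro x hx
    have h1 : IsClosed (⋃ c : Cell K d, closedCell K d c) :=
      isClosed_iUnion_of_finite fun c => (isCompact_closedCell K d c).isClosed
    exact closure_minimal (iUnion_mono fun c => openCell_subset_closedCell K d c) h1 (hdense x hx)

end Cells

end TorusFSR

namespace TorusFSR

/-! ### Unit cubes and word length in `ℤⁿ` -/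

/-- The index of the unit interval that contains `t` and is farthest from `[0,1]`. -/
noncomputable def outerIdx (t : ℝ) : ℤ := if 0 < t then ⌊t⌋ else ⌈t⌉ - 1

/-- The index of the unit interval that contains `t` and is nearest to `[0,1]`. -/
noncomputable def innerIdx (t : ℝ) : ℤ := if 0 < t then ⌈t⌉ - 1 else ⌊t⌋

lemma floor_ceil_cases (t : ℝ) : ⌊t⌋ ≤ ⌈t⌉ ∧ ⌈t⌉ ≤ ⌊t⌋ + 1 ∧ (0 < t → 0 ≤ ⌊t⌋ ∧ 1 ≤ ⌈t⌉) ∧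
    (¬ 0 < t → ⌈t⌉ ≤ 0) := by
  refine ⟨Int.floor_le_ceil t, Int.ceil_le_floor_add_one t, fun h => ⟨Int.floor_nonneg.2 h.le, ?_⟩,
    fun h => ?_⟩
  · exact Int.one_le_ceil_iff.2 h
  · exact Int.ceil_le.2 (by push_cast; linarith)

lemma mem_Icc_iff_ceil_floor {b : ℤ} {t : ℝ} :
    ((b : ℝ) ≤ t ∧ t ≤ b + 1) ↔ ⌈t⌉ ≤ b + 1 ∧ b ≤ ⌊t⌋ := by
  rw [Int.le_floor, Int.ceil_le]; push_cast; tauto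

/-- At most two unit intervals contain `t`, and their indices have different absolute values when
they differ. Summed over coordinates, the equality cases make the shortest and the longest cube
around a point unique. -/
lemma natAbs_idx {b : ℤ} {t : ℝ} (h : (b : ℝ) ≤ t ∧ t ≤ b + 1) :
    (innerIdx t).natAbs ≤ b.natAbs ∧ b.natAbs ≤ (outerIdx t).natAbs ∧
    (b.natAbs = (outerIdx t).natAbs → b = outerIdx t) ∧
    (b.natAbs = (innerIdx t).natAbs → b = innerIdx t) := by
  rw [mem_Icc_iff_ceil_floor] at h
  obtain ⟨h1, h2, h3, h4⟩ := floor_ceil_cases t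
  by_cases ht : 0 < t
  · have := h3 ht
    simp only [outerIdx, innerIdx, ht, if_true]; omega
  · have := h4 ht
    simp only [outerIdx, innerIdx, ht, if_false]; omega

lemma mem_Icc_outerIdx (t : ℝ) : ((outerIdx t : ℤ) : ℝ) ≤ t ∧ t ≤ (outerIdx t : ℤ) + 1 := by
  rw [mem_Icc_iff_ceil_floor]
  obtain ⟨h1, h2, h3, h4⟩ := floor_ceil_cases t
  unfold outerIdx
  split_ifs <;> omega

lemma mem_Icc_innerIdx (t : ℝ) : ((innerIdx t : ℤ) : ℝ) ≤ t ∧ t ≤ (innerIdx t : ℤ) + 1 := by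
  rw [mem_Icc_iff_ceil_floor]
  obtain ⟨h1, h2, h3, h4⟩ := floor_ceil_cases t
  unfold innerIdx
  split_ifs <;> omega

variable {n : ℕ}

/-- Greatest word length of an element whose cube contains `x`. -/
noncomputable def hi (x : Fin n → ℝ) : ℕ := ∑ i, (outerIdx (x i)).natAbs

/-- Least word length of an element whose cube contains `x`. -/
noncomputable def lo (x : Fin n → ℝ) : ℕ := ∑ i, (innerIdx (x i)).natAbs

/-- Word length in `ℤⁿ`. -/
def len (b : Fin n → ℤ) : ℕ := ∑ i, (b i).natAbs

lemma lo_le_len {x : Fin n → ℝ} {b : Fin n → ℤ} (h : x ∈ cube b) : lo x ≤ len b :=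
  Finset.sum_le_sum fun i _ => (natAbs_idx (h i)).1

lemma len_le_hi {x : Fin n → ℝ} {b : Fin n → ℤ} (h : x ∈ cube b) : len b ≤ hi x :=
  Finset.sum_le_sum fun i _ => (natAbs_idx (h i)).2.1

lemma mem_cube_outer (x : Fin n → ℝ) : x ∈ cube fun i => outerIdx (x i) :=
  fun i => mem_Icc_outerIdx (x i)

lemma mem_cube_inner (x : Fin n → ℝ) : x ∈ cube fun i => innerIdx (x i) :=
  fun i => mem_Icc_innerIdx (x i)

lemma eq_outer_of_len_eq {x : Fin n → ℝ} {b : Fin n → ℤ} (h : x ∈ cube b) (hl : len b = hi x) :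
    b = fun i => outerIdx (x i) := by
  funext i
  refine (natAbs_idx (h i)).2.2.1 ?_
  exact (Finset.sum_eq_sum_iff_of_le fun i _ => (natAbs_idx (h i)).2.1).1 hl i (Finset.mem_univ i)

lemma eq_inner_of_len_eq {x : Fin n → ℝ} {b : Fin n → ℤ} (h : x ∈ cube b) (hl : len b = lo x) :
    b = fun i => innerIdx (x i) := by
  funext i
  refine (natAbs_idx (h i)).2.2.2 ?_
  exact ((Finset.sum_eq_sum_iff_of_le fun i _ => (natAbs_idx (h i)).1).1 hl.symm i
    (Finset.mem_univ i)).symm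

/-- Word length in the standard generators is the `ℓ¹` norm: a generator changes it by at most one,
and a nonzero coordinate can always be moved one unit towards zero. -/
lemma mem_wordBall {k : ℕ} {b : Fin n → ℤ} : b ∈ wordBall (stdGens n) k ↔ len b ≤ k := by
  constructor
  · rintro ⟨l, hl, hg, rfl⟩
    refine le_trans ?_ hl
    clear hl
    induction l with
    | nil => simp [len]
    | cons a l ih =>
      have h1 := ih fun x hx => hg x (List.mem_cons_of_mem _ hx)
      have h2 : len a ≤ 1 := by
        have hs : ∀ i : Fin n, len (Pi.single i (1 : ℤ)) ≤ 1 := fun i => by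
          unfold len
          rw [Finset.sum_eq_single i] <;> simp +contextual
        rcases hg a List.mem_cons_self with ⟨i, hi⟩ | ⟨i, hi⟩
        · rw [← hi]; exact hs i
        · have h3 := hs i
          simp only at hi
          rw [hi] at h3
          simpa [len] using h3
      have h3 : len (a + l.sum) ≤ len a + len l.sum := by
        unfold len
        rw [← Finset.sum_add_distrib]
        exact Finset.sum_le_sum fun i _ => Int.natAbs_add_le _ _
      simp only [List.sum_cons, List.length_cons]
      omega
  · intro h
    induction k generalizing b with
    | zero =>
      refine ⟨[], by simp, by simp, ?_⟩
      have : ∀ i, (b i).natAbs = 0 := by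
        have := Nat.le_zero.1 h
        unfold len at this
        simpa [Finset.sum_eq_zero_iff] using this
      funext i
      have := this i
      simp only [List.sum_nil, Pi.zero_apply]
      omega
    | succ k ih =>
      by_cases hb : len b ≤ k
      · obtain ⟨l, hl, h⟩ := ih hb
        exact ⟨l, by omega, h⟩
      · have : ∃ i, b i ≠ 0 := by
          by_contra hcon
          push Not at hcon
          apply hb
          simp [len, hcon]
        obtain ⟨i, hi⟩ := this
        obtain ⟨a, ha, hab, habs⟩ : ∃ a : Fin n → ℤ, (a ∈ stdGens n ∨ -a ∈ stdGens n) ∧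
            (∀ j, j ≠ i → a j = 0) ∧ (b i - a i).natAbs + 1 = (b i).natAbs := by
          rcases lt_or_gt_of_ne hi with h0 | h0
          · refine ⟨-Pi.single i 1, Or.inr ⟨i, by simp⟩, fun j hj => by simp [hj], ?_⟩
            simp; omega
          · refine ⟨Pi.single i 1, Or.inl ⟨i, by simp⟩, fun j hj => by simp [hj], ?_⟩
            simp; omega
        have hlen : len (b - a) + 1 = len b := by
          unfold len
          rw [← Finset.add_sum_erase _ _ (Finset.mem_univ i),
            ← Finset.add_sum_erase _ (fun i => (b i).natAbs) (Finset.mem_univ i)]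
          have : ∑ x ∈ Finset.univ.erase i, ((b - a) x).natAbs =
              ∑ x ∈ Finset.univ.erase i, (b x).natAbs :=
            Finset.sum_congr rfl fun j hj => by simp [hab j (Finset.ne_of_mem_erase hj)]
          simp only [Pi.sub_apply] at this ⊢
          omega
        obtain ⟨l, hl, hg, hs⟩ := ih (b := b - a) (by omega)
        refine ⟨a :: l, by simpa using hl, ?_, by simp [hs]⟩
        intro x hx
        rcases List.mem_cons.1 hx with rfl | hx
        · exact ha
        · exact hg x hx

lemma finite_len_le (n k : ℕ) : {b : Fin n → ℤ | len b ≤ k}.Finite := by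
  refine Set.Finite.subset (Set.Finite.pi' fun _ : Fin n => Set.finite_Icc (-(k : ℤ)) k) ?_
  intro b hb i
  have : (b i).natAbs ≤ len b :=
    Finset.single_le_sum (f := fun i => (b i).natAbs) (fun _ _ => Nat.zero_le _) (Finset.mem_univ i)
  have hb' : len b ≤ k := hb
  simp only [mem_Icc]; omega

lemma isClosed_cube (b : Fin n → ℤ) : IsClosed (cube b) := by
  have : cube b = Icc (fun i => (b i : ℝ)) (fun i => (b i : ℝ) + 1) := by
    ext x; simp [cube, Pi.le_def, forall_and]
  rw [this]; exact isClosed_Icc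

lemma isCompact_cube (b : Fin n → ℤ) : IsCompact (cube b) := by
  have : cube b = Icc (fun i => (b i : ℝ)) (fun i => (b i : ℝ) + 1) := by
    ext x; simp [cube, Pi.le_def, forall_and]
  rw [this]; exact isCompact_Icc

lemma mem_ballB {k : ℕ} {x : Fin n → ℝ} : x ∈ ballB n k ↔ lo x ≤ k := by
  simp only [ballB, mem_iUnion, mem_wordBall, exists_prop]
  exact ⟨fun ⟨b, hb, hx⟩ => (lo_le_len hx).trans hb, fun h => ⟨_, h, mem_cube_inner x⟩⟩

lemma isCompact_ballB (n k : ℕ) : IsCompact (ballB n k) := by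
  have : ballB n k = ⋃ b ∈ {b : Fin n → ℤ | len b ≤ k}, cube b := by
    simp only [ballB, mem_wordBall, mem_ofPred_eq]
  rw [this]
  exact (finite_len_le n k).isCompact_biUnion fun b _ => isCompact_cube b

open Filter in
lemma eventually_natAbs_innerIdx_le (t : ℝ) :
    ∀ᶠ s in 𝓝 t, (innerIdx s).natAbs ≤ (outerIdx t).natAbs := by
  obtain ⟨h1, h2, h3, h4⟩ := floor_ceil_cases t
  by_cases ht : 0 < t
  · filter_upwards [Ioo_mem_nhds ht (Int.lt_floor_add_one t)] with s hs
    have : ⌈s⌉ ≤ ⌊t⌋ + 1 := Int.ceil_le.2 (by push_cast; exact hs.2.le)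
    have h5 := (floor_ceil_cases s).2.2.1 hs.1
    have := h3 ht
    simp only [innerIdx, outerIdx, hs.1, ht, if_true]; omega
  · have h0 : ((⌈t⌉ - 1 : ℤ) : ℝ) < t := by
      have := Int.ceil_lt_add_one t
      push_cast; linarith
    -- The bound 1 on the right suffices even for `t = 0`, since points of `(0,1)` have inner index
    -- 0.
    filter_upwards [Ioo_mem_nhds h0 (show t < 1 by linarith)] with s hs
    have h6 : ⌈t⌉ - 1 ≤ ⌊s⌋ := Int.le_floor.2 hs.1.le
    have h7 := h4 ht
    have h8 : ⌈s⌉ ≤ 1 := Int.ceil_le.2 (by push_cast; exact hs.2.le)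
    obtain ⟨h9, h10, h11, h12⟩ := floor_ceil_cases s
    by_cases hs0 : 0 < s
    · have := h11 hs0
      simp only [innerIdx, outerIdx, hs0, ht, if_true, if_false]; omega
    · have := h12 hs0
      simp only [innerIdx, outerIdx, hs0, ht, if_false]; omega

open Filter in
lemma eventually_innerIdx_eq (t : ℝ) :
    ∀ᶠ ε in 𝓝[>] (0 : ℝ), innerIdx (if 0 < t then t + ε else t - ε) = outerIdx t := by
  by_cases ht : 0 < t
  · have h : (0 : ℝ) < ⌊t⌋ + 1 - t := by linarith [Int.lt_floor_add_one t]
    filter_upwards [Ioo_mem_nhdsGT h] with ε hε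
    have h1 : 0 < t + ε := by linarith [hε.1]
    simp only [innerIdx, outerIdx, ht, h1, if_true]
    have : ⌈t + ε⌉ = ⌊t⌋ + 1 := by
      rw [Int.ceil_eq_iff]; push_cast
      constructor <;> linarith [hε.1, hε.2, Int.floor_le t]
    omega
  · have h : (0 : ℝ) < t - (⌈t⌉ - 1) := by linarith [Int.ceil_lt_add_one t]
    filter_upwards [Ioo_mem_nhdsGT h] with ε hε
    have h1 : ¬ 0 < t - ε := by linarith [hε.1]
    simp only [innerIdx, outerIdx, ht, h1, if_false]
    rw [Int.floor_eq_iff]; push_cast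
    constructor <;> linarith [hε.1, hε.2, Int.le_ceil t]

-- Moving every coordinate slightly away from `[0,1]` puts the point into the interior of its
-- longest cube, so `lo` of nearby points reaches `hi x`; conversely `lo` of nearby points never
-- exceeds `hi x`.
open Filter in
lemma mem_interior_ballB {k : ℕ} {x : Fin n → ℝ} : x ∈ interior (ballB n k) ↔ hi x ≤ k := by
  rw [mem_interior_iff_mem_nhds]
  constructor
  · intro h
    have h1 : ∀ᶠ ε in 𝓝[>] (0 : ℝ), ∀ i,
        innerIdx (if 0 < x i then x i + ε else x i - ε) = outerIdx (x i) :=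
      eventually_all.2 fun i => eventually_innerIdx_eq (x i)
    have h2 : Tendsto (fun ε : ℝ => fun i => if 0 < x i then x i + ε else x i - ε) (𝓝[>] 0)
        (𝓝 x) := by
      have : Continuous (fun ε : ℝ => fun i => if 0 < x i then x i + ε else x i - ε) := by
        refine continuous_pi fun i => ?_
        split_ifs <;> fun_prop
      have h3 := this.tendsto 0
      simp only [add_zero, sub_zero, ite_self] at h3
      exact h3.mono_left nhdsWithin_le_nhds
    obtain ⟨ε, h3, h4⟩ := (h1.and (h2 h)).exists
    have h5 := mem_ballB.1 h4
    unfold lo at h5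
    simp only [h3] at h5
    exact h5
  · intro h
    have h1 : ∀ᶠ y in 𝓝 x, ∀ i, (innerIdx (y i)).natAbs ≤ (outerIdx (x i)).natAbs :=
      eventually_all.2 fun i =>
        (continuous_apply i).continuousAt.eventually (eventually_natAbs_innerIdx_le (x i))
    filter_upwards [h1] with y hy
    exact mem_ballB.2 ((Finset.sum_le_sum fun i _ => hy i).trans h)

/-- This replaces the topology of the frontier by arithmetic of floors and ceilings; everything
later about spheres goes through it. -/
lemma mem_sphereS {k : ℕ} {x : Fin n → ℝ} : x ∈ sphereS n k ↔ lo x ≤ k ∧ k < hi x := by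
  rw [sphereS, (isCompact_ballB n k).isClosed.frontier_eq, mem_sdiff, mem_ballB, mem_interior_ballB,
    not_le]

lemma isCompact_sphereS (n k : ℕ) : IsCompact (sphereS n k) :=
  (isCompact_ballB n k).of_isClosed_subset isClosed_frontier
    (isCompact_ballB n k).isClosed.frontier_subset

instance (n k : ℕ) : CompactSpace (sphereS n k) := isCompact_iff_compactSpace.1 (isCompact_sphereS n k)

/-- Every word length between the least and the greatest one occurs. -/
lemma exists_cube_len_eq {x : Fin n → ℝ} {m : ℕ} (h1 : lo x ≤ m) (h2 : m ≤ hi x) :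
    ∃ b, x ∈ cube b ∧ len b = m := by
  classical
  -- A discrete intermediate value argument: the indices are switched from inner to outer one
  -- coordinate at a time, and each switch raises the length by at most one.
  have key : ∀ s : Finset (Fin n), ∀ m, lo x ≤ m →
      m ≤ len (fun i => if i ∈ s then outerIdx (x i) else innerIdx (x i)) →
      ∃ b, x ∈ cube b ∧ len b = m := by
    intro s
    induction s using Finset.induction_on with
    | empty =>
      intro m h1 h2
      refine ⟨_, mem_cube_inner x, le_antisymm h1 ?_⟩
      simpa using h2
    | insert a s ha ih =>
      intro m h1 h2
      by_cases h : m ≤ len (fun i => if i ∈ s then outerIdx (x i) else innerIdx (x i))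
      · exact ih m h1 h
      · refine ⟨_, ?_, le_antisymm ?_ h2⟩
        · intro i
          dsimp only
          split_ifs
          exacts [mem_Icc_outerIdx _, mem_Icc_innerIdx _]
        · push Not at h
          refine le_trans ?_ (Nat.succ_le_of_lt h)
          unfold len
          rw [← Finset.add_sum_erase _ _ (Finset.mem_univ a),
            ← Finset.add_sum_erase Finset.univ (fun i => (if i ∈ s then outerIdx (x i)
              else innerIdx (x i)).natAbs) (Finset.mem_univ a)]
          have : ∑ i ∈ Finset.univ.erase a,
              (if i ∈ insert a s then outerIdx (x i) else innerIdx (x i)).natAbs =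
              ∑ i ∈ Finset.univ.erase a, (if i ∈ s then outerIdx (x i)
              else innerIdx (x i)).natAbs :=
            Finset.sum_congr rfl fun j hj => by
              simp [Finset.mem_insert, Finset.ne_of_mem_erase hj]
          have h3 : (outerIdx (x a)).natAbs ≤ (innerIdx (x a)).natAbs + 1 := by
            obtain ⟨h1, h2, h3, h4⟩ := floor_ceil_cases (x a)
            unfold outerIdx innerIdx
            split_ifs <;> omega
          simp only [Finset.mem_insert_self, if_true, ha, if_false]
          omega
  exact key Finset.univ m h1 (by simpa [hi, len] using h2)

end TorusFSR

namespace TorusFSR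

/-! ### The homeomorphism from one sphere to the next one -/

/-- The centre coordinate from which the interval `[b, b + 1]` is expanded. -/
noncomputable def ctr (b : ℤ) : ℝ := if b = 0 then 1 / 2 else if 0 < b then b - 1 else b + 2

/-- The greatest distance from `ctr b` of a point of `[b, b + 1]`. -/
noncomputable def wid (b : ℤ) : ℝ := if b = 0 then 1 / 2 else 2

lemma wid_pos (b : ℤ) : 0 < wid b := by unfold wid; split_ifs <;> norm_num

lemma abs_sub_ctr_le {b : ℤ} {t : ℝ} (h : (b : ℝ) ≤ t ∧ t ≤ b + 1) : |t - ctr b| ≤ wid b := by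
  unfold ctr wid
  rw [abs_le]
  split_ifs with h1 h2
  · subst h1; norm_num at h; constructor <;> linarith
  · constructor <;> linarith
  · constructor <;> linarith

lemma one_le_abs_sub_ctr {b : ℤ} {t : ℝ} (h : (b : ℝ) ≤ t ∧ t ≤ b + 1) (hb : b ≠ 0) :
    1 ≤ |t - ctr b| := by
  unfold ctr
  rw [if_neg hb, le_abs]
  split_ifs with h2
  · left; linarith
  · right; linarith

/-- Since `r ≥ 0`, the point stays on its side of the centre, so for `b ≠ 0` it is in the interval
as soon as its distance is between 1 and 2. -/
lemma ctr_add_mem {b : ℤ} {t r : ℝ} (h : (b : ℝ) ≤ t ∧ t ≤ b + 1) (hr : 0 ≤ r)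
    (h1 : b ≠ 0 → 1 ≤ |t - ctr b| * r) (h2 : |t - ctr b| * r ≤ wid b) :
    (b : ℝ) ≤ ctr b + (t - ctr b) * r ∧ ctr b + (t - ctr b) * r ≤ b + 1 := by
  have h3 : |(t - ctr b) * r| ≤ wid b := by rwa [abs_mul, abs_of_nonneg hr]
  rw [abs_le] at h3
  by_cases hb : b = 0
  · subst hb
    simp only [ctr, wid, if_true] at h3 ⊢
    norm_num at h3 ⊢
    constructor <;> linarith
  · have h4 := h1 hb
    simp only [ctr, wid, if_neg hb] at h3 h4 ⊢
    split_ifs at h3 h4 ⊢ with h5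
    · rw [abs_of_nonneg (by linarith)] at h4
      constructor <;> linarith
    · rw [abs_of_nonpos (by linarith)] at h4
      constructor <;> linarith

/-- Distance 1 from the centre means the endpoint nearest to `[0,1]`, the only point that also
belongs to a shorter interval. The interval `[0,1]` itself has no such endpoint. -/
lemma natAbs_innerIdx_lt_iff {b : ℤ} {t : ℝ} (h : (b : ℝ) ≤ t ∧ t ≤ b + 1) :
    (innerIdx t).natAbs < b.natAbs ↔ b ≠ 0 ∧ |t - ctr b| = 1 := by
  have h' := mem_Icc_iff_ceil_floor.1 h
  obtain ⟨h1, h2, h3, h4⟩ := floor_ceil_cases t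
  constructor
  · intro hlt
    have hb : b ≠ 0 := by rintro rfl; simp at hlt
    refine ⟨hb, ?_⟩
    unfold ctr
    rw [if_neg hb]
    by_cases ht : 0 < t
    · have := h3 ht
      simp only [innerIdx, ht, if_true] at hlt
      have hc : ⌈t⌉ = b := by omega
      have hb' : 0 < b := by omega
      have : t = b := le_antisymm (hc ▸ Int.le_ceil t) h.1
      rw [if_pos hb', this]; norm_num
    · have := h4 ht
      simp only [innerIdx, ht, if_false] at hlt
      have hc : ⌊t⌋ = b + 1 := by omega
      have hb' : ¬ 0 < b := by omega
      have : t = b + 1 := le_antisymm h.2 (by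
        have := Int.floor_le t; rw [hc] at this; push_cast at this; exact this)
      rw [if_neg hb', this]; norm_num
  · rintro ⟨hb, h5⟩
    unfold ctr at h5
    rw [if_neg hb] at h5
    split_ifs at h5 with hb'
    · rw [abs_of_nonneg (by linarith)] at h5
      have : t = b := by linarith
      have ht : 0 < t := by rw [this]; exact_mod_cast hb'
      rw [innerIdx, if_pos ht, this, Int.ceil_intCast]; omega
    · rw [abs_of_nonpos (by linarith)] at h5
      have : t = ((b + 1 : ℤ) : ℝ) := by push_cast; linarith
      have ht : ¬ 0 < t := by rw [this]; norm_cast; omega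
      rw [innerIdx, if_neg ht, this, Int.floor_intCast]; omega

lemma natAbs_lt_outerIdx_iff {b : ℤ} {t : ℝ} (h : (b : ℝ) ≤ t ∧ t ≤ b + 1) :
    b.natAbs < (outerIdx t).natAbs ↔ |t - ctr b| = wid b := by
  have h' := mem_Icc_iff_ceil_floor.1 h
  obtain ⟨h1, h2, h3, h4⟩ := floor_ceil_cases t
  constructor
  · intro hlt
    by_cases ht : 0 < t
    · have := h3 ht
      simp only [outerIdx, ht, if_true] at hlt
      have hc : ⌊t⌋ = b + 1 := by omega
      have hb' : 0 ≤ b := by omega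
      have : t = b + 1 := le_antisymm h.2 (by
        have := Int.floor_le t; rw [hc] at this; push_cast at this; exact this)
      rw [this]
      rcases hb'.eq_or_lt with rfl | hb'
      · simp [ctr, wid]; norm_num
      · simp only [ctr, wid, hb'.ne', hb', if_true, if_false]; norm_num
    · have := h4 ht
      simp only [outerIdx, ht, if_false] at hlt
      have hc : ⌈t⌉ = b := by omega
      have hb' : b ≤ 0 := by omega
      have : t = b := le_antisymm (hc ▸ Int.le_ceil t) h.1
      rw [this]
      rcases hb'.eq_or_lt with rfl | hb'
      · simp [ctr, wid]
      · simp only [ctr, wid, hb'.ne, hb'.not_gt, if_false]; norm_num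
  · intro h5
    by_cases hb : b = 0
    · subst hb
      simp only [ctr, wid, if_true] at h5
      rcases (abs_eq (by norm_num)).1 h5 with h6 | h6
      · have : t = ((1 : ℤ) : ℝ) := by push_cast; linarith
        simp [outerIdx, this]
      · have : t = 0 := by linarith
        simp [outerIdx, this]
    · simp only [ctr, wid, if_neg hb] at h5
      split_ifs at h5 with hb'
      · rw [abs_of_nonneg (by linarith)] at h5
        have : t = ((b + 1 : ℤ) : ℝ) := by push_cast; linarith
        have ht : 0 < t := by rw [this]; norm_cast; omega
        rw [outerIdx, if_pos ht, this, Int.floor_intCast]; omega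
      · rw [abs_of_nonpos (by linarith)] at h5
        have : t = b := by linarith
        have ht : ¬ 0 < t := by rw [this]; exact_mod_cast hb'
        rw [outerIdx, if_neg ht, this, Int.ceil_intCast]; omega

variable {n : ℕ}

/-- The right-hand side says that `x` is on an inner face of the cube `b`; in `len_lt_hi_iff` it
says that `x` is on an outer face. -/
lemma lo_lt_len_iff {x : Fin n → ℝ} {b : Fin n → ℤ} (h : x ∈ cube b) :
    lo x < len b ↔ ∃ i, b i ≠ 0 ∧ |x i - ctr (b i)| = 1 := by
  simp only [← fun i => natAbs_innerIdx_lt_iff (h i)]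
  constructor
  · intro hlt
    obtain ⟨i, -, hi⟩ := Finset.exists_lt_of_sum_lt hlt
    exact ⟨i, hi⟩
  · rintro ⟨i, hi⟩
    exact Finset.sum_lt_sum (fun i _ => (natAbs_idx (h i)).1) ⟨i, Finset.mem_univ i, hi⟩

lemma len_lt_hi_iff {x : Fin n → ℝ} {b : Fin n → ℤ} (h : x ∈ cube b) :
    len b < hi x ↔ ∃ i, |x i - ctr (b i)| = wid (b i) := by
  simp only [← fun i => natAbs_lt_outerIdx_iff (h i)]
  constructor
  · intro hlt
    obtain ⟨i, -, hi⟩ := Finset.exists_lt_of_sum_lt hlt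
    exact ⟨i, hi⟩
  · rintro ⟨i, hi⟩
    exact Finset.sum_lt_sum (fun i _ => (natAbs_idx (h i)).2.1) ⟨i, Finset.mem_univ i, hi⟩

/-- The gauge of the box with centre `ctr b` and half widths `wid b`. -/
noncomputable def boxNorm (b : Fin n → ℤ) (x : Fin n → ℝ) : ℝ :=
  ‖fun i => (x i - ctr (b i)) / wid (b i)‖

/-- The greatest inverse distance from `ctr b` in the directions with `b i ≠ 0`. -/
noncomputable def invDist (b : Fin n → ℤ) (x : Fin n → ℝ) : ℝ :=
  ‖fun i => if b i = 0 then 0 else (x i - ctr (b i))⁻¹‖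

/-- Radial projection of the cube `b` from `ctr b` to its outer faces. -/
noncomputable def push (b : Fin n → ℤ) (x : Fin n → ℝ) : Fin n → ℝ :=
  fun i => ctr (b i) + (x i - ctr (b i)) * (boxNorm b x)⁻¹

/-- Radial projection of the cube `b` to `ctr b`, onto its inner faces. -/
noncomputable def pull (b : Fin n → ℤ) (x : Fin n → ℝ) : Fin n → ℝ :=
  fun i => ctr (b i) + (x i - ctr (b i)) * invDist b x

lemma exists_norm_apply_eq {f : Fin n → ℝ} (h : ‖f‖ ≠ 0) : ∃ i, |f i| = ‖f‖ := by
  by_contra hcon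
  push Not at hcon
  have hlt : ∀ i, ‖f i‖ < ‖f‖ := fun i => lt_of_le_of_ne (norm_le_pi_norm f i) (hcon i)
  have hpos : 0 < ‖f‖ := lt_of_le_of_ne (norm_nonneg f) h.symm
  exact lt_irrefl _ ((pi_norm_lt_iff hpos).2 hlt)

section

variable {b : Fin n → ℤ} {x : Fin n → ℝ}

lemma abs_sub_le_boxNorm (b : Fin n → ℤ) (x : Fin n → ℝ) (i : Fin n) :
    |x i - ctr (b i)| ≤ boxNorm b x * wid (b i) := by
  have := norm_le_pi_norm (fun i => (x i - ctr (b i)) / wid (b i)) i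
  rw [Real.norm_eq_abs, abs_div, abs_of_pos (wid_pos _), div_le_iff₀ (wid_pos _)] at this
  exact this

lemma exists_eq_boxNorm (h : boxNorm b x ≠ 0) :
    ∃ i, |x i - ctr (b i)| = boxNorm b x * wid (b i) := by
  obtain ⟨i, hi⟩ := exists_norm_apply_eq h
  rw [abs_div, abs_of_pos (wid_pos _), div_eq_iff (wid_pos _).ne'] at hi
  exact ⟨i, hi⟩

lemma boxNorm_le_one (h : x ∈ cube b) : boxNorm b x ≤ 1 := by
  refine (pi_norm_le_iff_of_nonneg zero_le_one).2 fun i => ?_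
  rw [Real.norm_eq_abs, abs_div, abs_of_pos (wid_pos _), div_le_one (wid_pos _)]
  exact abs_sub_ctr_le (h i)

lemma boxNorm_eq_one_iff (h : x ∈ cube b) : boxNorm b x = 1 ↔ len b < hi x := by
  rw [len_lt_hi_iff h]
  constructor
  · intro h1
    obtain ⟨i, hi⟩ := exists_eq_boxNorm (b := b) (x := x) (by rw [h1]; norm_num)
    exact ⟨i, by rw [hi, h1, one_mul]⟩
  · rintro ⟨i, hi⟩
    refine le_antisymm (boxNorm_le_one h) ?_
    have := abs_sub_le_boxNorm b x i
    rw [hi] at this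
    exact (le_mul_iff_one_le_left (wid_pos _)).1 this

lemma half_le_boxNorm (h : x ∈ cube b) {i : Fin n} (hi : b i ≠ 0) : 1 / 2 ≤ boxNorm b x := by
  have h1 := abs_sub_le_boxNorm b x i
  have h2 := one_le_abs_sub_ctr (h i) hi
  have : wid (b i) = 2 := by simp [wid, hi]
  rw [this] at h1
  linarith

lemma exists_ne_zero_of_len_pos (h : 0 < len b) : ∃ i, b i ≠ 0 := by
  obtain ⟨i, -, hi⟩ := Finset.exists_ne_zero_of_sum_ne_zero h.ne'
  exact ⟨i, by simpa using hi⟩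

lemma inv_le_invDist (b : Fin n → ℤ) (x : Fin n → ℝ) {i : Fin n} (hi : b i ≠ 0) :
    |x i - ctr (b i)|⁻¹ ≤ invDist b x := by
  have := norm_le_pi_norm (fun i => if b i = 0 then 0 else (x i - ctr (b i))⁻¹) i
  rwa [Real.norm_eq_abs, if_neg hi, abs_inv] at this

lemma exists_inv_eq_invDist (h : invDist b x ≠ 0) :
    ∃ i, b i ≠ 0 ∧ |x i - ctr (b i)|⁻¹ = invDist b x := by
  obtain ⟨i, hi⟩ := exists_norm_apply_eq h
  by_cases hb : b i = 0
  · simp only [hb, if_true, abs_zero] at hi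
    exact absurd hi.symm h
  · simp only [hb, if_false, abs_inv] at hi
    exact ⟨i, hb, hi⟩

lemma invDist_le_one (h : x ∈ cube b) : invDist b x ≤ 1 := by
  refine (pi_norm_le_iff_of_nonneg zero_le_one).2 fun i => ?_
  split_ifs with hb
  · simp
  · rw [norm_inv, Real.norm_eq_abs]
    exact inv_le_one_of_one_le₀ (one_le_abs_sub_ctr (h i) hb)

lemma invDist_eq_one_iff (h : x ∈ cube b) : invDist b x = 1 ↔ lo x < len b := by
  rw [lo_lt_len_iff h]
  constructor
  · intro h1
    obtain ⟨i, hb, hi⟩ := exists_inv_eq_invDist (b := b) (x := x) (by rw [h1]; norm_num)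
    exact ⟨i, hb, by rw [h1] at hi; exact inv_eq_one.1 hi⟩
  · rintro ⟨i, hb, hi⟩
    refine le_antisymm (invDist_le_one h) ?_
    have := inv_le_invDist b x hb
    rwa [hi, inv_one] at this

lemma invDist_pos (h : x ∈ cube b) (hb : 0 < len b) : 0 < invDist b x := by
  obtain ⟨i, hi⟩ := exists_ne_zero_of_len_pos hb
  refine lt_of_lt_of_le ?_ (inv_le_invDist b x hi)
  have := one_le_abs_sub_ctr (h i) hi
  positivity

lemma boxNorm_pos (h : x ∈ cube b) (hb : 0 < len b) : 0 < boxNorm b x := by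
  obtain ⟨i, hi⟩ := exists_ne_zero_of_len_pos hb
  linarith [half_le_boxNorm h hi]

lemma push_mem_cube (h : x ∈ cube b) (hb : 0 < len b) : push b x ∈ cube b := by
  intro i
  have hp := boxNorm_pos h hb
  refine ctr_add_mem (h i) (inv_nonneg.2 hp.le) (fun hi => ?_) ?_
  · rw [← div_eq_mul_inv, le_div_iff₀ hp]
    linarith [one_le_abs_sub_ctr (h i) hi, boxNorm_le_one h]
  · rw [← div_eq_mul_inv, div_le_iff₀ hp, mul_comm]
    exact abs_sub_le_boxNorm b x i

lemma pull_mem_cube (h : x ∈ cube b) (hb : 0 < len b) : pull b x ∈ cube b := by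
  intro i
  have hp := invDist_pos h hb
  refine ctr_add_mem (h i) hp.le (fun hi => ?_) ?_
  · have h1 := inv_le_invDist b x hi
    have h2 := one_le_abs_sub_ctr (h i) hi
    rwa [inv_le_iff_one_le_mul₀' (by linarith)] at h1
  · have := abs_sub_ctr_le (h i)
    nlinarith [invDist_le_one h, abs_nonneg (x i - ctr (b i))]

/-- Scaling from the centre by `r` multiplies `boxNorm` by `r` and, by `invDist_scale`, `invDist` by
`r⁻¹`. The value 1 of the former marks outer faces and of the latter inner faces, so these two rules
make `push` and `pull` mutually inverse. -/
lemma boxNorm_scale (b : Fin n → ℤ) (x : Fin n → ℝ) {r : ℝ} (hr : 0 ≤ r) :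
    boxNorm b (fun i => ctr (b i) + (x i - ctr (b i)) * r) = boxNorm b x * r := by
  unfold boxNorm
  have : (fun i => (ctr (b i) + (x i - ctr (b i)) * r - ctr (b i)) / wid (b i)) =
      r • fun i => (x i - ctr (b i)) / wid (b i) := by
    funext i; simp only [Pi.smul_apply, smul_eq_mul]; ring
  rw [this, norm_smul, Real.norm_of_nonneg hr, mul_comm]

lemma invDist_scale (b : Fin n → ℤ) (x : Fin n → ℝ) {r : ℝ} (hr : 0 ≤ r) :
    invDist b (fun i => ctr (b i) + (x i - ctr (b i)) * r) = invDist b x * r⁻¹ := by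
  unfold invDist
  have : (fun i => if b i = 0 then 0 else (ctr (b i) + (x i - ctr (b i)) * r - ctr (b i))⁻¹) =
      r⁻¹ • fun i => if b i = 0 then 0 else (x i - ctr (b i))⁻¹ := by
    funext i; simp only [Pi.smul_apply, smul_eq_mul]
    split_ifs
    · simp
    · rw [add_sub_cancel_left, mul_inv, mul_comm]
  rw [this, norm_smul, Real.norm_of_nonneg (inv_nonneg.2 hr), mul_comm]

end

lemma hi_eq_of_notMem {k : ℕ} {x : Fin n → ℝ} (h : x ∈ sphereS n k) (h' : x ∉ sphereS n (k + 1)) :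
    hi x = k + 1 := by
  rw [mem_sphereS] at h h'; omega

lemma lo_eq_of_notMem {k : ℕ} {x : Fin n → ℝ} (h : x ∈ sphereS n (k + 1)) (h' : x ∉ sphereS n k) :
    lo x = k + 1 := by
  rw [mem_sphereS] at h h'; omega

/-- Here `hi x = k + 1`, so the longest cube `b` is a new one, and `x` has `invDist = 1` and
`boxNorm = a < 1`. Dividing distances by `a` gives `boxNorm = 1` and `invDist = a < 1`: the image is
on an outer face and on no inner face, so `b` is its shortest cube. -/
lemma push_facts {k : ℕ} {x : Fin n → ℝ} (h : x ∈ sphereS n k) (h' : x ∉ sphereS n (k + 1)) :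
    push (fun i => outerIdx (x i)) x ∈ sphereS n (k + 1) ∧
    push (fun i => outerIdx (x i)) x ∉ sphereS n k ∧
    (fun i => innerIdx (push (fun i => outerIdx (x i)) x i)) = (fun i => outerIdx (x i)) ∧
    pull (fun i => outerIdx (x i)) (push (fun i => outerIdx (x i)) x) = x ∧
    boxNorm (fun i => outerIdx (x i)) x < 1 := by
  have hk := hi_eq_of_notMem h h'
  have hc := mem_cube_outer x
  have hlen : len (fun i => outerIdx (x i)) = k + 1 := hk
  generalize (fun i => outerIdx (x i)) = b at *
  have hp := boxNorm_pos hc (by omega)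
  have hlt : boxNorm b x < 1 :=
    lt_of_le_of_ne (boxNorm_le_one hc) fun h => by have := (boxNorm_eq_one_iff hc).1 h; omega
  have hm := push_mem_cube hc (by omega)
  have hn1 : boxNorm b (push b x) = 1 := by
    unfold push
    rw [boxNorm_scale b x (inv_nonneg.2 hp.le), mul_inv_cancel₀ hp.ne']
  have h1 : lo (push b x) ≤ len b := lo_le_len hm
  have h2 : len b < hi (push b x) := (boxNorm_eq_one_iff hm).1 hn1
  have hx1 : invDist b x = 1 :=
    (invDist_eq_one_iff hc).2 (by rw [mem_sphereS] at h; omega)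
  have hi2 : invDist b (push b x) = boxNorm b x := by
    unfold push
    rw [invDist_scale b x (inv_nonneg.2 hp.le), hx1, one_mul, inv_inv]
  have h3 : ¬ lo (push b x) < len b := by
    rw [← invDist_eq_one_iff hm, hi2]; exact hlt.ne
  refine ⟨mem_sphereS.2 ⟨by omega, by omega⟩, fun hmem => ?_, ?_, ?_, hlt⟩
  · rw [mem_sphereS] at hmem; omega
  · exact (eq_inner_of_len_eq hm (by omega)).symm
  · funext i
    unfold pull
    rw [hi2]
    unfold push
    field_simp
    ring

/-- The mirror image of `push_facts`, with the shortest cube in place of the longest and inner faces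
exchanged with outer ones. -/
lemma pull_facts {k : ℕ} {x : Fin n → ℝ} (h : x ∈ sphereS n (k + 1)) (h' : x ∉ sphereS n k) :
    pull (fun i => innerIdx (x i)) x ∈ sphereS n k ∧
    pull (fun i => innerIdx (x i)) x ∉ sphereS n (k + 1) ∧
    (fun i => outerIdx (pull (fun i => innerIdx (x i)) x i)) = (fun i => innerIdx (x i)) ∧
    push (fun i => innerIdx (x i)) (pull (fun i => innerIdx (x i)) x) = x := by
  have hk := lo_eq_of_notMem h h'
  have hc := mem_cube_inner x
  have hlen : len (fun i => innerIdx (x i)) = k + 1 := hk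
  generalize (fun i => innerIdx (x i)) = b at *
  have hp := invDist_pos hc (by omega)
  have hlt : invDist b x < 1 :=
    lt_of_le_of_ne (invDist_le_one hc) fun h => by have := (invDist_eq_one_iff hc).1 h; omega
  have hm := pull_mem_cube hc (by omega)
  have hn1 : invDist b (pull b x) = 1 := by
    unfold pull
    rw [invDist_scale b x hp.le, mul_inv_cancel₀ hp.ne']
  have h1 : len b ≤ hi (pull b x) := len_le_hi hm
  have h2 : lo (pull b x) < len b := (invDist_eq_one_iff hm).1 hn1
  have hx1 : boxNorm b x = 1 :=
    (boxNorm_eq_one_iff hc).2 (by rw [mem_sphereS] at h; omega)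
  have hi2 : boxNorm b (pull b x) = invDist b x := by
    unfold pull
    rw [boxNorm_scale b x hp.le, hx1, one_mul]
  have h3 : ¬ len b < hi (pull b x) := by
    rw [← boxNorm_eq_one_iff hm, hi2]; exact hlt.ne
  refine ⟨mem_sphereS.2 ⟨by omega, by omega⟩, fun hmem => ?_, ?_, ?_⟩
  · rw [mem_sphereS] at hmem; omega
  · exact (eq_outer_of_len_eq hm (by omega)).symm
  · funext i
    unfold push
    rw [hi2]
    unfold pull
    field_simp
    ring

open Classical in
/-- The bijection from a sphere to the next one. -/
noncomputable def stageEquiv (n k : ℕ) : sphereS n k ≃ sphereS n (k + 1) where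
  toFun x := if h : (x : Fin n → ℝ) ∈ sphereS n (k + 1) then ⟨x, h⟩ else
    ⟨push (fun i => outerIdx (x.1 i)) x, (push_facts x.2 h).1⟩
  invFun y := if h : (y : Fin n → ℝ) ∈ sphereS n k then ⟨y, h⟩ else
    ⟨pull (fun i => innerIdx (y.1 i)) y, (pull_facts y.2 h).1⟩
  left_inv x := by
    by_cases h : (x : Fin n → ℝ) ∈ sphereS n (k + 1)
    · simp [h]
    · obtain ⟨h1, h2, h3, h4, -⟩ := push_facts x.2 h
      simp only [h, dif_neg, not_false_iff, h2]
      exact Subtype.ext (by simp only [h3, h4])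
  right_inv y := by
    by_cases h : (y : Fin n → ℝ) ∈ sphereS n k
    · simp [h]
    · obtain ⟨h1, h2, h3, h4⟩ := pull_facts y.2 h
      simp only [h, dif_neg, not_false_iff, h2]
      exact Subtype.ext (by simp only [h3, h4])

lemma stageEquiv_of_mem {k : ℕ} {x : sphereS n k} (h : (x : Fin n → ℝ) ∈ sphereS n (k + 1)) :
    (stageEquiv n k x : Fin n → ℝ) = x := by
  simp [stageEquiv, h]

lemma stageEquiv_of_notMem {k : ℕ} {x : sphereS n k} (h : (x : Fin n → ℝ) ∉ sphereS n (k + 1)) :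
    (stageEquiv n k x : Fin n → ℝ) = push (fun i => outerIdx (x.1 i)) x := by
  simp [stageEquiv, h]

/-- The formula `push b` is valid on the whole of `cube b`, since at points that stay exposed
`boxNorm b x = 1` and `push b` is the identity. Hence the two cases of the definition agree on
overlaps. -/
lemma stageEquiv_of_mem_cube {k : ℕ} {x : sphereS n k} {b : Fin n → ℤ} (hb : len b = k + 1)
    (h : (x : Fin n → ℝ) ∈ cube b) : (stageEquiv n k x : Fin n → ℝ) = push b x := by
  by_cases hx : (x : Fin n → ℝ) ∈ sphereS n (k + 1)
  · rw [stageEquiv_of_mem hx]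
    have h1 : boxNorm b x = 1 := (boxNorm_eq_one_iff h).2 (by
      rw [mem_sphereS] at hx; omega)
    funext i
    simp [push, h1]
  · rw [stageEquiv_of_notMem hx]
    rw [eq_outer_of_len_eq h (by rw [hb, hi_eq_of_notMem x.2 hx])]

/-- The cubes of length `k + 1` form a finite closed cover of `S(k)`, and on each of them the map is
the continuous function `push b`. -/
lemma continuous_stageEquiv (n k : ℕ) : Continuous (stageEquiv n k) := by
  have hfin : Finite {b : Fin n → ℤ // len b = k + 1} :=
    ((finite_len_le n (k + 1)).subset fun b (hb : len b = k + 1) =>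
      (hb.le : len b ≤ k + 1)).to_subtype
  refine (locallyFinite_of_finite fun b : {b : Fin n → ℤ // len b = k + 1} =>
    ((↑) : sphereS n k → Fin n → ℝ) ⁻¹' cube b.1).continuous ?_ (fun b =>
      (isClosed_cube b.1).preimage continuous_subtype_val) fun b => ?_
  · refine eq_univ_of_forall fun x => mem_iUnion.2 ?_
    have := mem_sphereS.1 x.2
    obtain ⟨b, hb, hl⟩ := exists_cube_len_eq (x := x.1) (m := k + 1) (by omega) (by omega)
    exact ⟨⟨b, hl⟩, hb⟩
  · rw [Topology.IsInducing.subtypeVal.continuousOn_iff]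
    refine ContinuousOn.congr (f := fun x : sphereS n k => push b.1 x) ?_
      fun x hx => stageEquiv_of_mem_cube b.2 hx
    refine continuousOn_pi.2 fun i => ?_
    have hN : Continuous fun x : sphereS n k => boxNorm b.1 x := by
      have : ∀ i, Continuous fun x : sphereS n k => (x : Fin n → ℝ) i := fun i =>
        (continuous_apply i).comp continuous_subtype_val
      exact (continuous_pi fun i => ((this i).sub continuous_const).div_const _).norm
    refine ContinuousOn.add continuousOn_const (ContinuousOn.mul
      (((continuous_apply i).comp continuous_subtype_val).sub continuous_const).continuousOn
      (hN.continuousOn.inv₀ fun x hx => (boxNorm_pos hx (by rw [b.2]; omega)).ne'))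

/-- The homeomorphism from a sphere to the next one. -/
noncomputable def stage (n k : ℕ) : sphereS n k ≃ₜ sphereS n (k + 1) :=
  (continuous_stageEquiv n k).homeoOfEquivCompactToT2

@[simp] lemma coe_stage (n k : ℕ) : ⇑(stage n k) = stageEquiv n k := rfl

end TorusFSR

namespace TorusFSR

/-! ### Coordinates of points: integers, points of `(0,1)`, and other points -/

/-- `t` is not an integer and does not lie in `(0,1)`. -/
def IsFar (t : ℝ) : Prop := ⌊t⌋ ≠ 0 ∧ ⌊t⌋ ≠ ⌈t⌉

lemma near_iff {t : ℝ} : (0 < t ∧ t < 1) ↔ ⌊t⌋ = 0 ∧ ⌈t⌉ = 1 := by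
  rw [Int.floor_eq_zero_iff, Int.ceil_eq_iff]
  simp only [mem_Ico, Int.cast_one]
  exact ⟨fun h => ⟨⟨h.1.le, h.2⟩, by linarith [h.1], h.2.le⟩, fun h => ⟨by linarith [h.2.1], h.1.2⟩⟩

lemma ceil_eq_of_ne {t : ℝ} (h : ⌊t⌋ ≠ ⌈t⌉) : ⌈t⌉ = ⌊t⌋ + 1 := by
  obtain ⟨h1, h2, -⟩ := floor_ceil_cases t
  omega

lemma eq_floor_of_eq {t : ℝ} (h : ⌊t⌋ = ⌈t⌉) : t = ⌊t⌋ :=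
  le_antisymm (h ▸ Int.le_ceil t) (Int.floor_le t)

lemma not_near_of_far {t : ℝ} (h : IsFar t) : ¬ (0 < t ∧ t < 1) := fun h' => h.1 (near_iff.1 h').1

lemma cases_coord (t : ℝ) : (0 < t ∧ t < 1) ∨ IsFar t ∨ ⌊t⌋ = ⌈t⌉ := by
  rw [near_iff, IsFar]
  by_cases h : ⌊t⌋ = ⌈t⌉
  · exact .inr (.inr h)
  · have := ceil_eq_of_ne h
    by_cases h0 : ⌊t⌋ = 0
    · left; omega
    · exact .inr (.inl ⟨h0, h⟩)

lemma outerIdx_eq (t : ℝ) : outerIdx t = if 0 < ⌈t⌉ then ⌊t⌋ else ⌈t⌉ - 1 := by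
  unfold outerIdx
  simp only [Int.ceil_pos]

lemma innerIdx_eq (t : ℝ) : innerIdx t = if 0 < ⌈t⌉ then ⌈t⌉ - 1 else ⌊t⌋ := by
  unfold innerIdx
  simp only [Int.ceil_pos]

lemma fract_mem_of_ne {t : ℝ} (h : ⌊t⌋ ≠ ⌈t⌉) : 0 < Int.fract t ∧ Int.fract t < 1 := by
  refine ⟨?_, Int.fract_lt_one t⟩
  refine lt_of_le_of_ne (Int.fract_nonneg t) fun h0 => h ?_
  have : t = ⌊t⌋ := by have := Int.self_sub_floor t; linarith
  rw [this]; simp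

lemma outward_mem {t : ℝ} (h : IsFar t) : 0 < outward t ∧ outward t < 1 := by
  have := fract_mem_of_ne h.2
  unfold outward
  split_ifs <;> constructor <;> linarith

/-- The point of the unit interval of `t` with outward coordinate `u`. -/
noncomputable def place (t u : ℝ) : ℝ := if 0 < ⌊t⌋ then ⌊t⌋ + u else ⌈t⌉ - u

lemma place_outward {t : ℝ} (h : IsFar t) : place t (outward t) = t := by
  have := ceil_eq_of_ne h.2
  unfold place outward
  split_ifs
  · exact Int.floor_add_fract t
  · rw [this]; push_cast
    have := Int.floor_add_fract t; linarith

lemma floor_place {t u : ℝ} (h : IsFar t) (hu : 0 < u ∧ u < 1) : ⌊place t u⌋ = ⌊t⌋ := by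
  have := ceil_eq_of_ne h.2
  unfold place
  rw [Int.floor_eq_iff]
  split_ifs
  · constructor <;> linarith
  · rw [this]; push_cast; constructor <;> linarith

lemma ceil_place {t u : ℝ} (h : IsFar t) (hu : 0 < u ∧ u < 1) : ⌈place t u⌉ = ⌈t⌉ := by
  have := ceil_eq_of_ne h.2
  unfold place
  rw [Int.ceil_eq_iff]
  split_ifs
  · rw [this]; push_cast; constructor <;> linarith
  · constructor <;> linarith

lemma isFar_place {t u : ℝ} (h : IsFar t) (hu : 0 < u ∧ u < 1) : IsFar (place t u) := by
  rw [IsFar, floor_place h hu, ceil_place h hu]; exact h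

lemma outward_place {t u : ℝ} (h : IsFar t) (hu : 0 < u ∧ u < 1) : outward (place t u) = u := by
  have h2 := ceil_eq_of_ne h.2
  have h3 := Int.self_sub_floor (place t u)
  rw [floor_place h hu] at h3
  unfold outward
  rw [floor_place h hu, ← h3]
  unfold place
  split_ifs
  · ring
  · rw [h2]; push_cast; ring

lemma place_zero_or_one {t u : ℝ} (hu : u = 0 ∨ u = 1) : ⌊place t u⌋ = ⌈place t u⌉ := by
  have : ∃ z : ℤ, place t u = z := by
    unfold place
    rcases hu with rfl | rfl <;> split_ifs
    exacts [⟨⌊t⌋, by simp⟩, ⟨⌈t⌉, by simp⟩, ⟨⌊t⌋ + 1, by simp⟩, ⟨⌈t⌉ - 1, by simp⟩]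
  obtain ⟨z, hz⟩ := this
  rw [hz]; simp

lemma place_injective (t : ℝ) : Function.Injective (place t) := by
  intro u v h
  unfold place at h
  split_ifs at h <;> linarith

lemma not_near_place {t u : ℝ} (h : IsFar t) (hu : 0 ≤ u ∧ u ≤ 1) :
    ¬ (0 < place t u ∧ place t u < 1) := by
  by_cases hu' : 0 < u ∧ u < 1
  · exact not_near_of_far (isFar_place h hu')
  · intro h'
    have hu2 : u = 0 ∨ u = 1 := by
      by_contra hcon
      push Not at hcon
      exact hu' ⟨lt_of_le_of_ne hu.1 hcon.1.symm, lt_of_le_of_ne hu.2 hcon.2⟩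
    have := near_iff.1 h'
    have := place_zero_or_one (t := t) hu2
    omega

variable {n : ℕ}

/-! ### Cells of the refined cubical structure -/

/-- Only far coordinates need comparison: an integer coordinate is fixed by its floor and has
outward value 0 or 1, while far values lie strictly between, so comparisons with it are automatic.
-/
lemma sameTorusCell_of {x y : Fin n → ℝ} (h : ∀ i, ⌊x i⌋ = ⌊y i⌋ ∧ ⌈x i⌉ = ⌈y i⌉)
    (h' : ∀ i j, IsFar (x i) → IsFar (x j) →
      (outward (x i) < outward (x j) ↔ outward (y i) < outward (y j))) : SameTorusCell x y := by
  refine ⟨h, fun i j hi hj => ?_⟩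
  have hfar : ∀ i, IsFar (x i) → IsFar (y i) := fun i hi => by
    rw [IsFar, ← (h i).1, ← (h i).2]; exact hi
  have hint : ∀ i, ⌊x i⌋ = ⌈x i⌉ → outward (x i) = outward (y i) ∧
      (outward (x i) = 0 ∨ outward (x i) = 1) := fun i hi => by
    have h1 := eq_floor_of_eq hi
    have h2 : y i = x i := by
      rw [h1, eq_floor_of_eq (t := y i) (by rw [← (h i).1, ← (h i).2, hi]), (h i).1]
    refine ⟨by rw [h2], ?_⟩
    unfold outward
    have : Int.fract (x i) = 0 := by rw [h1]; simp
    rw [this]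
    split_ifs <;> simp
  by_cases hi' : ⌊x i⌋ = ⌈x i⌉ <;> by_cases hj' : ⌊x j⌋ = ⌈x j⌉
  · rw [(hint i hi').1, (hint j hj').1]
  · obtain ⟨h1, h2⟩ := hint i hi'
    have h3 := outward_mem ⟨hj, hj'⟩
    have h4 := outward_mem (hfar j ⟨hj, hj'⟩)
    rw [← h1]
    rcases h2 with h2 | h2 <;> rw [h2]
    · exact iff_of_true h3.1 h4.1
    · exact iff_of_false h3.2.not_gt h4.2.not_gt
  · obtain ⟨h1, h2⟩ := hint j hj'
    have h3 := outward_mem ⟨hi, hi'⟩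
    have h4 := outward_mem (hfar i ⟨hi, hi'⟩)
    rw [← h1]
    rcases h2 with h2 | h2 <;> rw [h2]
    · exact iff_of_false h3.1.not_gt h4.1.not_gt
    · exact iff_of_true h3.2 h4.2
  · exact h' i j ⟨hi, hi'⟩ ⟨hj, hj'⟩

/-- The cells of the refined cubical structure as classes of a setoid. -/
def torusSetoid (n : ℕ) : Setoid (Fin n → ℝ) where
  r := SameTorusCell
  iseqv := by
    refine ⟨fun x => ⟨fun i => ⟨rfl, rfl⟩, fun _ _ _ _ => Iff.rfl⟩, fun {x y} h => ?_,
      fun {x y z} h h' => ?_⟩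
    · exact ⟨fun i => ⟨(h.1 i).1.symm, (h.1 i).2.symm⟩, fun i j hi hj =>
        (h.2 i j (by rwa [(h.1 i).1]) (by rwa [(h.1 j).1])).symm⟩
    · exact ⟨fun i => ⟨(h.1 i).1.trans (h'.1 i).1, (h.1 i).2.trans (h'.1 i).2⟩, fun i j hi hj =>
        (h.2 i j hi hj).trans (h'.2 i j (by rwa [← (h.1 i).1]) (by rwa [← (h.1 j).1]))⟩

lemma SameTorusCell.refl (x : Fin n → ℝ) : SameTorusCell x x := (torusSetoid n).refl x

lemma SameTorusCell.symm {x y : Fin n → ℝ} (h : SameTorusCell x y) : SameTorusCell y x :=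
  (torusSetoid n).symm h

lemma SameTorusCell.trans {x y z : Fin n → ℝ} (h : SameTorusCell x y) (h' : SameTorusCell y z) :
    SameTorusCell x z := (torusSetoid n).trans h h'

lemma SameTorusCell.far_iff {x y : Fin n → ℝ} (h : SameTorusCell x y) (i : Fin n) :
    IsFar (x i) ↔ IsFar (y i) := by rw [IsFar, IsFar, (h.1 i).1, (h.1 i).2]

lemma SameTorusCell.near_iff {x y : Fin n → ℝ} (h : SameTorusCell x y) (i : Fin n) :
    (0 < x i ∧ x i < 1) ↔ (0 < y i ∧ y i < 1) := by
  rw [TorusFSR.near_iff, TorusFSR.near_iff, (h.1 i).1, (h.1 i).2]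

lemma SameTorusCell.lt_iff {x y : Fin n → ℝ} (h : SameTorusCell x y) {i j : Fin n}
    (hi : IsFar (x i)) (hj : IsFar (x j)) :
    outward (x i) < outward (x j) ↔ outward (y i) < outward (y j) := h.2 i j hi.1 hj.1

lemma SameTorusCell.eq_iff {x y : Fin n → ℝ} (h : SameTorusCell x y) {i j : Fin n}
    (hi : IsFar (x i)) (hj : IsFar (x j)) :
    outward (x i) = outward (x j) ↔ outward (y i) = outward (y j) := by
  have h1 := h.lt_iff hi hj
  have h2 := h.lt_iff hj hi
  constructor <;> intro h3
  · exact le_antisymm (not_lt.1 fun h => by linarith [h2.2 h]) (not_lt.1 fun h => by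
      linarith [h1.2 h])
  · exact le_antisymm (not_lt.1 fun h => by linarith [h2.1 h]) (not_lt.1 fun h => by
      linarith [h1.1 h])

lemma SameTorusCell.eq_of_int {x y : Fin n → ℝ} (h : SameTorusCell x y) {i : Fin n}
    (hi : ⌊x i⌋ = ⌈x i⌉) : x i = y i := by
  rw [eq_floor_of_eq hi, eq_floor_of_eq (t := y i) (by rw [← (h.1 i).1, ← (h.1 i).2, hi]), (h.1 i).1]

lemma SameTorusCell.outerIdx_eq {x y : Fin n → ℝ} (h : SameTorusCell x y) (i : Fin n) :
    outerIdx (x i) = outerIdx (y i) := by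
  rw [TorusFSR.outerIdx_eq, TorusFSR.outerIdx_eq, (h.1 i).1, (h.1 i).2]

lemma SameTorusCell.innerIdx_eq {x y : Fin n → ℝ} (h : SameTorusCell x y) (i : Fin n) :
    innerIdx (x i) = innerIdx (y i) := by
  rw [TorusFSR.innerIdx_eq, TorusFSR.innerIdx_eq, (h.1 i).1, (h.1 i).2]

lemma SameTorusCell.hi_eq {x y : Fin n → ℝ} (h : SameTorusCell x y) : hi x = hi y := by
  unfold hi; simp only [h.outerIdx_eq]

lemma SameTorusCell.lo_eq {x y : Fin n → ℝ} (h : SameTorusCell x y) : lo x = lo y := by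
  unfold lo; simp only [h.innerIdx_eq]

lemma SameTorusCell.mem_sphereS {x y : Fin n → ℝ} (h : SameTorusCell x y) {k : ℕ} :
    x ∈ sphereS n k ↔ y ∈ sphereS n k := by
  rw [TorusFSR.mem_sphereS, TorusFSR.mem_sphereS, h.hi_eq, h.lo_eq]

lemma SameTorusCell.mem_cube {x y : Fin n → ℝ} (h : SameTorusCell x y) {b : Fin n → ℤ} :
    x ∈ cube b ↔ y ∈ cube b := by
  have : ∀ i, ((b i : ℝ) ≤ x i ∧ x i ≤ b i + 1) ↔ ((b i : ℝ) ≤ y i ∧ y i ≤ b i + 1) := fun i => by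
    rw [mem_Icc_iff_ceil_floor, mem_Icc_iff_ceil_floor, (h.1 i).1, (h.1 i).2]
  exact forall_congr' this

/-- The cell of `x`. -/
def torusCell (x : Fin n → ℝ) : Set (Fin n → ℝ) := {y | SameTorusCell x y}

open Classical in
/-- The indices of the coordinates in `(0,1)`. -/
noncomputable def nearIdx (x : Fin n → ℝ) : List (Fin n) :=
  (List.finRange n).filter fun i => 0 < x i ∧ x i < 1

/-- The coordinates in `(0,1)`, in their order. -/
noncomputable def nearVals (x : Fin n → ℝ) : List ℝ := (nearIdx x).map x

open Classical in
/-- The indices of the noninteger coordinates outside `(0,1)`. -/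
noncomputable def farIdx (x : Fin n → ℝ) : Finset (Fin n) := Finset.univ.filter fun i => IsFar (x i)

/-- The outward coordinates of the noninteger coordinates outside `(0,1)`. -/
noncomputable def farVals (x : Fin n → ℝ) : Multiset ℝ := (farIdx x).val.map fun i => outward (x i)

lemma mem_nearIdx {x : Fin n → ℝ} {i : Fin n} : i ∈ nearIdx x ↔ 0 < x i ∧ x i < 1 := by
  simp [nearIdx]

lemma nodup_nearIdx (x : Fin n → ℝ) : (nearIdx x).Nodup := (List.nodup_finRange n).filter _

lemma mem_farIdx {x : Fin n → ℝ} {i : Fin n} : i ∈ farIdx x ↔ IsFar (x i) := by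
  simp [farIdx]

lemma mem_farVals {x : Fin n → ℝ} {v : ℝ} : v ∈ farVals x ↔ ∃ i, IsFar (x i) ∧ outward (x i) = v := by
  simp [farVals, mem_farIdx]

lemma SameTorusCell.nearIdx_eq {x y : Fin n → ℝ} (h : SameTorusCell x y) :
    nearIdx x = nearIdx y := by
  unfold nearIdx
  simp only [h.near_iff]

lemma SameTorusCell.farIdx_eq {x y : Fin n → ℝ} (h : SameTorusCell x y) :
    farIdx x = farIdx y := by
  ext i
  rw [mem_farIdx, mem_farIdx, h.far_iff]

/-! ### Types of points -/

/-- The combinatorial and metric data of a point of a sphere that determine its image in the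
subdivision complex: the coordinates in `(0,1)`, the outward coordinates, and the number of steps
before the point is covered by a new cube. -/
abbrev Datum : Type := List ℝ × Multiset ℝ × ℕ

/-- Two data belong to the same open cell of the subdivision complex. -/
def SameType (s t : Datum) : Prop :=
  s.1.length = t.1.length ∧ s.2.2 = t.2.2 ∧
    ∃ θ : ℝ → ℝ, StrictMonoOn θ {v | v ∈ s.2.1} ∧ t.2.1 = s.2.1.map θ

/-- `SameType` as a setoid. -/
def typeSetoid : Setoid Datum where
  r := SameType
  iseqv := by
    refine ⟨fun s => ⟨rfl, rfl, id, strictMonoOn_id, by simp⟩, fun {s t} h => ?_,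
      fun {s t r} h h' => ?_⟩
    · obtain ⟨h1, h2, θ, h3, h4⟩ := h
      have hinv : ∀ v ∈ s.2.1, Function.invFunOn θ {v | v ∈ s.2.1} (θ v) = v := fun v hv =>
        h3.injOn.leftInvOn_invFunOn hv
      refine ⟨h1.symm, h2.symm, Function.invFunOn θ {v | v ∈ s.2.1}, ?_, ?_⟩
      · intro a ha b hb hab
        rw [mem_ofPred_eq, h4, Multiset.mem_map] at ha hb
        obtain ⟨a, ha, rfl⟩ := ha
        obtain ⟨b, hb, rfl⟩ := hb
        rw [hinv a ha, hinv b hb]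
        exact (h3.lt_iff_lt ha hb).1 hab
      · rw [h4, Multiset.map_map]
        conv_lhs => rw [← Multiset.map_id s.2.1]
        exact (Multiset.map_congr rfl fun v hv => by simpa using hinv v hv).symm
    · obtain ⟨h1, h2, θ, h3, h4⟩ := h
      obtain ⟨h1', h2', θ', h3', h4'⟩ := h'
      refine ⟨h1.trans h1', h2.trans h2', θ' ∘ θ, ?_, by rw [h4', h4, Multiset.map_map]⟩
      refine h3'.comp h3 fun v hv => ?_
      rw [mem_ofPred_eq, h4]
      exact Multiset.mem_map_of_mem θ hv

/-- The dimension of the cell of a datum. -/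
noncomputable def Datum.dim (s : Datum) : ℕ := s.1.length + s.2.1.toFinset.card

lemma SameType.dim_eq {s t : Datum} (h : SameType s t) : s.dim = t.dim := by
  obtain ⟨h1, h2, θ, h3, h4⟩ := h
  unfold Datum.dim
  rw [h1, h4, Multiset.toFinset_map, Finset.card_image_of_injOn]
  intro a ha b hb
  exact h3.injOn (by simpa using ha) (by simpa using hb)

/-- The datum of a point of the `k`-th sphere. -/
noncomputable def datum (k : ℕ) (x : Fin n → ℝ) : Datum := (nearVals x, farVals x, hi x - 1 - k)

/-- The dimension of the cell of `x`. -/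
noncomputable def cellDim (x : Fin n → ℝ) : ℕ := (nearVals x).length + (farVals x).toFinset.card

lemma SameTorusCell.sameType {x y : Fin n → ℝ} (h : SameTorusCell x y) (k : ℕ) :
    SameType (datum k x) (datum k y) := by
  classical
  refine ⟨by simp [datum, nearVals, h.nearIdx_eq], by simp [datum, h.hi_eq], ?_⟩
  -- The value at `outward (x i)` does not depend on the chosen index, because coordinates with
  -- equal outward values in `x` have equal outward values in `y`.
  let θ : ℝ → ℝ := fun v => if hv : ∃ i, IsFar (x i) ∧ outward (x i) = v then
    outward (y hv.choose) else 0
  have hθ : ∀ i, IsFar (x i) → θ (outward (x i)) = outward (y i) := fun i hi => by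
    have hex : ∃ j, IsFar (x j) ∧ outward (x j) = outward (x i) := ⟨i, hi, rfl⟩
    simp only [θ, dif_pos hex]
    exact (h.eq_iff hex.choose_spec.1 hi).1 hex.choose_spec.2
  refine ⟨θ, ?_, ?_⟩
  · intro a ha b hb hab
    obtain ⟨i, hi, rfl⟩ := mem_farVals.1 ha
    obtain ⟨j, hj, rfl⟩ := mem_farVals.1 hb
    rw [hθ i hi, hθ j hj]
    exact (h.lt_iff hi hj).1 hab
  · simp only [datum, farVals, Multiset.map_map, ← h.farIdx_eq]
    exact Multiset.map_congr rfl fun i hi => (hθ i (mem_farIdx.1 hi)).symm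

lemma SameTorusCell.cellDim_eq {x y : Fin n → ℝ} (h : SameTorusCell x y) : cellDim x = cellDim y :=
  (h.sameType 0).dim_eq

/-- A function on a finite set is determined by its order pattern and its multiset of values. -/
lemma eq_of_map_eq_of_lt_iff {ι : Type*} {A : Finset ι} {f g : ι → ℝ}
    (h : A.val.map f = A.val.map g) (hlt : ∀ i ∈ A, ∀ j ∈ A, f i < f j ↔ g i < g j) :
    ∀ i ∈ A, f i = g i := by
  classical
  have key : ∀ f g : ι → ℝ, A.val.map f = A.val.map g →
      (∀ i ∈ A, ∀ j ∈ A, f i < f j ↔ g i < g j) → ∀ i ∈ A, g i ≤ f i := by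
    intro f g h hlt i hi
    by_contra hcon
    push Not at hcon
    -- Equal multisets have equally many entries `≤ f i`. If `f i < g i`, the order pattern makes
    -- the indices with `g j ≤ f i` a subset of those with `f j ≤ f i`, and a proper one because `i`
    -- is missing.
    have h1 : (A.filter fun j => f j ≤ f i).card = (A.filter fun j => g j ≤ f i).card := by
      have := congrArg (Multiset.countP (· ≤ f i)) h
      rw [Multiset.countP_map, Multiset.countP_map] at this
      exact this
    have h2 : (A.filter fun j => g j ≤ f i) ⊂ (A.filter fun j => f j ≤ f i) := by
      rw [Finset.ssubset_iff_of_subset]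
      · exact ⟨i, by simp [hi], by simp [hcon]⟩
      · intro j hj
        rw [Finset.mem_filter] at hj ⊢
        exact ⟨hj.1, ((hlt j hj.1 i hi).2 (hj.2.trans_lt hcon)).le⟩
    exact (Finset.card_lt_card h2).ne h1.symm
  intro i hi
  exact le_antisymm (key g f h.symm (fun i hi j hj => (hlt i hi j hj).symm) i hi) (key f g h hlt i hi)

/-- Injectivity of the type map on a cell: near values are listed by a common index list, far values
are recovered from their multiset by the common order pattern, and integers are constant on the
cell. -/
lemma SameTorusCell.eq_of_datum_eq {x y : Fin n → ℝ} (h : SameTorusCell x y)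
    (h1 : nearVals x = nearVals y) (h2 : farVals x = farVals y) : x = y := by
  funext i
  rcases cases_coord (x i) with hi | hi | hi
  · unfold nearVals at h1
    rw [← h.nearIdx_eq] at h1
    exact List.map_inj_left.1 h1 i (mem_nearIdx.2 hi)
  · unfold farVals at h2
    rw [← h.farIdx_eq] at h2
    have := eq_of_map_eq_of_lt_iff h2 (fun i hi j hj =>
      h.lt_iff (mem_farIdx.1 hi) (mem_farIdx.1 hj)) i (mem_farIdx.2 hi)
    rw [← place_outward hi, ← place_outward ((h.far_iff i).1 hi), this]
    unfold place
    rw [(h.1 i).1, (h.1 i).2]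
  · exact h.eq_of_int hi

lemma exists_map_eq_of_nodup {ι : Type*} {l : List ι} (hl : l.Nodup) {m : List ℝ}
    (h : l.length = m.length) : ∃ g : ι → ℝ, l.map g = m := by
  classical
  induction l generalizing m with
  | nil => exact ⟨fun _ => 0, by simpa using h.symm⟩
  | cons a l ih =>
    cases m with
    | nil => simp at h
    | cons b m =>
      rw [List.nodup_cons] at hl
      obtain ⟨g, hg⟩ := ih hl.2 (by simpa using h)
      refine ⟨Function.update g a b, ?_⟩
      rw [List.map_cons, Function.update_self, ← hg]
      congr 1
      refine List.map_congr_left fun i hi => ?_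
      rw [Function.update_of_ne]
      rintro rfl; exact hl.1 hi

/-- All entries lie in `(0,1)`. -/
def Datum.Valid (s : Datum) : Prop := (∀ z ∈ s.1, 0 < z ∧ z < 1) ∧ ∀ u ∈ s.2.1, 0 < u ∧ u < 1

lemma valid_datum (k : ℕ) (x : Fin n → ℝ) : (datum k x).Valid := by
  constructor
  · intro z hz
    obtain ⟨i, hi, rfl⟩ := List.mem_map.1 hz
    exact mem_nearIdx.1 hi
  · intro u hu
    obtain ⟨i, hi, rfl⟩ := mem_farVals.1 hu
    exact outward_mem hi

/-- Every datum of the type of `datum k x` is the datum of a point in the cell of `x`. -/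
lemma exists_sameTorusCell_datum_eq {k : ℕ} {x : Fin n → ℝ} {s : Datum} (hs : s.Valid)
    (h : SameType (datum k x) s) : ∃ y, SameTorusCell x y ∧ datum k y = s := by
  classical
  obtain ⟨h1, h2, θ, h3, h4⟩ := h
  obtain ⟨g, hg⟩ := exists_map_eq_of_nodup (nodup_nearIdx x) (m := s.1)
    (by simpa [datum, nearVals] using h1)
  have hg' : ∀ i, 0 < x i ∧ x i < 1 → 0 < g i ∧ g i < 1 := fun i hi =>
    hs.1 _ (hg ▸ List.mem_map_of_mem (mem_nearIdx.2 hi))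
  have hθ : ∀ i, IsFar (x i) → 0 < θ (outward (x i)) ∧ θ (outward (x i)) < 1 := fun i hi =>
    hs.2 _ (by rw [h4]; exact Multiset.mem_map_of_mem θ (mem_farVals.2 ⟨i, hi, rfl⟩))
  -- Only the positions inside the unit intervals are changed: near coordinates take the prescribed
  -- values and far ones are moved by `θ`, which preserves their order.
  let y : Fin n → ℝ := fun i => if 0 < x i ∧ x i < 1 then g i else
    if IsFar (x i) then place (x i) (θ (outward (x i))) else x i
  have hy1 : ∀ i, 0 < x i ∧ x i < 1 → y i = g i := fun i hi => by simp only [y, if_pos hi]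
  have hy2 : ∀ i, IsFar (x i) → y i = place (x i) (θ (outward (x i))) := fun i hi => by
    simp only [y, if_neg (not_near_of_far hi), if_pos hi]
  have hy : SameTorusCell x y := by
    refine sameTorusCell_of (fun i => ?_) fun i j hi hj => ?_
    · rcases cases_coord (x i) with hi | hi | hi
      · rw [hy1 i hi, (near_iff.1 hi).1, (near_iff.1 hi).2, (near_iff.1 (hg' i hi)).1,
          (near_iff.1 (hg' i hi)).2]
        simp
      · rw [hy2 i hi, floor_place hi (hθ i hi), ceil_place hi (hθ i hi)]
        simp
      · have h5 : ¬ (0 < x i ∧ x i < 1) := fun h => by have := near_iff.1 h; omega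
        have h6 : ¬ IsFar (x i) := fun h => h.2 hi
        simp only [y, if_neg h5, if_neg h6, and_self]
    · rw [hy2 i hi, hy2 j hj, outward_place hi (hθ i hi), outward_place hj (hθ j hj)]
      exact (h3.lt_iff_lt (mem_farVals.2 ⟨i, hi, rfl⟩) (mem_farVals.2 ⟨j, hj, rfl⟩)).symm
  refine ⟨y, hy, Prod.ext ?_ (Prod.ext ?_ ?_)⟩
  · simp only [datum, nearVals]
    rw [← hy.nearIdx_eq, ← hg]
    exact List.map_congr_left fun i hi => hy1 i (mem_nearIdx.1 hi)
  · rw [h4]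
    simp only [datum, farVals, Multiset.map_map]
    rw [← hy.farIdx_eq]
    refine Multiset.map_congr rfl fun i hi => ?_
    have hi' := mem_farIdx.1 hi
    rw [hy2 i hi', outward_place hi' (hθ i hi')]; rfl
  · rw [← h2]
    simp only [datum, hy.hi_eq]

end TorusFSR

namespace TorusFSR

/-! ### Charts of cells -/

variable {n : ℕ}

open Classical in
/-- The indices of the coordinates in `(0,1)`, as a finset. -/
noncomputable def nearFin (x : Fin n → ℝ) : Finset (Fin n) :=
  Finset.univ.filter fun i => 0 < x i ∧ x i < 1

lemma mem_nearFin {x : Fin n → ℝ} {i : Fin n} : i ∈ nearFin x ↔ 0 < x i ∧ x i < 1 := by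
  simp [nearFin]

lemma length_nearVals (x : Fin n → ℝ) : (nearVals x).length = (nearFin x).card := by
  classical
  rw [nearVals, List.length_map, ← List.toFinset_card_of_nodup (nodup_nearIdx x)]
  congr 1
  ext i
  rw [List.mem_toFinset, mem_nearIdx, mem_nearFin]

section Chart

variable (x : Fin n → ℝ)

/-- The parameters of the cell of `x`. -/
abbrev CellParam : Type := {i // i ∈ nearFin x} ⊕ {v // v ∈ (farVals x).toFinset}

lemma card_cellParam : Fintype.card (CellParam x) = cellDim x := by
  rw [Fintype.card_sum, Fintype.card_coe, Fintype.card_coe, cellDim, length_nearVals]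

/-- An enumeration of the parameters. -/
noncomputable def paramEquiv : Fin (cellDim x) ≃ CellParam x :=
  (finCongr (card_cellParam x).symm).trans (Fintype.equivFin _).symm

/-- The parameter of a coordinate in `(0,1)`. -/
noncomputable def nearParam (i : {i // i ∈ nearFin x}) : Fin (cellDim x) :=
  (paramEquiv x).symm (.inl i)

/-- The parameter of a common value of outward coordinates. -/
noncomputable def farParam (v : {v // v ∈ (farVals x).toFinset}) : Fin (cellDim x) :=
  (paramEquiv x).symm (.inr v)

lemma param_cases (a : Fin (cellDim x)) : (∃ i, a = nearParam x i) ∨ ∃ v, a = farParam x v := by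
  rcases h : paramEquiv x a with i | v
  · exact .inl ⟨i, by rw [nearParam, ← h, Equiv.symm_apply_apply]⟩
  · exact .inr ⟨v, by rw [farParam, ← h, Equiv.symm_apply_apply]⟩

/-- The domain of the parameters. -/
def paramDomain : Set (Fin (cellDim x) → ℝ) :=
  {p | (∀ a, 0 < p a ∧ p a < 1) ∧ ∀ v w, v.1 < w.1 → p (farParam x v) < p (farParam x w)}

lemma outward_mem_farVals {x : Fin n → ℝ} {i : Fin n} (h : IsFar (x i)) :
    outward (x i) ∈ (farVals x).toFinset :=
  Multiset.mem_toFinset.2 (mem_farVals.2 ⟨i, h, rfl⟩)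

open Classical in
/-- The parametrization of the cell. -/
noncomputable def paramMap (p : Fin (cellDim x) → ℝ) : Fin n → ℝ := fun i =>
  if h : i ∈ nearFin x then p (nearParam x ⟨i, h⟩) else
    if h : IsFar (x i) then place (x i) (p (farParam x ⟨_, outward_mem_farVals h⟩)) else x i

variable {x}

lemma paramMap_near (p : Fin (cellDim x) → ℝ) {i : Fin n} (h : i ∈ nearFin x) :
    paramMap x p i = p (nearParam x ⟨i, h⟩) := by simp only [paramMap, dif_pos h]

lemma paramMap_far (p : Fin (cellDim x) → ℝ) {i : Fin n} (h : IsFar (x i)) :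
    paramMap x p i = place (x i) (p (farParam x ⟨_, outward_mem_farVals h⟩)) := by
  have h' : i ∉ nearFin x := fun hi => not_near_of_far h (mem_nearFin.1 hi)
  simp only [paramMap, dif_neg h', dif_pos h]

lemma paramMap_int (p : Fin (cellDim x) → ℝ) {i : Fin n} (h : ⌊x i⌋ = ⌈x i⌉) :
    paramMap x p i = x i := by
  have h1 : i ∉ nearFin x := fun hi => by have := near_iff.1 (mem_nearFin.1 hi); omega
  have h2 : ¬ IsFar (x i) := fun hi => hi.2 h
  simp only [paramMap, dif_neg h1, dif_neg h2]

variable (x)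

lemma continuous_paramMap : Continuous (paramMap x) := by
  refine continuous_pi fun i => ?_
  unfold paramMap place
  split_ifs <;> fun_prop

lemma paramMap_injective : Function.Injective (paramMap x) := by
  intro p q h
  funext a
  rcases param_cases x a with ⟨i, rfl⟩ | ⟨⟨v, hv⟩, rfl⟩
  · have := congrFun h i.1
    rwa [paramMap_near p i.2, paramMap_near q i.2] at this
  · obtain ⟨i, hi, rfl⟩ := mem_farVals.1 (Multiset.mem_toFinset.1 hv)
    have := congrFun h i
    rw [paramMap_far p hi, paramMap_far q hi] at this
    exact place_injective _ this

lemma isOpen_paramDomain : IsOpen (paramDomain x) := by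
  have : paramDomain x = (⋂ a, {p | 0 < p a} ∩ {p | p a < 1}) ∩
      ⋂ v, ⋂ w, ⋂ _ : v.1 < w.1, {p | p (farParam x v) < p (farParam x w)} := by
    ext p; simp [paramDomain]
  rw [this]
  refine IsOpen.inter (isOpen_iInter_of_finite fun a => ?_) ?_
  · exact (isOpen_lt (by fun_prop) (by fun_prop)).inter (isOpen_lt (by fun_prop) (by fun_prop))
  · exact isOpen_iInter_of_finite fun v => isOpen_iInter_of_finite fun w =>
      isOpen_iInter_of_finite fun _ => isOpen_lt (by fun_prop) (by fun_prop)

lemma convex_paramDomain : Convex ℝ (paramDomain x) := by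
  intro p hp q hq a b ha hb hab
  have hlt : ∀ {s t s' t' : ℝ}, s < t → s' < t' → a * s + b * s' < a * t + b * t' := by
    intro s t s' t' h h'
    rcases ha.eq_or_lt with rfl | ha
    · have : b = 1 := by linarith
      subst this; linarith
    · nlinarith [mul_lt_mul_of_pos_left h ha, mul_le_mul_of_nonneg_left h'.le hb]
  refine ⟨fun i => ⟨?_, ?_⟩, fun v w hvw => ?_⟩
  · have := hlt (hp.1 i).1 (hq.1 i).1
    simpa using this
  · have := hlt (hp.1 i).2 (hq.1 i).2
    simp only [mul_one, hab] at this
    simpa using this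
  · have := hlt (hp.2 v w hvw) (hq.2 v w hvw)
    simpa using this

lemma isBounded_paramDomain : Bornology.IsBounded (paramDomain x) := by
  refine (Metric.isBounded_Icc (0 : Fin (cellDim x) → ℝ) 1).subset fun p hp => ?_
  exact ⟨fun a => (hp.1 a).1.le, fun a => (hp.1 a).2.le⟩

lemma closure_paramDomain {p : Fin (cellDim x) → ℝ} (hp : p ∈ closure (paramDomain x)) :
    (∀ a, 0 ≤ p a ∧ p a ≤ 1) ∧ ∀ v w, v.1 < w.1 → p (farParam x v) ≤ p (farParam x w) := by
  have hcl : IsClosed {p : Fin (cellDim x) → ℝ | (∀ a, 0 ≤ p a ∧ p a ≤ 1) ∧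
      ∀ v w, v.1 < w.1 → p (farParam x v) ≤ p (farParam x w)} := by
    have : {p : Fin (cellDim x) → ℝ | (∀ a, 0 ≤ p a ∧ p a ≤ 1) ∧
      ∀ v w, v.1 < w.1 → p (farParam x v) ≤ p (farParam x w)} = (⋂ a, {p | 0 ≤ p a} ∩ {p | p a ≤ 1}) ∩
      ⋂ v, ⋂ w, ⋂ _ : v.1 < w.1, {p | p (farParam x v) ≤ p (farParam x w)} := by
      ext p; simp
    rw [this]
    refine IsClosed.inter (isClosed_iInter fun a => ?_) ?_
    · exact (isClosed_le (by fun_prop) (by fun_prop)).inter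
        (isClosed_le (by fun_prop) (by fun_prop))
    · exact isClosed_iInter fun v => isClosed_iInter fun w =>
        isClosed_iInter fun _ => isClosed_le (by fun_prop) (by fun_prop)
  refine closure_minimal (s := paramDomain x) ?_ hcl hp
  exact fun p hp => ⟨fun a => ⟨(hp.1 a).1.le, (hp.1 a).2.le⟩, fun v w h => (hp.2 v w h).le⟩

variable {x}

lemma sameTorusCell_paramMap {p : Fin (cellDim x) → ℝ} (hp : p ∈ paramDomain x) :
    SameTorusCell x (paramMap x p) := by
  refine sameTorusCell_of (fun i => ?_) fun i j hi hj => ?_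
  · rcases cases_coord (x i) with hi | hi | hi
    · rw [paramMap_near p (mem_nearFin.2 hi), (near_iff.1 hi).1, (near_iff.1 hi).2,
        (near_iff.1 (hp.1 _)).1, (near_iff.1 (hp.1 _)).2]
      simp
    · rw [paramMap_far p hi, floor_place hi (hp.1 _), ceil_place hi (hp.1 _)]
      simp
    · rw [paramMap_int p hi]; simp
  · rw [paramMap_far p hi, paramMap_far p hj, outward_place hi (hp.1 _), outward_place hj (hp.1 _)]
    constructor
    · intro h
      exact hp.2 _ _ h
    · intro h
      by_contra hcon
      rcases (not_lt.1 hcon).eq_or_lt with h' | h'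
      · simp only [h', lt_irrefl] at h
      · exact h.not_gt (hp.2 ⟨_, outward_mem_farVals hj⟩ ⟨_, outward_mem_farVals hi⟩ h')

lemma exists_paramMap_eq {y : Fin n → ℝ} (h : SameTorusCell x y) :
    ∃ p ∈ paramDomain x, paramMap x p = y := by
  have hex : ∀ v : {v // v ∈ (farVals x).toFinset}, ∃ i, IsFar (x i) ∧ outward (x i) = v.1 :=
    fun v => mem_farVals.1 (Multiset.mem_toFinset.1 v.2)
  choose c hc hc' using hex
  let p : Fin (cellDim x) → ℝ := fun a =>
    Sum.elim (fun i => y i.1) (fun v => outward (y (c v))) (paramEquiv x a)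
  have hp1 : ∀ i, p (nearParam x i) = y i.1 := fun i => by simp [p, nearParam]
  have hp2 : ∀ v, p (farParam x v) = outward (y (c v)) := fun v => by simp [p, farParam]
  refine ⟨p, ⟨fun a => ?_, fun v w hvw => ?_⟩, ?_⟩
  · rcases param_cases x a with ⟨i, rfl⟩ | ⟨v, rfl⟩
    · rw [hp1]; exact (h.near_iff i).1 (mem_nearFin.1 i.2)
    · rw [hp2]; exact outward_mem ((h.far_iff _).1 (hc v))
  · rw [hp2, hp2, ← h.lt_iff (hc v) (hc w), hc', hc']; exact hvw
  · funext i
    rcases cases_coord (x i) with hi | hi | hi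
    · rw [paramMap_near p (mem_nearFin.2 hi), hp1]
    · rw [paramMap_far p hi, hp2]
      have h1 : outward (y (c ⟨_, outward_mem_farVals hi⟩)) = outward (y i) :=
        (h.eq_iff (hc _) hi).1 (hc' _)
      rw [h1]
      conv_rhs => rw [← place_outward ((h.far_iff i).1 hi)]
      unfold place
      rw [(h.1 i).1, (h.1 i).2]
    · rw [paramMap_int p hi, h.eq_of_int hi]

/-- The dimension is at most the number of distinct parameter values in `(0,1)`, with near and far
parameters counted separately. If it does not drop, then no parameter has reached 0 or 1 and no two
far ones have merged, so `p` is still in the domain. -/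
lemma cellDim_paramMap_lt {p : Fin (cellDim x) → ℝ} (hp : p ∈ closure (paramDomain x))
    (hp' : p ∉ paramDomain x) : cellDim (paramMap x p) < cellDim x := by
  classical
  obtain ⟨h1, h2⟩ := closure_paramDomain x hp
  by_contra hcon
  apply hp'
  set y := paramMap x p with hy
  let A : Finset {i // i ∈ nearFin x} := Finset.univ.filter fun i =>
    0 < p (nearParam x i) ∧ p (nearParam x i) < 1
  let B : Finset {v // v ∈ (farVals x).toFinset} := Finset.univ.filter fun v =>
    0 < p (farParam x v) ∧ p (farParam x v) < 1
  have hA : (nearFin y).card ≤ A.card := by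
    have : nearFin y ⊆ A.map (Function.Embedding.subtype _) := by
      intro i hi
      rw [mem_nearFin] at hi
      have hix : i ∈ nearFin x := by
        rcases cases_coord (x i) with h | h | h
        · exact mem_nearFin.2 h
        · rw [hy, paramMap_far p h] at hi
          exact absurd hi (not_near_place h (h1 _))
        · rw [hy, paramMap_int p h] at hi
          exact mem_nearFin.2 hi
      rw [hy, paramMap_near p hix] at hi
      exact Finset.mem_map.2 ⟨⟨i, hix⟩, by simpa [A] using hi, rfl⟩
    simpa using Finset.card_le_card this
  have hB : (farVals y).toFinset ⊆ B.image fun v => p (farParam x v) := by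
    intro u hu
    obtain ⟨i, hi, rfl⟩ := mem_farVals.1 (Multiset.mem_toFinset.1 hu)
    rcases cases_coord (x i) with h | h | h
    · have h3 := mem_nearFin.2 h
      rw [hy, paramMap_near p h3] at hi
      obtain ⟨h4, h5⟩ := h1 (nearParam x ⟨i, h3⟩)
      rcases h4.eq_or_lt with h4 | h4
      · rw [← h4] at hi; simp [IsFar] at hi
      · rcases h5.eq_or_lt with h5 | h5
        · rw [h5] at hi; simp [IsFar] at hi
        · exact absurd ⟨h4, h5⟩ (not_near_of_far hi)
    · rw [hy, paramMap_far p h] at hi ⊢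
      set w : {v // v ∈ (farVals x).toFinset} := ⟨_, outward_mem_farVals h⟩
      obtain ⟨h4, h5⟩ := h1 (farParam x w)
      have h6 : 0 < p (farParam x w) ∧ p (farParam x w) < 1 := by
        refine ⟨lt_of_le_of_ne h4 fun h0 => hi.2 (place_zero_or_one (.inl h0.symm)),
          lt_of_le_of_ne h5 fun h0 => hi.2 (place_zero_or_one (.inr h0))⟩
      rw [outward_place h h6]
      exact Finset.mem_image.2 ⟨w, by simpa [B] using h6, rfl⟩
    · rw [hy, paramMap_int p h] at hi
      exact absurd h hi.2
  have hB' := Finset.card_le_card hB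
  have hBi : (B.image fun v => p (farParam x v)).card ≤ B.card := Finset.card_image_le
  have hA2 : A.card ≤ Fintype.card {i // i ∈ nearFin x} := Finset.card_le_univ A
  have hB2 : B.card ≤ Fintype.card {v // v ∈ (farVals x).toFinset} := Finset.card_le_univ B
  rw [cellDim, cellDim, length_nearVals, length_nearVals] at hcon
  rw [Fintype.card_coe] at hA2 hB2
  have hAu : A = Finset.univ := by
    rw [← Finset.card_eq_iff_eq_univ, Fintype.card_coe]; omega
  have hBu : B = Finset.univ := by
    rw [← Finset.card_eq_iff_eq_univ, Fintype.card_coe]; omega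
  have hinj : Set.InjOn (fun v => p (farParam x v)) B := by
    rw [← Finset.card_image_iff]; omega
  refine ⟨fun a => ?_, fun v w hvw => lt_of_le_of_ne (h2 v w hvw) fun h => ?_⟩
  · rcases param_cases x a with ⟨i, rfl⟩ | ⟨v, rfl⟩
    · have : i ∈ A := hAu ▸ Finset.mem_univ i
      simpa [A] using this
    · have : v ∈ B := hBu ▸ Finset.mem_univ v
      simpa [B] using this
  · have := hinj (by simp [hBu]) (by simp [hBu]) h
    rw [this] at hvw
    exact lt_irrefl _ hvw

variable (x)

/-- A chart of the closed cell of `x`. -/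
structure IsCellChart {m : ℕ} (ρ : (Fin m → ℝ) → Fin n → ℝ) : Prop where
  dim_eq : cellDim x = m
  continuous : Continuous ρ
  injective : Function.Injective ρ
  image_ball : ρ '' Metric.ball 0 1 = torusCell x
  image_closedBall : ρ '' Metric.closedBall 0 1 = closure (torusCell x)
  sphere : ∀ v ∈ Metric.sphere (0 : Fin m → ℝ) 1, cellDim (ρ v) < m

lemma image_paramDomain : paramMap x '' paramDomain x = torusCell x := by
  ext y
  constructor
  · rintro ⟨p, hp, rfl⟩; exact sameTorusCell_paramMap hp
  · intro hy
    obtain ⟨p, hp, rfl⟩ := exists_paramMap_eq hy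
    exact ⟨p, hp, rfl⟩

/-- The parameter domain is open, convex, bounded and nonempty, so its closure is carried to the
closed unit ball by a homeomorphism of the whole space; its inverse followed by `paramMap` is the
chart. -/
lemma exists_isCellChart {m : ℕ} (hm : cellDim x = m) :
    ∃ ρ : (Fin m → ℝ) → Fin n → ℝ, IsCellChart x ρ := by
  subst hm
  have hne : (interior (paramDomain x)).Nonempty := by
    obtain ⟨p, hp, -⟩ := exists_paramMap_eq (SameTorusCell.refl x)
    exact ⟨p, by rwa [(isOpen_paramDomain x).interior_eq]⟩
  obtain ⟨h, h1, h2, h3⟩ := exists_homeomorph_image_interior_closure_frontier_eq_unitBall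
    (convex_paramDomain x) hne (isBounded_paramDomain x)
  rw [(isOpen_paramDomain x).interior_eq] at h1
  have himg : ∀ s, (paramMap x ∘ h.symm) '' (h '' s) = paramMap x '' s := fun s => by
    rw [image_comp, ← image_comp h.symm h]
    simp
  refine ⟨paramMap x ∘ h.symm, rfl, (continuous_paramMap x).comp h.symm.continuous,
    (paramMap_injective x).comp h.symm.injective, ?_, ?_, ?_⟩
  · rw [← h1, himg, image_paramDomain]
  · rw [← h2, himg, ← image_paramDomain]
    exact image_closure_of_isCompact (isBounded_paramDomain x).isCompact_closure
      (continuous_paramMap x).continuousOn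
  · intro v hv
    rw [← h3] at hv
    obtain ⟨p, hp, rfl⟩ := hv
    rw [(isOpen_paramDomain x).frontier_eq] at hp
    simpa using cellDim_paramMap_lt hp.1 hp.2

variable {x}

/-- A chart of a cell, followed by a map that is injective on the cell, is a characteristic map. -/
lemma IsCellChart.exists_isCharMap {m : ℕ} {ρ : (Fin m → ℝ) → Fin n → ℝ} (hρ : IsCellChart x ρ)
    {X : Type*} [TopologicalSpace X] {C : Set X} {dim : X → ℕ} {K : Set (Fin n → ℝ)} (φ : K → X)
    (hφ : Continuous φ) (hC : ∀ y, φ y ∈ C ∧ dim (φ y) = cellDim y.1)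
    (hK : closure (torusCell x) ⊆ K)
    (hinj : ∀ y y' : K, SameTorusCell x y → SameTorusCell x y' → φ y = φ y' → y = y') :
    ∃ f, IsCharMap C dim m (φ '' {y | SameTorusCell x y}) f ∧
      ∀ v ∈ Metric.closedBall (0 : Fin m → ℝ) 1, ∃ h, f v = φ ⟨ρ v, h⟩ := by
  classical
  have hmem : ∀ v ∈ Metric.closedBall (0 : Fin m → ℝ) 1, ρ v ∈ K := fun v hv =>
    hK (hρ.image_closedBall ▸ mem_image_of_mem ρ hv)
  have hx : x ∈ K := hK (subset_closure (SameTorusCell.refl x))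
  -- The second branch is a default value; it is not used on the closed ball, which `ρ` maps into
  -- `K`.
  let f : (Fin m → ℝ) → X := fun v => if h : ρ v ∈ K then φ ⟨ρ v, h⟩ else φ ⟨x, hx⟩
  have hf : ∀ v (h : ρ v ∈ K), f v = φ ⟨ρ v, h⟩ := fun v h => dif_pos h
  have hb : ∀ v ∈ Metric.ball (0 : Fin m → ℝ) 1, SameTorusCell x (ρ v) := fun v hv => by
    have : ρ v ∈ torusCell x := by rw [← hρ.image_ball]; exact mem_image_of_mem ρ hv
    exact this
  have hbK : ∀ v ∈ Metric.ball (0 : Fin m → ℝ) 1, ρ v ∈ K := fun v hv =>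
    hmem v (Metric.ball_subset_closedBall hv)
  refine ⟨f, ⟨?_, ?_, ?_, ?_⟩, fun v hv => ⟨hmem v hv, hf v _⟩⟩
  · rw [continuousOn_iff_continuous_domRestrict]
    have : Continuous fun v : Metric.closedBall (0 : Fin m → ℝ) 1 =>
        φ ⟨ρ v, hmem v v.2⟩ :=
      hφ.comp ((hρ.continuous.comp continuous_subtype_val).subtype_mk _)
    exact this.congr fun v => (hf v _).symm
  · intro v hv w hw h
    rw [hf v (hbK v hv), hf w (hbK w hw)] at h
    exact hρ.injective (congrArg Subtype.val (hinj _ _ (hb v hv) (hb w hw) h))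
  · ext s
    constructor
    · rintro ⟨v, hv, rfl⟩
      exact ⟨⟨ρ v, hbK v hv⟩, hb v hv, (hf v _).symm⟩
    · rintro ⟨⟨y, hy⟩, hxy, rfl⟩
      have : y ∈ ρ '' Metric.ball 0 1 := by rw [hρ.image_ball]; exact hxy
      obtain ⟨v, hv, rfl⟩ := this
      exact ⟨v, hv, hf v hy⟩
  · intro v hv
    have h1 := hmem v (Metric.sphere_subset_closedBall hv)
    rw [hf v h1]
    exact ⟨(hC _).1, (hC _).2 ▸ hρ.sphere v hv⟩

end Chart

/-! ### Counting -/

open Classical in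
/-- The number of integer coordinates. -/
noncomputable def intFin (x : Fin n → ℝ) : Finset (Fin n) := Finset.univ.filter fun i => ⌊x i⌋ = ⌈x i⌉

lemma mem_intFin {x : Fin n → ℝ} {i : Fin n} : i ∈ intFin x ↔ ⌊x i⌋ = ⌈x i⌉ := by
  simp [intFin]

lemma card_add_card_add_card (x : Fin n → ℝ) :
    (nearFin x).card + (farIdx x).card + (intFin x).card = n := by
  classical
  have h1 : Disjoint (nearFin x) (farIdx x) := Finset.disjoint_left.2 fun i hi hi' =>
    not_near_of_far (mem_farIdx.1 hi') (mem_nearFin.1 hi)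
  have h2 : Disjoint (nearFin x ∪ farIdx x) (intFin x) := Finset.disjoint_left.2 fun i hi hi' => by
    have h3 := mem_intFin.1 hi'
    rcases Finset.mem_union.1 hi with h | h
    · have := near_iff.1 (mem_nearFin.1 h); omega
    · exact (mem_farIdx.1 h).2 h3
  rw [← Finset.card_union_of_disjoint h1, ← Finset.card_union_of_disjoint h2]
  have : nearFin x ∪ farIdx x ∪ intFin x = Finset.univ := by
    ext i
    simp only [Finset.mem_union, mem_nearFin, mem_farIdx, mem_intFin, Finset.mem_univ, iff_true]
    rcases cases_coord (x i) with h | h | h <;> simp [h]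
  rw [this, Finset.card_univ, Fintype.card_fin]

lemma natAbs_outerIdx_eq (t : ℝ) : (outerIdx t).natAbs =
    (innerIdx t).natAbs + if ⌊t⌋ = ⌈t⌉ then 1 else 0 := by
  rw [outerIdx_eq, innerIdx_eq]
  obtain ⟨h1, h2, -⟩ := floor_ceil_cases t
  split_ifs <;> omega

/-- An integer coordinate lies in two unit intervals whose indices differ by one in absolute value;
any other coordinate lies in only one. In particular a point of a sphere has an integer coordinate.
-/
lemma hi_eq_lo_add (x : Fin n → ℝ) : hi x = lo x + (intFin x).card := by
  classical
  rw [hi, lo, intFin, Finset.card_filter, ← Finset.sum_add_distrib]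
  exact Finset.sum_congr rfl fun i _ => natAbs_outerIdx_eq (x i)

lemma card_farVals (x : Fin n → ℝ) : (farVals x).card = (farIdx x).card := by
  simp [farVals]

lemma cellDim_le (x : Fin n → ℝ) : cellDim x + (intFin x).card ≤ n := by
  have h1 := card_add_card_add_card x
  have h2 := Multiset.toFinset_card_le (farVals x)
  rw [card_farVals] at h2
  rw [cellDim, length_nearVals]
  omega

lemma cellDim_le_of_mem {k : ℕ} {x : Fin n → ℝ} (h : x ∈ sphereS n k) : cellDim x ≤ n - 1 := by
  have h1 := cellDim_le x
  have h2 := hi_eq_lo_add x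
  rw [mem_sphereS] at h
  omega

open Classical in
/-- Bounded sets meet finitely many cells. -/
lemma finite_torusCell_image {K : Set (Fin n → ℝ)} {c : ℤ}
    (hK : ∀ x ∈ K, ∀ i, -(c : ℝ) ≤ x i ∧ x i ≤ c) : (torusCell '' K).Finite := by
  -- This signature determines the cell and takes finitely many values on a bounded set.
  let sig : (Fin n → ℝ) → (Fin n → ℤ × ℤ) × (Fin n → Fin n → Prop) := fun x =>
    (fun i => (⌊x i⌋, ⌈x i⌉), fun i j => outward (x i) < outward (x j))
  have h1 : (sig '' K).Finite := by
    refine Set.Finite.subset ((Set.Finite.pi' fun _ : Fin n =>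
      (Set.finite_Icc (-c) c).prod (Set.finite_Icc (-c) c)).prod Set.finite_univ) ?_
    rintro _ ⟨x, hx, rfl⟩
    refine ⟨fun i => ⟨⟨?_, ?_⟩, ?_, ?_⟩, mem_univ _⟩
    · exact Int.le_floor.2 (by push_cast; exact (hK x hx i).1)
    · exact_mod_cast (Int.floor_le (x i)).trans (hK x hx i).2
    · exact_mod_cast (hK x hx i).1.trans (Int.le_ceil (x i))
    · exact Int.ceil_le.2 (hK x hx i).2
  choose f hf using fun s : sig '' K => s.2
  refine (h1.dependent_image fun s hs => torusCell (f ⟨s, hs⟩)).subset ?_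
  rintro _ ⟨x, hx, rfl⟩
  refine ⟨sig x, ⟨x, hx, rfl⟩, ?_⟩
  have h2 := (hf ⟨sig x, x, hx, rfl⟩).2
  set y := f ⟨sig x, x, hx, rfl⟩
  have h3 : SameTorusCell y x := by
    refine ⟨fun i => ?_, fun i j _ _ => ?_⟩
    · have := congrFun (congrArg Prod.fst h2) i
      exact ⟨congrArg Prod.fst this, congrArg Prod.snd this⟩
    · have := congrFun (congrFun (congrArg Prod.snd h2) i) j
      exact iff_of_eq this
  ext z
  exact ⟨fun h => h3.symm.trans h, fun h => h3.trans h⟩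

end TorusFSR

namespace TorusFSR

/-! ### The space of the subdivision complex -/

variable {n : ℕ}

/-- The space of the subdivision complex: all data of points of spheres. -/
def TypeSpace (n : ℕ) : Type := {s : Datum // ∃ k, ∃ x ∈ sphereS n k, datum k x = s}

/-- The type of a point of the `k`-th sphere. -/
noncomputable def toType (n k : ℕ) (x : sphereS n k) : TypeSpace n :=
  ⟨datum k x.1, k, x.1, x.2, rfl⟩

noncomputable instance (n : ℕ) : TopologicalSpace (TypeSpace n) :=
  ⨆ k, TopologicalSpace.coinduced (toType n k) inferInstance

lemma continuous_toType (n k : ℕ) : Continuous (toType n k) :=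
  continuous_iff_coinduced_le.2 (le_iSup (fun k => TopologicalSpace.coinduced (toType n k)
    inferInstance) k)

lemma continuous_of_comp_toType {Z : Type*} [TopologicalSpace Z] {f : TypeSpace n → Z}
    (h : ∀ k, Continuous (f ∘ toType n k)) : Continuous f :=
  continuous_iSup_dom.2 fun k => continuous_coinduced_dom.2 (h k)

lemma exists_toType_eq (s : TypeSpace n) : ∃ k x, toType n k x = s := by
  obtain ⟨s, k, x, hx, rfl⟩ := s
  exact ⟨k, ⟨x, hx⟩, rfl⟩

lemma TypeSpace.valid (s : TypeSpace n) : s.1.Valid := by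
  obtain ⟨k, x, rfl⟩ := exists_toType_eq s
  exact valid_datum k x.1

/-! #### Functions that separate the types -/

/-- Sums of products of values of functions at increasing positions of a list. -/
noncomputable def iterSum : List (ℝ → ℝ) → List ℝ → ℝ
  | [], _ => 1
  | _ :: _, [] => 0
  | g :: gs, z :: l => iterSum (g :: gs) l + g z * iterSum gs l

lemma iterSum_nonneg {gs : List (ℝ → ℝ)} (h : ∀ g ∈ gs, ∀ t, 0 ≤ g t) (l : List ℝ) :
    0 ≤ iterSum gs l := by
  induction l generalizing gs with
  | nil => cases gs <;> simp [iterSum]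
  | cons z l ih =>
    cases gs with
    | nil => simp [iterSum]
    | cons g gs =>
      simp only [iterSum]
      exact add_nonneg (ih h) (mul_nonneg (h g List.mem_cons_self z)
        (ih fun g hg => h g (List.mem_cons_of_mem _ hg)))

lemma iterSum_eq_zero {gs : List (ℝ → ℝ)} {l : List ℝ} (h : l.length < gs.length) :
    iterSum gs l = 0 := by
  induction l generalizing gs with
  | nil => cases gs with
    | nil => simp at h
    | cons g gs => rfl
  | cons z l ih =>
    cases gs with
    | nil => simp at h
    | cons g gs =>
      simp only [List.length_cons] at h
      simp only [iterSum]
      rw [ih (by simp only [List.length_cons]; omega), ih (by omega), mul_zero, add_zero]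

/-- Entries at which all test functions vanish do not matter. Thus, for functions supported in
`(0,1)`, the sum over the near coordinates equals the sum over all coordinates, which is continuous
even where near coordinates appear or disappear. -/
lemma iterSum_filter {gs : List (ℝ → ℝ)} {P : ℝ → Prop} [DecidablePred P]
    (h : ∀ g ∈ gs, ∀ t, ¬ P t → g t = 0) (l : List ℝ) :
    iterSum gs (l.filter fun t => P t) = iterSum gs l := by
  induction l generalizing gs with
  | nil => rfl
  | cons z l ih =>
    cases gs with
    | nil => simp [iterSum]
    | cons g gs =>
      by_cases hz : P z
      · rw [List.filter_cons_of_pos (by simpa using hz)]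
        simp only [iterSum]
        rw [ih h, ih fun g hg => h g (List.mem_cons_of_mem _ hg)]
      · rw [List.filter_cons_of_neg (by simpa using hz)]
        simp only [iterSum]
        rw [ih h, h g List.mem_cons_self z hz, zero_mul, add_zero]

lemma continuous_iterSum {gs : List (ℝ → ℝ)} (h : ∀ g ∈ gs, Continuous g) (l : List (Fin n)) :
    Continuous fun x : Fin n → ℝ => iterSum gs (l.map x) := by
  induction l generalizing gs with
  | nil => exact (continuous_const : Continuous fun _ : Fin n → ℝ => iterSum gs [])
  | cons i l ih =>
    cases gs with
    | nil => exact (continuous_const : Continuous fun _ : Fin n → ℝ => (1 : ℝ))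
    | cons g gs =>
      simp only [List.map_cons, iterSum]
      exact (ih h).add (((h g List.mem_cons_self).comp (continuous_apply i)).mul
        (ih fun g hg => h g (List.mem_cons_of_mem _ hg)))

lemma one_le_iterSum {b : ℝ → ℝ → ℝ} {l : List ℝ} (h0 : ∀ z t, 0 ≤ b z t)
    (h1 : ∀ z ∈ l, b z z = 1) : 1 ≤ iterSum (l.map b) l := by
  induction l with
  | nil => simp [iterSum]
  | cons z l ih =>
    simp only [List.map_cons, iterSum]
    rw [h1 z List.mem_cons_self]
    have h2 := ih fun z hz => h1 z (List.mem_cons_of_mem _ hz)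
    have h3 := iterSum_nonneg (gs := b z :: l.map b) (by
      intro g hg t
      rw [← List.map_cons] at hg
      obtain ⟨z, -, rfl⟩ := List.mem_map.1 hg
      exact h0 z t) l
    linarith

/-- A list `m` that is no longer than `l` admits at most one selection of full length, the diagonal
one, and it contains a zero factor as soon as some entry differs. -/
lemma iterSum_eq_zero_of_ne {b : ℝ → ℝ → ℝ} {l m : List ℝ} (hlen : m.length ≤ l.length)
    (hne : m ≠ l) (h : ∀ z ∈ l, ∀ w ∈ m, w ≠ z → b z w = 0) : iterSum (l.map b) m = 0 := by
  induction l generalizing m with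
  | nil => exact absurd (by simpa using hlen) hne
  | cons z l ih =>
    cases m with
    | nil => rfl
    | cons w m =>
      simp only [List.length_cons] at hlen
      simp only [List.map_cons, iterSum]
      rw [iterSum_eq_zero (by simp only [List.length_cons, List.length_map]; omega), zero_add]
      by_cases hw : w = z
      · subst hw
        rw [ih (by omega) (fun h => hne (by rw [h])) fun z hz w hw =>
          h z (List.mem_cons_of_mem _ hz) w (List.mem_cons_of_mem _ hw), mul_zero]
      · rw [h z List.mem_cons_self w List.mem_cons_self hw, zero_mul]

lemma exists_bump {F : Set ℝ} (hF : IsClosed F) (hne : F.Nonempty) {z : ℝ} (hz : z ∉ F) :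
    ∃ g : ℝ → ℝ, Continuous g ∧ (∀ t, 0 ≤ g t) ∧ g z = 1 ∧ ∀ t ∈ F, g t = 0 := by
  have hpos := (hF.notMem_iff_infDist_pos hne).1 hz
  refine ⟨fun t => Metric.infDist t F / Metric.infDist z F,
    (Metric.continuous_infDist_pt F).div_const _, fun t => ?_, div_self hpos.ne', fun t ht => ?_⟩
  · exact div_nonneg Metric.infDist_nonneg Metric.infDist_nonneg
  · simp only [Metric.infDist_zero_of_mem ht, zero_div]

lemma nearVals_eq_filter (x : Fin n → ℝ) [DecidablePred fun t : ℝ => 0 < t ∧ t < 1] :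
    nearVals x = ((List.finRange n).map x).filter fun t => 0 < t ∧ t < 1 := by
  rw [List.filter_map, nearVals, nearIdx]
  congr 1
  refine List.filter_congr fun i _ => ?_
  simp

/-- One bump is used for each entry of the longer list `s.1.1`. The diagonal selection contributes 1
at `s`, while every selection at `t` vanishes. -/
lemma exists_separating_of_near {s t : TypeSpace n} (h : t.1.1 ≠ s.1.1)
    (hlen : t.1.1.length ≤ s.1.1.length) :
    ∃ f : TypeSpace n → ℝ, Continuous f ∧ f s ≠ f t := by
  classical
  have hb : ∀ z : ℝ, ∃ g : ℝ → ℝ, Continuous g ∧ (∀ u, 0 ≤ g u) ∧ (z ∈ s.1.1 → g z = 1) ∧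
      (∀ w ∈ t.1.1, w ≠ z → g w = 0) ∧ ∀ u, ¬ (0 < u ∧ u < 1) → g u = 0 := by
    intro z
    by_cases hz : z ∈ s.1.1
    · have hz' := s.valid.1 z hz
      obtain ⟨g, h1, h2, h3, h4⟩ := exists_bump
        -- The half-lines give support in `(0,1)`, as `iterSum_filter` needs; the finite set makes
        -- the bump vanish at the other entries of `t`.
        (F := (Iic 0 ∪ Ici 1) ∪ ((t.1.1.toFinset.erase z : Finset ℝ) : Set ℝ)) (z := z)
        ((isClosed_Iic.union isClosed_Ici).union (Finset.finite_toSet _).isClosed)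
        ⟨0, .inl (.inl self_mem_Iic)⟩ (by
          rintro ((h | h) | h)
          · exact absurd hz'.1 (not_lt.2 h)
          · exact absurd hz'.2 (not_lt.2 h)
          · simp at h)
      refine ⟨g, h1, h2, fun _ => h3, fun w hw hwz => h4 w (.inr ?_), fun u hu => h4 u (.inl ?_)⟩
      · simp [hw, hwz]
      · by_cases h0 : 0 < u
        · exact .inr (not_lt.1 fun h1 => hu ⟨h0, h1⟩)
        · exact .inl (not_lt.1 h0)
    · exact ⟨fun _ => 0, continuous_const, fun _ => le_rfl, fun h => absurd h hz, fun _ _ _ => rfl,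
        fun _ _ => rfl⟩
  choose b h1 h2 h3 h4 h5 using hb
  refine ⟨fun r => iterSum (s.1.1.map b) r.1.1, ?_, ?_⟩
  · refine continuous_of_comp_toType fun k => ?_
    have h6 : (fun r : TypeSpace n => iterSum (s.1.1.map b) r.1.1) ∘ toType n k =
        fun x => iterSum (s.1.1.map b) ((List.finRange n).map x.1) := by
      funext x
      simp only [Function.comp_apply, toType, datum]
      rw [nearVals_eq_filter, iterSum_filter]
      intro g hg t ht
      obtain ⟨z, -, rfl⟩ := List.mem_map.1 hg
      exact h5 z t ht
    rw [h6]
    refine (continuous_iterSum (fun g hg => ?_) _).comp continuous_subtype_val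
    obtain ⟨z, -, rfl⟩ := List.mem_map.1 hg
    exact h1 z
  · have h6 := one_le_iterSum (l := s.1.1) h2 h3
    have h7 := iterSum_eq_zero_of_ne hlen h fun z _ => h4 z
    simp only [h7]
    linarith

/-- The contribution of a coordinate to `∑ g(u)`. -/
noncomputable def coordWeight (g : ℝ → ℝ) (t : ℝ) : ℝ :=
  g (min |2 * t - 1| 1) + ((g (Int.fract (max ((|2 * t - 1| - 1) / 2) 0)) -
    g 1 * Int.fract (max ((|2 * t - 1| - 1) / 2) 0)) + g 1 * max ((|2 * t - 1| - 1) / 2) 0)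

/-- The jump of `Int.fract` is harmless because `g u - g 1 * u` vanishes at both `u = 0` and `u =
1`. -/
lemma continuous_coordWeight {g : ℝ → ℝ} (hg : Continuous g) (h0 : g 0 = 0) :
    Continuous (coordWeight g) := by
  have h1 : Continuous fun u => (g (Int.fract u) - g 1 * Int.fract u) :=
    ContinuousOn.comp_fract'' (f := fun u => g u - g 1 * u) (by fun_prop) (by simp [h0])
  unfold coordWeight
  exact (hg.comp (by fun_prop)).add ((h1.comp (by fun_prop)).add (by fun_prop))

-- Outside `[0,1]`, `(|2t - 1| - 1) / 2` is the distance of `t` from `[0,1]`: for far `t` its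
-- fractional part is the outward coordinate. When `t` passes an integer outwards, the far term
-- tends to `g 1` and is replaced by one more unit of the outer index.
open Classical in
lemma coordWeight_eq {g : ℝ → ℝ} (h0 : g 0 = 0) (t : ℝ) : coordWeight g t =
    (if 0 < t ∧ t < 1 then g |2 * t - 1| else 0) + (if IsFar t then g (outward t) else 0) +
      g 1 * (outerIdx t).natAbs := by
  by_cases hn : 0 < t ∧ t < 1
  · have hf : ¬ IsFar t := fun h => not_near_of_far h hn
    have hw : |2 * t - 1| ≤ 1 := by rw [abs_le]; constructor <;> linarith
    have ho : outerIdx t = 0 := by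
      have := near_iff.1 hn
      rw [outerIdx_eq]; simp [this]
    unfold coordWeight
    rw [if_pos hn, if_neg hf, min_eq_left hw, max_eq_right (by linarith), ho]
    simp [h0]
  · have hfar : (if IsFar t then g (outward t) else 0) + g 1 * (outerIdx t).natAbs =
        g 1 + (g (Int.fract ((|2 * t - 1| - 1) / 2)) -
        g 1 * Int.fract ((|2 * t - 1| - 1) / 2) + g 1 * ((|2 * t - 1| - 1) / 2)) := by
      have hg : ∀ v : ℝ, Int.fract v = v - ⌊v⌋ := fun v => rfl
      by_cases h1 : 1 ≤ t
      · have ha : (|2 * t - 1| - 1) / 2 = t - 1 := by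
          rw [abs_of_nonneg (by linarith)]; ring
        have hpos : 0 < ⌊t⌋ := Int.floor_pos.2 h1
        have hceil : 0 < ⌈t⌉ := by have := Int.floor_le_ceil t; omega
        have hout : outward t = Int.fract t := by simp [outward, hpos]
        have habs : (((outerIdx t).natAbs : ℕ) : ℝ) = ⌊t⌋ := by
          rw [outerIdx_eq, if_pos hceil]
          rw [Nat.cast_natAbs, abs_of_nonneg hpos.le]
        have hif : (if IsFar t then g (outward t) else 0) = g (Int.fract t) := by
          split_ifs with h
          · rw [hout]
          · have : ⌊t⌋ = ⌈t⌉ := by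
              by_contra h'; exact h ⟨hpos.ne', h'⟩
            rw [eq_floor_of_eq this]; simp [h0]
        have hfr : Int.fract (t - 1) = Int.fract t := Int.fract_sub_one t
        rw [hif, habs, ha, hfr, hg t]
        ring_nf
      · have h2 : t ≤ 0 := by
          by_contra h
          exact hn ⟨not_le.1 h, not_le.1 h1⟩
        have ha : (|2 * t - 1| - 1) / 2 = -t := by
          rw [abs_of_nonpos (by linarith)]; ring
        have hceil : ¬ 0 < ⌈t⌉ := by
          rw [Int.ceil_pos]; linarith
        have hneg : ¬ 0 < ⌊t⌋ := by have := Int.floor_le_ceil t; omega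
        have habs : (((outerIdx t).natAbs : ℕ) : ℝ) = 1 - ⌈t⌉ := by
          rw [outerIdx_eq, if_neg hceil]
          rw [Nat.cast_natAbs, abs_of_nonpos (by omega)]
          push_cast; ring
        have hif : (if IsFar t then g (outward t) else 0) = g (Int.fract (-t)) := by
          split_ifs with h
          · have h3 := (fract_mem_of_ne h.2).1
            rw [Int.fract_neg h3.ne']
            simp [outward, hneg]
          · have : ⌊t⌋ = ⌈t⌉ := by
              by_contra h'
              have h4 := ceil_eq_of_ne h'
              exact h ⟨by omega, h'⟩
            rw [eq_floor_of_eq this, ← Int.cast_neg, Int.fract_intCast, h0]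
        rw [hif, habs, ha, hg (-t), Int.floor_neg]
        push_cast
        ring_nf
    have hw : 1 ≤ |2 * t - 1| := by
      rw [le_abs]
      by_contra hcon
      push Not at hcon
      exact hn ⟨by linarith [hcon.2], by linarith [hcon.1]⟩
    unfold coordWeight
    rw [if_neg hn, min_eq_right hw, max_eq_left (by linarith), zero_add, hfar]

/-- The sum of the values of `g` over the outward coordinates, with the countdown counted as a
number of coordinates equal to `1`. -/
noncomputable def weight (g : ℝ → ℝ) (s : Datum) : ℝ :=
  (s.1.map fun z => g |2 * z - 1|).sum + ((s.2.1 + Multiset.replicate s.2.2 1).map g).sum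

/-- On `S(k)` the outer indices sum to `hi x`, which is the countdown plus `k + 1`; the truncated
subtraction is genuine because `k < hi x`. So the weight is a continuous function of the
coordinates, up to a constant. -/
lemma weight_datum {g : ℝ → ℝ} (h0 : g 0 = 0) {k : ℕ} {x : Fin n → ℝ} (hx : x ∈ sphereS n k) :
    weight g (datum k x) = (∑ i, coordWeight g (x i)) - g 1 * (k + 1) := by
  classical
  simp only [coordWeight_eq h0, Finset.sum_add_distrib, weight, datum, Multiset.map_add,
    Multiset.sum_add, Multiset.map_replicate, Multiset.sum_replicate]
  have h1 : ((nearVals x).map fun z => g |2 * z - 1|).sum =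
      ∑ i, if 0 < x i ∧ x i < 1 then g |2 * x i - 1| else 0 := by
    rw [← Finset.sum_filter, nearVals, List.map_map]
    rw [← List.sum_toFinset _ (nodup_nearIdx x)]
    refine Finset.sum_congr ?_ fun _ _ => rfl
    ext i; simp [mem_nearIdx]
  have h2 : ((farVals x).map g).sum = ∑ i, if IsFar (x i) then g (outward (x i)) else 0 := by
    rw [← Finset.sum_filter, farVals, Multiset.map_map]
    refine Finset.sum_congr ?_ fun _ _ => rfl
    ext i; simp [mem_farIdx]
  have h3 : ((hi x - 1 - k : ℕ) : ℝ) = (∑ i, ((outerIdx (x i)).natAbs : ℝ)) - 1 - k := by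
    have := (mem_sphereS.1 hx).2
    rw [Nat.sub_sub, Nat.cast_sub (by omega), hi]
    push_cast; ring
  rw [h1, h2, nsmul_eq_mul, h3, ← Finset.mul_sum]
  ring

lemma sum_map_eq_count {M : Multiset ℝ} {g : ℝ → ℝ} {v : ℝ} (h1 : g v = 1)
    (h0 : ∀ u ∈ M, u ≠ v → g u = 0) : (M.map g).sum = M.count v := by
  classical
  induction M using Multiset.induction_on with
  | empty => simp
  | cons a M ih =>
    rw [Multiset.map_cons, Multiset.sum_cons, ih fun u hu => h0 u (Multiset.mem_cons_of_mem hu)]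
    by_cases ha : a = v
    · rw [ha, h1, Multiset.count_cons_self]; push_cast; ring
    · rw [h0 a (Multiset.mem_cons_self a M) ha, Multiset.count_cons_of_ne (Ne.symm ha), zero_add]

/-- When the near lists agree, their contributions to the weight cancel. A bump at a value `v` whose
multiplicities differ then counts `v` in the far values together with the countdown copies of 1. -/
lemma exists_separating_of_far {s t : TypeSpace n} (h : s.1.1 = t.1.1) (hne : s ≠ t) :
    ∃ f : TypeSpace n → ℝ, Continuous f ∧ f s ≠ f t := by
  classical
  set M := s.1.2.1 + Multiset.replicate s.1.2.2 1 with hM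
  set M' := t.1.2.1 + Multiset.replicate t.1.2.2 1 with hM'
  -- Far values are less than 1, so the combined multiset determines the countdown as the
  -- multiplicity of 1, and then the far values.
  have hone : ∀ r : TypeSpace n, r.1.2.1.count 1 = 0 := fun r =>
    Multiset.count_eq_zero.2 fun h => lt_irrefl _ (r.valid.2 1 h).2
  have hMM : M ≠ M' := by
    intro hcon
    have h1 : s.1.2.2 = t.1.2.2 := by
      have := congrArg (Multiset.count 1) hcon
      simpa [hM, hM', hone] using this
    have h2 : s.1.2.1 = t.1.2.1 := by
      rw [hM, hM', h1] at hcon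
      exact add_right_cancel hcon
    exact hne (Subtype.ext (Prod.ext h (Prod.ext h2 h1)))
  obtain ⟨v, hv⟩ : ∃ v, M.count v ≠ M'.count v := by
    by_contra hcon
    push Not at hcon
    exact hMM (Multiset.ext.2 hcon)
  have hpos : ∀ r : TypeSpace n, (0 : ℝ) ∉ r.1.2.1 + Multiset.replicate r.1.2.2 1 := by
    intro r hr
    rcases Multiset.mem_add.1 hr with hr | hr
    · exact lt_irrefl _ (r.valid.2 0 hr).1
    · exact zero_ne_one (Multiset.eq_of_mem_replicate hr)
  have hv0 : v ≠ 0 := by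
    rintro rfl
    rw [Multiset.count_eq_zero.2 (hpos s), Multiset.count_eq_zero.2 (hpos t)] at hv
    exact hv rfl
  obtain ⟨g, h1, -, h3, h4⟩ := exists_bump
    (F := (((insert 0 (M.toFinset ∪ M'.toFinset)).erase v : Finset ℝ) : Set ℝ)) (z := v)
    (Finset.finite_toSet _).isClosed ⟨0, by simp [hv0.symm]⟩ (by simp)
  have hg0 : g 0 = 0 := h4 0 (by simp [hv0.symm])
  refine ⟨fun r => weight g r.1, ?_, ?_⟩
  · refine continuous_of_comp_toType fun k => ?_
    have h6 : (fun r : TypeSpace n => weight g r.1) ∘ toType n k =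
        fun x => (∑ i, coordWeight g (x.1 i)) - g 1 * (k + 1) :=
      funext fun x => weight_datum hg0 x.2
    rw [h6]
    refine (continuous_finsetSum _ fun i _ => ?_).sub continuous_const
    exact (continuous_coordWeight h1 hg0).comp ((continuous_apply i).comp continuous_subtype_val)
  · simp only [weight, h, ← hM, ← hM']
    rw [sum_map_eq_count (M := M) h3 fun u hu huv => h4 u (by simp [hu, huv]),
      sum_map_eq_count (M := M') h3 fun u hu huv => h4 u (by simp [hu, huv])]
    intro hcon
    exact hv (by exact_mod_cast add_left_cancel hcon)

instance (n : ℕ) : T2Space (TypeSpace n) := by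
  -- Evaluation at all continuous real functions is a continuous map into a product of lines; it is
  -- injective because such functions separate data.
  refine T2Space.of_injective_continuous (Y := C(TypeSpace n, ℝ) → ℝ) (f := fun s F => F s) ?_
    (continuous_pi fun F => F.continuous)
  intro s t h
  by_contra hne
  obtain ⟨f, hf, hst⟩ : ∃ f : TypeSpace n → ℝ, Continuous f ∧ f s ≠ f t := by
    by_cases heq : s.1.1 = t.1.1
    · exact exists_separating_of_far heq hne
    · rcases le_total t.1.1.length s.1.1.length with hl | hl
      · exact exists_separating_of_near (Ne.symm heq) hl
      · obtain ⟨f, h1, h2⟩ := exists_separating_of_near heq hl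
        exact ⟨f, h1, h2.symm⟩
  exact hst (congrFun h ⟨f, hf⟩)

end TorusFSR

namespace TorusFSR

variable {n : ℕ}

/-! ### Points in cells of top dimension -/

lemma card_farVals_toFinset_le (x : Fin n → ℝ) : (farVals x).toFinset.card ≤ (farIdx x).card := by
  rw [← card_farVals]; exact Multiset.toFinset_card_le _

lemma intFin_card_of_mem {k : ℕ} {x : Fin n → ℝ} (hx : x ∈ sphereS n k) :
    lo x ≤ k ∧ k < lo x + (intFin x).card ∧ hi x = lo x + (intFin x).card := by
  have := mem_sphereS.1 hx
  have := hi_eq_lo_add x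
  omega

/-- A point of a sphere has at least one integer coordinate, so dimension `n - 1` leaves room for
exactly one and for no coincidence among far values. Then `hi x = lo x + 1`, which pins both to `k`
and `k + 1`. -/
lemma top_facts (hn : 1 ≤ n) {k : ℕ} {x : Fin n → ℝ} (hx : x ∈ sphereS n k)
    (hd : cellDim x = n - 1) : (farVals x).Nodup ∧ (nearFin x).card + (farVals x).card = n - 1 ∧
      (intFin x).card = 1 ∧ lo x = k ∧ hi x = k + 1 := by
  have h1 := intFin_card_of_mem hx
  have h2 := card_add_card_add_card x
  have h3 := card_farVals_toFinset_le x
  rw [cellDim, length_nearVals] at hd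
  rw [← Multiset.toFinset_card_eq_card_iff_nodup, card_farVals]
  omega

lemma cellDim_eq_of_nodup {x : Fin n → ℝ} (h : (farVals x).Nodup) :
    cellDim x = n - (intFin x).card := by
  have h2 := card_add_card_add_card x
  rw [cellDim, length_nearVals, Multiset.toFinset_card_of_nodup h, card_farVals]
  omega

lemma floor_ceil_of_mem_Ioo {b : ℤ} {t : ℝ} (h : (b : ℝ) < t ∧ t < b + 1) :
    ⌊t⌋ = b ∧ ⌈t⌉ = b + 1 := by
  rw [Int.floor_eq_iff, Int.ceil_eq_iff]
  push_cast
  exact ⟨⟨h.1.le, h.2⟩, by linarith [h.1], h.2.le⟩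

/-- The outward coordinate of `t` in `[b, b + 1]`. -/
noncomputable def outIn (b : ℤ) (t : ℝ) : ℝ := if 0 < b then t - b else b + 1 - t

lemma outward_eq_outIn {b : ℤ} {t : ℝ} (h : (b : ℝ) < t ∧ t < b + 1) : outward t = outIn b t := by
  have h1 := (floor_ceil_of_mem_Ioo h).1
  have h2 := Int.self_sub_floor t
  rw [h1] at h2
  unfold outward outIn
  rw [h1, ← h2]
  split_ifs <;> ring

open Filter in
lemma eventually_affine_ne {a c : ℝ} (hc : c ≠ 0) : ∀ᶠ t in 𝓝[>] (0 : ℝ), (1 - t) * a + t * c ≠ 0 := by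
  by_cases ha : a = 0
  · filter_upwards [self_mem_nhdsWithin] with t ht
    rw [ha, mul_zero, zero_add]
    exact mul_ne_zero (ne_of_gt ht) hc
  · have h1 : ContinuousAt (fun t : ℝ => (1 - t) * a + t * c) 0 := by fun_prop
    exact (h1.eventually_ne (by simpa using ha)).filter_mono nhdsWithin_le_nhds

open Filter in
/-- Points of top-dimensional cells are dense in the spheres. -/
lemma mem_closure_top (hn : 1 ≤ n) {k : ℕ} {x : Fin n → ℝ} (hx : x ∈ sphereS n k) :
    x ∈ closure {y | y ∈ sphereS n k ∧ cellDim y = n - 1} := by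
  classical
  have hx' := mem_sphereS.1 hx
  obtain ⟨b, hb, hlen⟩ := exists_cube_len_eq (x := x) (m := k + 1) (by omega) (by omega)
  -- The coordinate `i₀` is on an inner face of the cube and is kept fixed; all others are moved
  -- towards a generic point of the cube.
  obtain ⟨i₀, hi₀, hx₀⟩ := (lo_lt_len_iff hb).1 (by omega)
  -- These are distinct values in `(0,1)`, used as the outward positions of the target point `y`.
  let r : Fin n → ℝ := fun i => ((i : ℕ) + 1 : ℝ) / (n + 1)
  have hr : ∀ i, 0 < r i ∧ r i < 1 := fun i => by
    refine ⟨by positivity, ?_⟩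
    rw [div_lt_one (by positivity)]
    have := i.2
    have : ((i : ℕ) : ℝ) < n := by exact_mod_cast this
    linarith
  have hrinj : ∀ i j, r i = r j → i = j := fun i j h => by
    have h1 : (n + 1 : ℝ) ≠ 0 := by positivity
    have : ((i : ℕ) : ℝ) = j := by
      simp only [r] at h; field_simp at h; linarith
    exact Fin.ext (by exact_mod_cast this)
  let y : Fin n → ℝ := fun i => if i = i₀ then x i else
    if 0 < b i then b i + r i else b i + 1 - r i
  have hy₀ : y i₀ = x i₀ := by simp [y]
  have hy : ∀ i, i ≠ i₀ → (b i : ℝ) < y i ∧ y i < b i + 1 ∧ outIn (b i) (y i) = r i := fun i hi => by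
    have := hr i
    simp only [y, if_neg hi, outIn]
    split_ifs <;> refine ⟨by linarith, by linarith, by ring⟩
  let z : ℝ → Fin n → ℝ := fun t i => (1 - t) * x i + t * y i
  have hz : Tendsto z (𝓝[>] 0) (𝓝 x) := by
    have : Continuous z := by fun_prop
    have h := this.tendsto 0
    have h0 : z 0 = x := by funext i; simp [z]
    rw [h0] at h
    exact h.mono_left nhdsWithin_le_nhds
  -- Each difference of outward positions is affine in `t` and nonzero at `t = 1`, hence nonzero for
  -- all small `t > 0`.
  have hev : ∀ᶠ t in 𝓝[>] (0 : ℝ), ∀ i j, i ≠ j → i ≠ i₀ → j ≠ i₀ →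
      outIn (b i) (z t i) ≠ outIn (b j) (z t j) := by
    refine eventually_all.2 fun i => eventually_all.2 fun j => ?_
    by_cases hij : i ≠ j ∧ i ≠ i₀ ∧ j ≠ i₀
    · have hne : outIn (b i) (y i) - outIn (b j) (y j) ≠ 0 := by
        rw [(hy i hij.2.1).2.2, (hy j hij.2.2).2.2]
        exact sub_ne_zero.2 fun h => hij.1 (hrinj i j h)
      filter_upwards [eventually_affine_ne (a := outIn (b i) (x i) - outIn (b j) (x j)) hne] with t ht
      intro _ _ _ h
      apply ht
      have hl : ∀ i, outIn (b i) (z t i) = (1 - t) * outIn (b i) (x i) + t * outIn (b i) (y i) := by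
        intro i
        simp only [outIn, z]
        split_ifs <;> ring
      rw [hl, hl] at h
      linear_combination h
    · exact Eventually.of_forall fun t h1 h2 h3 => absurd ⟨h1, h2, h3⟩ hij
  refine mem_closure_of_tendsto hz ?_
  filter_upwards [hev, Ioo_mem_nhdsGT (zero_lt_one (α := ℝ))] with t ht ht01
  have hz₀ : z t i₀ = x i₀ := by simp only [z, hy₀]; ring
  have hzi : ∀ i, i ≠ i₀ → (b i : ℝ) < z t i ∧ z t i < b i + 1 := fun i hi => by
    obtain ⟨h1, h2, -⟩ := hy i hi
    have h3 := hb i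
    have h4 : 0 < 1 - t := by linarith [ht01.2]
    constructor
    · nlinarith [ht01.1, mul_lt_mul_of_pos_left h1 ht01.1, mul_le_mul_of_nonneg_left h3.1 h4.le]
    · nlinarith [ht01.1, mul_lt_mul_of_pos_left h2 ht01.1, mul_le_mul_of_nonneg_left h3.2 h4.le]
  have hcube : z t ∈ cube b := fun i => by
    by_cases hi : i = i₀
    · rw [hi, hz₀]; exact hb i₀
    · exact ⟨(hzi i hi).1.le, (hzi i hi).2.le⟩
  have hmem : z t ∈ sphereS n k := by
    -- Being on an inner face of a cube of length `k + 1` is all that membership in `S(k)` requires.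
    have h1 : lo (z t) < len b := (lo_lt_len_iff hcube).2 ⟨i₀, hi₀, by rw [hz₀, hx₀]⟩
    have h2 := len_le_hi hcube
    exact mem_sphereS.2 ⟨by omega, by omega⟩
  refine ⟨hmem, ?_⟩
  have hint : (intFin (z t)).card = 1 := by
    have h1 := intFin_card_of_mem hmem
    have h2 : intFin (z t) ⊆ {i₀} := fun i hi => by
      by_contra h
      rw [Finset.mem_singleton] at h
      have h3 := mem_intFin.1 hi
      have h4 := floor_ceil_of_mem_Ioo (hzi i h)
      omega
    have := Finset.card_le_card h2
    rw [Finset.card_singleton] at this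
    omega
  rw [cellDim_eq_of_nodup, hint]
  refine Multiset.Nodup.map_on ?_ (farIdx (z t)).nodup
  intro i hi j hj h
  by_contra hij
  have hne : ∀ i ∈ farIdx (z t), i ≠ i₀ := fun i hi h => by
    have h1 : i₀ ∈ intFin (z t) := by
      obtain ⟨a, ha⟩ := Finset.card_eq_one.1 hint
      have : ∀ j ∈ intFin (z t), j = i₀ := fun j hj => by
        by_contra hj0
        have h3 := mem_intFin.1 hj
        have h4 := floor_ceil_of_mem_Ioo (hzi j hj0)
        omega
      have ha' : a ∈ intFin (z t) := by simp [ha]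
      rw [← this a ha']; exact ha'
    exact (mem_farIdx.1 hi).2 (h ▸ mem_intFin.1 h1)
  have h1 := hne i hi
  have h2 := hne j hj
  rw [outward_eq_outIn (hzi i h1), outward_eq_outIn (hzi j h2)] at h
  exact ht i j hij h1 h2 h

/-! ### Standard points of top-dimensional cells -/

/-- The standard point in the cell of type `Δ^{p-1} × I^{n-p}`. -/
noncomputable def stdPt (n p : ℕ) : Fin n → ℝ := fun i => if (i : ℕ) < p then 1 + (i : ℝ) / p else 1 / 2

lemma stdPt_of_lt {p : ℕ} {i : Fin n} (h : (i : ℕ) < p) : stdPt n p i = 1 + (i : ℝ) / p := if_pos h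

lemma stdPt_of_le {p : ℕ} {i : Fin n} (h : p ≤ i) : stdPt n p i = 1 / 2 := if_neg (not_lt.2 h)

lemma stdPt_mem {p : ℕ} {i : Fin n} (h : (i : ℕ) < p) (h0 : 0 < (i : ℕ)) :
    ((1 : ℤ) : ℝ) < stdPt n p i ∧ stdPt n p i < (1 : ℤ) + 1 := by
  have hp : (0 : ℝ) < p := by exact_mod_cast h0.trans h
  have h1 : (0 : ℝ) < (i : ℝ) / p := div_pos (by exact_mod_cast h0) hp
  have h2 : (i : ℝ) / p < 1 := by rw [div_lt_one hp]; exact_mod_cast h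
  rw [stdPt_of_lt h]
  push_cast
  constructor <;> linarith

lemma outward_stdPt {p : ℕ} {i : Fin n} (h : (i : ℕ) < p) (h0 : 0 < (i : ℕ)) :
    outward (stdPt n p i) = (i : ℝ) / p := by
  rw [outward_eq_outIn (stdPt_mem h h0), stdPt_of_lt h, outIn]
  simp

lemma near_stdPt {p : ℕ} {i : Fin n} : (0 < stdPt n p i ∧ stdPt n p i < 1) ↔ p ≤ i := by
  constructor
  · intro h
    by_contra hcon
    rw [stdPt_of_lt (not_le.1 hcon)] at h
    have : (0 : ℝ) ≤ (i : ℝ) / p := by positivity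
    linarith [h.2]
  · intro h
    rw [stdPt_of_le h]; norm_num

lemma far_stdPt {p : ℕ} {i : Fin n} : IsFar (stdPt n p i) ↔ (i : ℕ) < p ∧ 0 < (i : ℕ) := by
  constructor
  · intro h
    have h1 : (i : ℕ) < p := by
      by_contra hcon
      exact not_near_of_far h (near_stdPt.2 (not_lt.1 hcon))
    refine ⟨h1, Nat.pos_of_ne_zero fun h0 => ?_⟩
    rw [stdPt_of_lt h1, h0] at h
    simp [IsFar] at h
  · rintro ⟨h1, h2⟩
    have := floor_ceil_of_mem_Ioo (stdPt_mem h1 h2)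
    rw [IsFar, this.1, this.2]
    norm_num

lemma int_stdPt {p : ℕ} (hp : 1 ≤ p) {i : Fin n} : ⌊stdPt n p i⌋ = ⌈stdPt n p i⌉ ↔ (i : ℕ) = 0 := by
  constructor
  · intro h
    by_contra hcon
    by_cases h1 : (i : ℕ) < p
    · exact (far_stdPt.2 ⟨h1, Nat.pos_of_ne_zero hcon⟩).2 h
    · have := near_iff.1 (near_stdPt.2 (not_lt.1 h1)); omega
  · intro h
    rw [stdPt_of_lt (by omega), h]; simp

lemma card_nearFin_stdPt {p : ℕ} (hp : p ≤ n) : (nearFin (stdPt n p)).card = n - p := by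
  classical
  have h1 : (nearFin (stdPt n p))ᶜ = Finset.univ.filter fun i : Fin n => (i : ℕ) < p := by
    ext i; simp [mem_nearFin, near_stdPt]
  have h2 := Finset.card_compl (nearFin (stdPt n p))
  rw [h1, Fin.card_filter_val_lt, Fintype.card_fin, min_eq_right hp] at h2
  have h3 := Finset.card_le_univ (nearFin (stdPt n p))
  rw [Fintype.card_fin] at h3
  omega

lemma card_intFin_stdPt {p : ℕ} (hp : 1 ≤ p) (hpn : p ≤ n) : (intFin (stdPt n p)).card = 1 := by
  rw [Finset.card_eq_one]
  refine ⟨⟨0, by omega⟩, ?_⟩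
  ext i
  rw [mem_intFin, int_stdPt hp, Finset.mem_singleton, Fin.ext_iff]

lemma nodup_farVals_stdPt {p : ℕ} (hp : 1 ≤ p) : (farVals (stdPt n p)).Nodup := by
  refine Multiset.Nodup.map_on ?_ (farIdx (stdPt n p)).nodup
  intro i hi j hj h
  obtain ⟨h1, h2⟩ := far_stdPt.1 (mem_farIdx.1 hi)
  obtain ⟨h3, h4⟩ := far_stdPt.1 (mem_farIdx.1 hj)
  rw [outward_stdPt h1 h2, outward_stdPt h3 h4] at h
  have : (p : ℝ) ≠ 0 := by positivity
  field_simp at h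
  exact Fin.ext (by exact_mod_cast h)

lemma card_farVals_stdPt {p : ℕ} (hp : 1 ≤ p) (hpn : p ≤ n) :
    (farVals (stdPt n p)).card = p - 1 := by
  have h1 := card_add_card_add_card (stdPt n p)
  have h2 := card_nearFin_stdPt hpn
  have h3 := card_intFin_stdPt hp hpn
  rw [card_farVals]
  omega

lemma cellDim_stdPt {p : ℕ} (hp : 1 ≤ p) (hpn : p ≤ n) : cellDim (stdPt n p) = n - 1 := by
  rw [cellDim_eq_of_nodup (nodup_farVals_stdPt hp), card_intFin_stdPt hp hpn]

lemma stdPt_mem_sphereS {p : ℕ} (hp : 1 ≤ p) (hpn : p ≤ n) : stdPt n p ∈ sphereS n (p - 1) := by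
  classical
  have h1 := hi_eq_lo_add (stdPt n p)
  have h2 := card_intFin_stdPt hp hpn
  have h3 : hi (stdPt n p) = p := by
    unfold hi
    have : ∀ i, (outerIdx (stdPt n p i)).natAbs = if (i : ℕ) < p then 1 else 0 := fun i => by
      split_ifs with h
      · by_cases h0 : 0 < (i : ℕ)
        · have := floor_ceil_of_mem_Ioo (stdPt_mem h h0)
          rw [outerIdx_eq, this.1, this.2]; simp
        · rw [stdPt_of_lt h, Nat.eq_zero_of_not_pos h0]; simp [outerIdx_eq]
      · have := near_iff.1 (near_stdPt.2 (not_lt.1 h))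
        rw [outerIdx_eq, this.1, this.2]; simp
    simp only [this]
    rw [← Finset.card_filter, Fin.card_filter_val_lt, min_eq_right hpn]
  exact mem_sphereS.2 (by omega)

/-- Data without repetitions have the same type if they have the same numbers of entries. -/
lemma sameType_of_nodup {s t : Datum} (h1 : s.1.length = t.1.length) (h2 : s.2.2 = t.2.2)
    (h3 : s.2.1.card = t.2.1.card) (hs : s.2.1.Nodup) (ht : t.2.1.Nodup) : SameType s t := by
  classical
  refine ⟨h1, h2, ?_⟩
  have hc : s.2.1.toFinset.card = t.2.1.toFinset.card := by
    rw [Multiset.toFinset_card_of_nodup hs, Multiset.toFinset_card_of_nodup ht, h3]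
  let e : s.2.1.toFinset ≃o t.2.1.toFinset :=
    (s.2.1.toFinset.orderIsoOfFin hc).symm.trans (t.2.1.toFinset.orderIsoOfFin rfl)
  let θ : ℝ → ℝ := fun v => if h : v ∈ s.2.1.toFinset then e ⟨v, h⟩ else 0
  have hθ : ∀ v (h : v ∈ s.2.1.toFinset), θ v = e ⟨v, h⟩ := fun v h => dif_pos h
  refine ⟨θ, fun a ha b hb hab => ?_, ?_⟩
  · rw [hθ a (by simpa using ha), hθ b (by simpa using hb)]
    exact e.strictMono hab
  · have hmono : Set.InjOn θ s.2.1.toFinset := fun a ha b hb hab => by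
      rw [hθ a ha, hθ b hb] at hab
      simpa using e.injective (Subtype.ext hab)
    have him : s.2.1.toFinset.image θ = t.2.1.toFinset := by
      refine Finset.eq_of_subset_of_card_le ?_ ?_
      · intro w hw
        obtain ⟨v, hv, rfl⟩ := Finset.mem_image.1 hw
        rw [hθ v hv]; exact (e ⟨v, hv⟩).2
      · rw [Finset.card_image_of_injOn hmono, hc]
    have h4 := congrArg Finset.val him
    rw [Finset.image_val_of_injOn hmono, Multiset.toFinset_val, Multiset.toFinset_val,
      hs.dedup, ht.dedup] at h4
    exact h4.symm

/-- In top dimension the countdown is zero and the far values are distinct, so the type depends only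
on their number. This is why there are only `n` tiles. -/
lemma sameType_stdPt (hn : 1 ≤ n) {k : ℕ} {x : Fin n → ℝ} (hx : x ∈ sphereS n k)
    (hd : cellDim x = n - 1) : (farVals x).card + 1 ≤ n ∧
    SameType (datum (farVals x).card (stdPt n ((farVals x).card + 1))) (datum k x) := by
  obtain ⟨h1, h2, h3, h4, h5⟩ := top_facts hn hx hd
  have hpn : (farVals x).card + 1 ≤ n := by omega
  have hp : 1 ≤ (farVals x).card + 1 := by omega
  refine ⟨hpn, sameType_of_nodup ?_ ?_ ?_ (nodup_farVals_stdPt hp) h1⟩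
  · simp only [datum, length_nearVals]
    rw [card_nearFin_stdPt hpn]; omega
  · have h6 := top_facts hn (stdPt_mem_sphereS hp hpn) (cellDim_stdPt hp hpn)
    simp only [datum]
    omega
  · simp only [datum, card_farVals_stdPt hp hpn]; omega

/-! ### The subdivision complex -/

/-- The setoid of the open cells of the subdivision complex. -/
def typeRel (n : ℕ) : Setoid (TypeSpace n) := typeSetoid.comap Subtype.val

/-- The dimension of the cell of a type. -/
noncomputable def typeDim (s : TypeSpace n) : ℕ := s.1.dim

lemma typeDim_congr (s t : TypeSpace n) (h : typeRel n s t) : typeDim s = typeDim t :=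
  SameType.dim_eq h

/-- The map to the subdivision complex is a bijection from the cell of `x` to the cell of its
type. -/
lemma bijOn_toType {k : ℕ} (x : sphereS n k) :
    BijOn (toType n k) {y | SameTorusCell x.1 y.1} (classIn univ (typeRel n) (toType n k x)) := by
  refine ⟨fun y hy => ⟨mem_univ _, SameTorusCell.sameType hy k⟩, fun y hy z hz h => ?_,
    fun s hs => ?_⟩
  · have h1 : datum k y.1 = datum k z.1 := congrArg Subtype.val h
    refine Subtype.ext (SameTorusCell.eq_of_datum_eq (hy.symm.trans hz) ?_ ?_)
    · exact congrArg Prod.fst h1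
    · exact congrArg (fun d : Datum => d.2.1) h1
  · obtain ⟨y, hy, hys⟩ := exists_sameTorusCell_datum_eq s.valid hs.2
    exact ⟨⟨y, hy.mem_sphereS.1 x.2⟩, hy, Subtype.ext hys⟩

lemma closure_torusCell_subset {k : ℕ} {x : Fin n → ℝ} (hx : x ∈ sphereS n k) :
    closure (torusCell x) ⊆ sphereS n k :=
  closure_minimal (fun _ hy => SameTorusCell.mem_sphereS hy |>.1 hx) (isCompact_sphereS n k).isClosed

/-- The characteristic map of a top-dimensional cell comes from a chart of a standard cell. -/
def IsStdChar (n m : ℕ) (f : (Fin m → ℝ) → TypeSpace n) : Prop :=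
  m = n - 1 → ∃ p, 1 ≤ p ∧ p ≤ n ∧ ∃ ρ : (Fin m → ℝ) → Fin n → ℝ, IsCellChart (stdPt n p) ρ ∧
    ∀ v ∈ Metric.closedBall (0 : Fin m → ℝ) 1, ∃ h, f v = toType n (p - 1) ⟨ρ v, h⟩

lemma exists_typeChar {k : ℕ} {x : Fin n → ℝ} (hx : x ∈ sphereS n k) {m : ℕ} (hm : cellDim x = m) :
    ∃ (ρ : (Fin m → ℝ) → Fin n → ℝ) (f : (Fin m → ℝ) → TypeSpace n), IsCellChart x ρ ∧
      IsCharMap univ typeDim m (classIn univ (typeRel n) (toType n k ⟨x, hx⟩)) f ∧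
      ∀ v ∈ Metric.closedBall (0 : Fin m → ℝ) 1, ∃ h, f v = toType n k ⟨ρ v, h⟩ := by
  obtain ⟨ρ, hρ⟩ := exists_isCellChart x hm
  obtain ⟨f, hf, hf'⟩ := hρ.exists_isCharMap (C := univ) (dim := typeDim) (toType n k)
    (continuous_toType n k) (fun y => ⟨mem_univ _, rfl⟩) (closure_torusCell_subset hx)
    (fun y y' h h' he => (bijOn_toType ⟨x, hx⟩).injOn h h' he)
  rw [(bijOn_toType ⟨x, hx⟩).image_eq] at hf
  exact ⟨ρ, f, hρ, hf, hf'⟩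

/-- For a top cell the chart is taken from the standard point of its type rather than from `x`, so
that its tile type can be computed on a standard closed tile. -/
lemma hasCharMaps_type (hn : 1 ≤ n) :
    HasCharMaps univ (typeRel n) typeDim fun m _ f => IsStdChar n m f := by
  rintro m ⟨_, s, -, hm, rfl⟩
  obtain ⟨k, ⟨x, hx⟩, rfl⟩ := exists_toType_eq s
  have hm' : cellDim x = m := hm
  by_cases hmn : m = n - 1
  · obtain ⟨hpn, hst⟩ := sameType_stdPt hn hx (hm'.trans hmn)
    have hp : 1 ≤ (farVals x).card + 1 := by omega
    have hstd := stdPt_mem_sphereS hp hpn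
    obtain ⟨ρ, f, hρ, hf, hf'⟩ := exists_typeChar hstd
      ((cellDim_stdPt hp hpn).trans hmn.symm)
    refine ⟨f, ?_, fun _ => ⟨_, hp, hpn, ρ, hρ, hf'⟩⟩
    rw [classIn_eq (show typeRel n (toType n _ ⟨_, hstd⟩) (toType n k ⟨x, hx⟩) from hst)] at hf
    exact hf
  · obtain ⟨ρ, f, hρ, hf, hf'⟩ := exists_typeChar hx hm'
    exact ⟨f, hf, fun h => absurd h hmn⟩

/-- Every type is the type of a point with small coordinates. -/
lemma exists_small_datum_eq {k : ℕ} {x : Fin n → ℝ} (hx : x ∈ sphereS n k) :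
    ∃ l < n, ∃ y ∈ sphereS n l, (∀ i, 0 ≤ y i ∧ y i ≤ 2) ∧ datum l y = datum k x := by
  classical
  -- Near coordinates stay, far ones are moved to `(1,2)` with the same outward position, and
  -- integers become 1.
  let y : Fin n → ℝ := fun i => if 0 < x i ∧ x i < 1 then x i else
    if IsFar (x i) then 1 + outward (x i) else 1
  have hy1 : ∀ i, (0 < x i ∧ x i < 1) → y i = x i := fun i hi => if_pos hi
  have hy2 : ∀ i, IsFar (x i) → y i = 1 + outward (x i) := fun i hi => by
    simp only [y, if_neg (not_near_of_far hi), if_pos hi]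
  have hy3 : ∀ i, ⌊x i⌋ = ⌈x i⌉ → y i = 1 := fun i hi => by
    have h1 : ¬ (0 < x i ∧ x i < 1) := fun h => by have := near_iff.1 h; omega
    have h2 : ¬ IsFar (x i) := fun h => h.2 hi
    simp only [y, if_neg h1, if_neg h2]
  have hfl : ∀ i, IsFar (x i) → ⌊y i⌋ = 1 ∧ ⌈y i⌉ = 2 := fun i hi => by
    have := outward_mem hi
    have h := floor_ceil_of_mem_Ioo (b := 1) (t := y i)
      (by rw [hy2 i hi]; push_cast; constructor <;> linarith)
    omega
  have hnear : ∀ i, (0 < y i ∧ y i < 1) ↔ (0 < x i ∧ x i < 1) := fun i => by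
    rcases cases_coord (x i) with h | h | h
    · rw [hy1 i h]
    · refine iff_of_false (fun h' => ?_) (not_near_of_far h)
      have := near_iff.1 h'; have := hfl i h; omega
    · rw [hy3 i h]
      refine iff_of_false (by norm_num) fun h' => ?_
      have := near_iff.1 h'; omega
  have hfar : ∀ i, IsFar (y i) ↔ IsFar (x i) := fun i => by
    rcases cases_coord (x i) with h | h | h
    · rw [hy1 i h]
    · refine iff_of_true ?_ h
      have := hfl i h
      rw [IsFar]; omega
    · rw [hy3 i h]
      exact iff_of_false (by simp [IsFar]) fun h' => h'.2 h
  have hN : nearIdx y = nearIdx x := by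
    unfold nearIdx; simp only [hnear]
  have hF : farIdx y = farIdx x := by
    ext i; rw [mem_farIdx, mem_farIdx, hfar]
  have hI : intFin y = intFin x := by
    ext i
    rw [mem_intFin, mem_intFin]
    rcases cases_coord (x i) with h | h | h
    · rw [hy1 i h]
    · have := hfl i h; have := h.2; omega
    · rw [hy3 i h]; simp [h]
  have hlo : lo y = (farIdx x).card := by
    unfold lo
    have : ∀ i, (innerIdx (y i)).natAbs = if IsFar (x i) then 1 else 0 := fun i => by
      rw [innerIdx_eq]
      rcases cases_coord (x i) with h | h | h
      · have h1 := near_iff.1 h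
        rw [hy1 i h, if_neg fun h' => not_near_of_far h' h, h1.2]; simp
      · have := hfl i h
        rw [if_pos h, this.2]; simp
      · have hnf : ¬ IsFar (x i) := fun h' => h'.2 h
        rw [hy3 i h]; simp [hnf]
    simp only [this]
    rw [← Finset.card_filter]
    congr 1
  have h1 := intFin_card_of_mem hx
  have h2 := hi_eq_lo_add y
  have h3 := card_add_card_add_card x
  rw [hI] at h2
  -- The level is chosen to give the same countdown. It is below `n` because `hi y` is the number of
  -- far and integer coordinates.
  refine ⟨hi y - 1 - (hi x - 1 - k), by omega, y, mem_sphereS.2 (by omega), fun i => ?_,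
    Prod.ext ?_ (Prod.ext ?_ ?_)⟩
  · rcases cases_coord (x i) with h | h | h
    · rw [hy1 i h]; constructor <;> linarith
    · have := outward_mem h
      rw [hy2 i h]; constructor <;> linarith
    · rw [hy3 i h]; norm_num
  · simp only [datum, nearVals, hN]
    exact List.map_congr_left fun i hi => hy1 i (mem_nearIdx.1 hi)
  · simp only [datum, farVals, hF]
    refine Multiset.map_congr rfl fun i hi => ?_
    have hi' := mem_farIdx.1 hi
    have := outward_mem hi'
    rw [outward_eq_outIn (b := 1) (by rw [hy2 i hi']; push_cast; constructor <;> linarith), hy2 i hi']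
    simp [outIn]
  · simp only [datum]; omega

lemma finite_classes_of_small {X : Type*} {C : Set X} {r : Setoid X}
    (φ : ℕ → Set (Fin n → ℝ) → Set X) {c : ℤ}
    (h : ∀ s ∈ C, ∃ l < n, ∃ y : Fin n → ℝ, (∀ i, -(c : ℝ) ≤ y i ∧ y i ≤ c) ∧
      classIn C r s = φ l (torusCell y)) : (classIn C r '' C).Finite := by
  refine Set.Finite.subset ((Set.finite_Iio n).biUnion fun l _ =>
    (finite_torusCell_image (n := n) (K := {y | ∀ i, -(c : ℝ) ≤ y i ∧ y i ≤ c}) (c := c)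
      fun y hy => hy).image (φ l)) ?_
  rintro _ ⟨s, hs, rfl⟩
  obtain ⟨l, hl, y, hy, he⟩ := h s hs
  exact mem_biUnion hl ⟨torusCell y, ⟨y, hy, rfl⟩, he.symm⟩

lemma finite_type_classes (n : ℕ) :
    Finite (Σ m, {s : Set (TypeSpace n) // IsClassOfDim univ (typeRel n) typeDim m s}) := by
  refine finite_sigma_classes typeDim_congr (finite_classes_of_small (c := 2)
    (fun l c => toType n l '' {y | y.1 ∈ c}) fun s _ => ?_)
  obtain ⟨k, ⟨x, hx⟩, rfl⟩ := exists_toType_eq s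
  obtain ⟨l, hl, y, hy, hb, he⟩ := exists_small_datum_eq hx
  refine ⟨l, hl, y, fun i => ⟨by push_cast; linarith [hb i], by push_cast; exact (hb i).2⟩, ?_⟩
  have h1 : toType n k ⟨x, hx⟩ = toType n l ⟨y, hy⟩ := Subtype.ext he.symm
  rw [h1, ← (bijOn_toType ⟨y, hy⟩).image_eq]
  rfl

/-- The CW structure of the subdivision complex. -/
@[reducible]
noncomputable def typeCW (hn : 1 ≤ n) : CWComplex (univ : Set (TypeSpace n)) :=
  (hasCharMaps_type hn).cw typeDim_congr (finite_type_classes n)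

lemma typeDim_le (s : TypeSpace n) : typeDim s ≤ n - 1 := by
  obtain ⟨k, x, rfl⟩ := exists_toType_eq s
  exact cellDim_le_of_mem x.2

/-- The cell of a type. -/
noncomputable def typeCell (hn : 1 ≤ n) (s : TypeSpace n) : Cell (typeCW hn) (typeDim s) :=
  (hasCharMaps_type hn).cellOf typeDim_congr (finite_type_classes n) (mem_univ s)

lemma openCell_typeCell (hn : 1 ≤ n) (s : TypeSpace n) :
    openCell (typeCW hn) (typeDim s) (typeCell hn s) = classIn univ (typeRel n) s :=
  (hasCharMaps_type hn).openCell_cellOf _ _ _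

lemma exists_openCell_typeCW (hn : 1 ≤ n) (s : TypeSpace n) {m : ℕ} (hm : typeDim s = m) :
    ∃ c : Cell (typeCW hn) m, openCell (typeCW hn) m c = classIn univ (typeRel n) s := by
  subst hm
  exact ⟨typeCell hn s, openCell_typeCell hn s⟩

lemma mem_closure_typeTop (hn : 1 ≤ n) (s : TypeSpace n) :
    s ∈ closure {t : TypeSpace n | ∃ k, ∃ x : sphereS n k, cellDim x.1 = n - 1 ∧ toType n k x = t} := by
  obtain ⟨k, ⟨x, hx⟩, rfl⟩ := exists_toType_eq s
  have h1 : (⟨x, hx⟩ : sphereS n k) ∈ closure {y : sphereS n k | cellDim y.1 = n - 1} := by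
    rw [closure_subtype]
    refine closure_mono ?_ (mem_closure_top hn hx)
    rintro y ⟨hy, hd⟩
    exact ⟨⟨y, hy⟩, hd, rfl⟩
  refine map_mem_closure (continuous_toType n k) h1 fun y hy => ⟨k, y, hy, rfl⟩

lemma unionOfClosed_typeCW (hn : 1 ≤ n) : UnionOfClosed (typeCW hn) (n - 1) := by
  refine unionOfClosed_of_dense (typeCW hn)
    ((hasCharMaps_type hn).finitelyManyCells_cw typeDim_congr (finite_type_classes n)) (n - 1) fun s _ => ?_
  refine closure_mono ?_ (mem_closure_typeTop hn s)
  rintro _ ⟨k, x, hd, rfl⟩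
  obtain ⟨c, hc⟩ := exists_openCell_typeCW hn (toType n k x) (m := n - 1) hd
  exact mem_iUnion.2 ⟨c, hc ▸ mem_classIn_self (mem_univ _)⟩

end TorusFSR

namespace TorusFSR

variable {n : ℕ}

/-! ### The cell structure inside a cube -/

lemma floor_ceil_iff {b : ℤ} {t t' : ℝ} (h : (b : ℝ) ≤ t ∧ t ≤ b + 1)
    (h' : (b : ℝ) ≤ t' ∧ t' ≤ b + 1) :
    (⌊t⌋ = ⌊t'⌋ ∧ ⌈t⌉ = ⌈t'⌉) ↔ ((t = b ↔ t' = b) ∧ (t = b + 1 ↔ t' = b + 1)) := by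
  constructor
  · rintro ⟨h1, h2⟩
    have key : ∀ s s' : ℝ, ⌊s⌋ = ⌊s'⌋ → ⌈s⌉ = ⌈s'⌉ → ∀ c : ℤ, s = c → s' = c := by
      rintro s s' h1 h2 c rfl
      rw [Int.floor_intCast] at h1
      rw [Int.ceil_intCast] at h2
      rw [eq_floor_of_eq (t := s') (by omega), ← h1]
    refine ⟨⟨key _ _ h1 h2 b, key _ _ h1.symm h2.symm b⟩, ?_, ?_⟩
    · exact_mod_cast key _ _ h1 h2 (b + 1)
    · exact_mod_cast key _ _ h1.symm h2.symm (b + 1)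
  · rintro ⟨h1, h2⟩
    by_cases h3 : t = b
    · rw [h3, h1.1 h3]; simp
    by_cases h4 : t = b + 1
    · rw [h4, h2.1 h4]; simp
    have h5 := floor_ceil_of_mem_Ioo ⟨lt_of_le_of_ne h.1 (Ne.symm h3), lt_of_le_of_ne h.2 h4⟩
    have h6 := floor_ceil_of_mem_Ioo ⟨lt_of_le_of_ne h'.1 (fun h => h3 (h1.2 h.symm)),
      lt_of_le_of_ne h'.2 fun h => h4 (h2.2 h)⟩
    omega

lemma abs_sub_ctr_eq {b : ℤ} {t : ℝ} (h : (b : ℝ) ≤ t ∧ t ≤ b + 1) (hb : b ≠ 0) :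
    (0 < b ∧ |t - ctr b| = t - b + 1) ∨ (b < 0 ∧ |t - ctr b| = b + 1 - t + 1) := by
  unfold ctr
  rw [if_neg hb]
  by_cases h0 : 0 < b
  · left
    rw [if_pos h0, abs_of_nonneg (by linarith)]
    exact ⟨h0, by ring⟩
  · right
    rw [if_neg h0, abs_of_nonpos (by linarith)]
    exact ⟨by omega, by ring⟩

lemma floor_ceil_iff_abs {b : ℤ} {t t' : ℝ} (h : (b : ℝ) ≤ t ∧ t ≤ b + 1)
    (h' : (b : ℝ) ≤ t' ∧ t' ≤ b + 1) (hb : b ≠ 0) :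
    (⌊t⌋ = ⌊t'⌋ ∧ ⌈t⌉ = ⌈t'⌉) ↔
      ((|t - ctr b| = 1 ↔ |t' - ctr b| = 1) ∧ (|t - ctr b| = 2 ↔ |t' - ctr b| = 2)) := by
  rw [floor_ceil_iff h h']
  have key : ∀ t : ℝ, ((b : ℝ) ≤ t ∧ t ≤ b + 1) → (0 < b → (|t - ctr b| = 1 ↔ t = b) ∧
      (|t - ctr b| = 2 ↔ t = b + 1)) ∧ (b < 0 → (|t - ctr b| = 1 ↔ t = b + 1) ∧
      (|t - ctr b| = 2 ↔ t = b)) := fun t ht => by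
    rcases abs_sub_ctr_eq ht hb with ⟨h1, h2⟩ | ⟨h1, h2⟩
    · refine ⟨fun _ => ?_, fun h => by omega⟩
      rw [h2]
      constructor <;> constructor <;> intro <;> linarith
    · refine ⟨fun h => by omega, fun _ => ?_⟩
      rw [h2]
      constructor <;> constructor <;> intro <;> linarith
  rcases lt_or_gt_of_ne hb with h0 | h0
  · rw [((key t h).2 h0).1, ((key t h).2 h0).2, ((key t' h').2 h0).1, ((key t' h').2 h0).2]
    tauto
  · rw [((key t h).1 h0).1, ((key t h).1 h0).2, ((key t' h').1 h0).1, ((key t' h').1 h0).2]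

lemma isFar_iff_abs {b : ℤ} {t : ℝ} (h : (b : ℝ) ≤ t ∧ t ≤ b + 1) (hb : b ≠ 0) :
    IsFar t ↔ |t - ctr b| ≠ 1 ∧ |t - ctr b| ≠ 2 := by
  have hint : ∀ c : ℤ, (t = c) → ¬ IsFar t := by
    rintro c rfl h'
    exact h'.2 (by simp)
  constructor
  · intro hf
    rcases abs_sub_ctr_eq h hb with ⟨h1, h2⟩ | ⟨h1, h2⟩ <;> rw [h2] <;>
      refine ⟨fun h3 => ?_, fun h3 => ?_⟩
    · exact hint b (by linarith) hf
    · exact hint (b + 1) (by push_cast; linarith) hf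
    · exact hint (b + 1) (by push_cast; linarith) hf
    · exact hint b (by linarith) hf
  · rintro ⟨h3, h4⟩
    have hne : t ≠ b ∧ t ≠ b + 1 := by
      rcases abs_sub_ctr_eq h hb with ⟨h1, h2⟩ | ⟨h1, h2⟩ <;> rw [h2] at h3 h4
      · exact ⟨fun h => h3 (by rw [h]; ring), fun h => h4 (by rw [h]; ring)⟩
      · exact ⟨fun h => h4 (by rw [h]; ring), fun h => h3 (by rw [h]; ring)⟩
    have h5 := floor_ceil_of_mem_Ioo ⟨lt_of_le_of_ne h.1 hne.1.symm, lt_of_le_of_ne h.2 hne.2⟩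
    rw [IsFar]
    omega

lemma outward_eq_abs {b : ℤ} {t : ℝ} (h : (b : ℝ) ≤ t ∧ t ≤ b + 1) (hb : b ≠ 0) (hf : IsFar t) :
    outward t = |t - ctr b| - 1 := by
  have hint : ∀ c : ℤ, t ≠ c := by
    rintro c rfl
    exact hf.2 (by simp)
  rw [outward_eq_outIn (b := b) ⟨lt_of_le_of_ne h.1 (hint b).symm,
    lt_of_le_of_ne h.2 (by exact_mod_cast hint (b + 1))⟩, outIn]
  rcases abs_sub_ctr_eq h hb with ⟨h1, h2⟩ | ⟨h1, h2⟩ <;> rw [h2]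
  · rw [if_pos h1]; ring
  · rw [if_neg (by omega)]; ring

lemma isFar_ne_zero {b : ℤ} {t : ℝ} (h : (b : ℝ) ≤ t ∧ t ≤ b + 1) (hf : IsFar t) : b ≠ 0 := by
  rintro rfl
  simp only [Int.cast_zero, zero_add] at h
  rcases h.1.eq_or_lt with h0 | h0
  · exact hf.2 (by rw [← h0]; simp)
  rcases h.2.eq_or_lt with h1 | h1
  · exact hf.2 (by rw [h1]; simp)
  exact not_near_of_far hf ⟨h0, h1⟩

lemma abs_sub_ctr_le_two {b : ℤ} {t : ℝ} (h : (b : ℝ) ≤ t ∧ t ≤ b + 1) (hb : b ≠ 0) :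
    |t - ctr b| ≤ 2 := by
  have := abs_sub_ctr_le h
  rwa [wid, if_neg hb] at this

/-- Inside a cube, cells are described by the distances from `ctr`. -/
lemma sameTorusCell_iff_of_cube {b : Fin n → ℤ} {x y : Fin n → ℝ} (hx : x ∈ cube b)
    (hy : y ∈ cube b) : SameTorusCell x y ↔
      (∀ i, b i = 0 → (x i = 0 ↔ y i = 0) ∧ (x i = 1 ↔ y i = 1)) ∧
      (∀ i, b i ≠ 0 → (|x i - ctr (b i)| = 1 ↔ |y i - ctr (b i)| = 1) ∧
        (|x i - ctr (b i)| = 2 ↔ |y i - ctr (b i)| = 2)) ∧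
      ∀ i j, b i ≠ 0 → b j ≠ 0 → (|x i - ctr (b i)| < |x j - ctr (b j)| ↔
        |y i - ctr (b i)| < |y j - ctr (b j)|) := by
  constructor
  · intro h
    have h2 : ∀ i, b i ≠ 0 → (|x i - ctr (b i)| = 1 ↔ |y i - ctr (b i)| = 1) ∧
        (|x i - ctr (b i)| = 2 ↔ |y i - ctr (b i)| = 2) := fun i hi =>
      (floor_ceil_iff_abs (hx i) (hy i) hi).1 (h.1 i)
    refine ⟨fun i hi => ?_, h2, fun i j hi hj => ?_⟩
    · have := (floor_ceil_iff (hx i) (hy i)).1 (h.1 i)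
      simpa [hi] using this
    · have a1 := one_le_abs_sub_ctr (hx i) hi
      have a2 := one_le_abs_sub_ctr (hx j) hj
      have a3 := one_le_abs_sub_ctr (hy i) hi
      have a4 := one_le_abs_sub_ctr (hy j) hj
      have b1 := abs_sub_ctr_le_two (hx i) hi
      have b2 := abs_sub_ctr_le_two (hx j) hj
      have b3 := abs_sub_ctr_le_two (hy i) hi
      have b4 := abs_sub_ctr_le_two (hy j) hj
      -- The values 1 and 2 are the extremes of the possible distances, so a comparison involving
      -- one of them follows from `h2`; the remaining case compares two far coordinates.
      by_cases c1 : |x i - ctr (b i)| = 1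
      · rw [c1, (h2 i hi).1.1 c1, a2.lt_iff_ne, a4.lt_iff_ne, ne_comm, ne_comm (a := (1 : ℝ))]
        exact not_congr (h2 j hj).1
      by_cases c2 : |x i - ctr (b i)| = 2
      · rw [c2, (h2 i hi).2.1 c2]
        exact iff_of_false b2.not_gt b4.not_gt
      by_cases c3 : |x j - ctr (b j)| = 1
      · rw [c3, (h2 j hj).1.1 c3]
        exact iff_of_false a1.not_gt a3.not_gt
      by_cases c4 : |x j - ctr (b j)| = 2
      · rw [c4, (h2 j hj).2.1 c4, b1.lt_iff_ne, b3.lt_iff_ne]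
        exact not_congr (h2 i hi).2
      have f1 := (isFar_iff_abs (hx i) hi).2 ⟨c1, c2⟩
      have f2 := (isFar_iff_abs (hx j) hj).2 ⟨c3, c4⟩
      have := h.lt_iff f1 f2
      rw [outward_eq_abs (hx i) hi f1, outward_eq_abs (hx j) hj f2,
        outward_eq_abs (hy i) hi ((h.far_iff i).1 f1),
        outward_eq_abs (hy j) hj ((h.far_iff j).1 f2)] at this
      simpa using this
  · rintro ⟨h1, h2, h3⟩
    have h0 : ∀ i, ⌊x i⌋ = ⌊y i⌋ ∧ ⌈x i⌉ = ⌈y i⌉ := fun i => by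
      by_cases hi : b i = 0
      · refine (floor_ceil_iff (hx i) (hy i)).2 ?_
        simpa [hi] using h1 i hi
      · exact (floor_ceil_iff_abs (hx i) (hy i) hi).2 (h2 i hi)
    refine sameTorusCell_of h0 fun i j hi hj => ?_
    have hbi := isFar_ne_zero (hx i) hi
    have hbj := isFar_ne_zero (hx j) hj
    have hi' : IsFar (y i) := by rwa [IsFar, ← (h0 i).1, ← (h0 i).2]
    have hj' : IsFar (y j) := by rwa [IsFar, ← (h0 j).1, ← (h0 j).2]
    rw [outward_eq_abs (hx i) hbi hi, outward_eq_abs (hx j) hbj hj,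
        outward_eq_abs (hy i) hbi hi', outward_eq_abs (hy j) hbj hj']
    simpa using h3 i j hbi hbj

/-! ### The subdivision of types -/

lemma near_of_outerIdx_eq_zero {t : ℝ} : outerIdx t = 0 ↔ 0 < t ∧ t < 1 := by
  rw [near_iff, outerIdx_eq]
  obtain ⟨h1, h2, h3, h4⟩ := floor_ceil_cases t
  split_ifs <;> omega

lemma abs_eq_outward_add_one {t : ℝ} (hf : IsFar t) :
    |t - ctr (outerIdx t)| = outward t + 1 := by
  have h := mem_cube_outer (fun _ : Fin 1 => t) 0
  rw [outward_eq_abs h (isFar_ne_zero h hf) hf]; ring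

lemma abs_eq_one_of_int {t : ℝ} (h : ⌊t⌋ = ⌈t⌉) : |t - ctr (outerIdx t)| = 1 := by
  have hb : outerIdx t ≠ 0 := fun h0 => by
    have := near_iff.1 (near_of_outerIdx_eq_zero.1 h0); omega
  have := (natAbs_innerIdx_lt_iff (mem_cube_outer (fun _ : Fin 1 => t) 0)).1 (by
    rw [natAbs_outerIdx_eq, if_pos h]; simp)
  exact this.2

/-- The numbers whose maximum is the distance from the centre of the covering cube. -/
def scaleSet (s : Datum) : Set ℝ :=
  {v | (∃ z ∈ s.1, v = |2 * z - 1|) ∨ (∃ u ∈ s.2.1, v = (u + 1) / 2) ∨ v = 1 / 2}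

/-- The distance from the centre of the covering cube. -/
noncomputable def scale (s : Datum) : ℝ := sSup (scaleSet s)

section

variable {k : ℕ} {x : Fin n → ℝ}

lemma exists_int (h : x ∈ sphereS n k) : ∃ i, ⌊x i⌋ = ⌈x i⌉ := by
  have h1 := intFin_card_of_mem h
  obtain ⟨i, hi⟩ := Finset.card_pos.1 (show 0 < (intFin x).card by omega)
  exact ⟨i, mem_intFin.1 hi⟩

lemma outerIdx_ne_zero_of_int {t : ℝ} (h : ⌊t⌋ = ⌈t⌉) : outerIdx t ≠ 0 := fun h0 => by
  have := near_iff.1 (near_of_outerIdx_eq_zero.1 h0); omega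

lemma abs_sub_half {t : ℝ} : |t - ctr 0| = |2 * t - 1| * wid 0 := by
  have : 2 * t - 1 = 2 * (t - ctr 0) := by simp [ctr]; ring
  rw [this, abs_mul]
  simp [wid]
  ring

/-- Divided by the half width, the distance from the centre is `|2z - 1|` for a near coordinate, `(u
+ 1) / 2` for a far one and `1 / 2` for an integer, which always occurs. So the projection factor is
visible in the datum. -/
lemma scale_eq (h : x ∈ sphereS n k) : scale (datum k x) = boxNorm (fun i => outerIdx (x i)) x := by
  obtain ⟨i₀, hi₀⟩ := exists_int h
  have hle := abs_sub_le_boxNorm (fun i => outerIdx (x i)) x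
  have hhalf := half_le_boxNorm (mem_cube_outer x) (outerIdx_ne_zero_of_int hi₀)
  refine IsGreatest.csSup_eq ⟨?_, ?_⟩
  · obtain ⟨i, hi⟩ := exists_eq_boxNorm (b := fun i => outerIdx (x i)) (x := x) (by linarith)
    rcases cases_coord (x i) with h1 | h1 | h1
    · left
      refine ⟨x i, List.mem_map_of_mem (mem_nearIdx.2 h1), ?_⟩
      rw [near_of_outerIdx_eq_zero.2 h1, abs_sub_half] at hi
      exact (mul_right_cancel₀ (wid_pos 0).ne' hi).symm
    · right; left
      refine ⟨outward (x i), mem_farVals.2 ⟨i, h1, rfl⟩, ?_⟩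
      rw [abs_eq_outward_add_one h1, wid, if_neg (isFar_ne_zero (mem_cube_outer x i) h1)] at hi
      linarith
    · right; right
      rw [abs_eq_one_of_int h1, wid, if_neg (outerIdx_ne_zero_of_int h1)] at hi
      linarith
  · rintro v (⟨z, hz, rfl⟩ | ⟨u, hu, rfl⟩ | rfl)
    · obtain ⟨i, hi, rfl⟩ := List.mem_map.1 hz
      have := hle i
      rw [near_of_outerIdx_eq_zero.2 (mem_nearIdx.1 hi), abs_sub_half] at this
      exact le_of_mul_le_mul_right this (wid_pos 0)
    · obtain ⟨i, hi, rfl⟩ := mem_farVals.1 hu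
      have := hle i
      rw [abs_eq_outward_add_one hi, wid, if_neg (isFar_ne_zero (mem_cube_outer x i) hi)] at this
      linarith
    · exact hhalf

end

open Classical in
/-- The datum of a point of the next sphere. -/
noncomputable def subDatum (n : ℕ) (s : Datum) : Datum :=
  if 0 < s.2.2 then (s.1, s.2.1, s.2.2 - 1) else
    ((s.1.map fun z => 1 / 2 + (z - 1 / 2) * (scale s)⁻¹).filter fun t => 0 < t ∧ t < 1,
      -- The added zeros stand for the integer coordinates, which start at distance 1 from the
      -- centre. The filter discards the coordinates that arrive on an outer face.
      ((s.2.1 + Multiset.replicate (n - s.1.length - s.2.1.card) 0).map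
        fun u => (u + 1) * (scale s)⁻¹ - 1).filter fun t => 0 < t ∧ t < 1,
      -- After the projection `lo` equals the new level, so the countdown is the number of integer
      -- coordinates minus one.
      n - 1 - ((s.1.map fun z => 1 / 2 + (z - 1 / 2) * (scale s)⁻¹).filter
          fun t => 0 < t ∧ t < 1).length -
        (((s.2.1 + Multiset.replicate (n - s.1.length - s.2.1.card) 0).map
        fun u => (u + 1) * (scale s)⁻¹ - 1).filter fun t => 0 < t ∧ t < 1).card)

section

variable {k : ℕ} {x : Fin n → ℝ}

lemma abs_push_sub {b : Fin n → ℤ} (h : 0 ≤ boxNorm b x) (i : Fin n) :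
    |push b x i - ctr (b i)| = |x i - ctr (b i)| * (boxNorm b x)⁻¹ := by
  rw [push, add_sub_cancel_left, abs_mul, abs_of_nonneg (inv_nonneg.2 h)]

/-- The properties of the projection of a point that is covered by a new cube. -/
lemma push_props (h : x ∈ sphereS n k) (h' : x ∉ sphereS n (k + 1)) {b : Fin n → ℤ}
    (hb : b = fun i => outerIdx (x i)) : x ∈ cube b ∧ push b x ∈ cube b ∧ len b = k + 1 ∧
      0 < boxNorm b x ∧ boxNorm b x < 1 ∧ (∀ i, innerIdx (push b x i) = b i) ∧
      (∀ i, b i = 0 → 0 < x i ∧ x i < 1) ∧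
      (∀ i, b i ≠ 0 → 1 < |push b x i - ctr (b i)|) ∧ ∃ i, b i ≠ 0 ∧ |x i - ctr (b i)| = 1 := by
  subst hb
  have hc := mem_cube_outer x
  have hlen : len (fun i => outerIdx (x i)) = k + 1 := hi_eq_of_notMem h h'
  have hpos := boxNorm_pos hc (by omega)
  have hf := push_facts h h'
  refine ⟨hc, push_mem_cube hc (by omega), hlen, hpos, hf.2.2.2.2, fun i => congrFun hf.2.2.1 i,
    fun i hi => near_of_outerIdx_eq_zero.1 hi, fun i hi => ?_, ?_⟩
  · rw [abs_push_sub hpos.le]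
    have h1 := one_le_abs_sub_ctr (hc i) hi
    have h2 := (one_lt_inv₀ hpos).2 hf.2.2.2.2
    exact lt_of_lt_of_le h2 (le_mul_of_one_le_left (by linarith) h1)
  · obtain ⟨i, hi⟩ := exists_int h
    exact ⟨i, outerIdx_ne_zero_of_int hi, abs_eq_one_of_int hi⟩

lemma push_near {b : Fin n → ℤ} {i : Fin n} (hi : b i = 0) :
    push b x i = 1 / 2 + (x i - 1 / 2) * (boxNorm b x)⁻¹ := by
  simp [push, hi, ctr]

end

lemma datum_third {k : ℕ} {x : Fin n → ℝ} (h : x ∈ sphereS n k) :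
    0 < (datum k x).2.2 ↔ x ∈ sphereS n (k + 1) := by
  rw [mem_sphereS] at *
  simp only [datum]
  omega

/-- The datum of the projected point is a function of the datum alone, because every distance is
divided by the same factor and that factor is `scale`. Hence `stage` descends to the subdivision
complex. -/
lemma datum_stage {k : ℕ} (x : sphereS n k) :
    datum (k + 1) (stageEquiv n k x).1 = subDatum n (datum k x.1) := by
  classical
  obtain ⟨x, hx⟩ := x
  by_cases h : x ∈ sphereS n (k + 1)
  · rw [stageEquiv_of_mem h, subDatum, if_pos ((datum_third hx).2 h)]
    simp only [datum]
    rw [Nat.sub_sub (hi x - 1)]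
  · rw [stageEquiv_of_notMem h, subDatum, if_neg (mt (datum_third hx).1 h), scale_eq hx]
    set b : Fin n → ℤ := fun i => outerIdx (x i) with hb
    set a := boxNorm b x with ha
    obtain ⟨hc, hc', hlen, hpos, hlt, hin, hnear, habs, -⟩ := push_props hx h hb
    have hnotnear : ∀ i, b i ≠ 0 → ¬ (0 < push b x i ∧ push b x i < 1) := fun i hi hn => by
      have h1 := hin i
      have h2 := near_iff.1 hn
      rw [innerIdx_eq, if_pos (by omega)] at h1
      omega
    have h1 : nearVals (push b x) = ((nearVals x).map fun z => 1 / 2 + (z - 1 / 2) * a⁻¹).filter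
        fun t => 0 < t ∧ t < 1 := by
      have : nearIdx (push b x) = (nearIdx x).filter fun i => 0 < push b x i ∧ push b x i < 1 := by
        unfold nearIdx
        rw [List.filter_filter]
        refine List.filter_congr fun i _ => ?_
        by_cases hi : b i = 0
        · simp [near_of_outerIdx_eq_zero.1 hi]
        · simp [hnotnear i hi]
      rw [nearVals, this, nearVals, List.map_map]
      have : (nearIdx x).map ((fun z => 1 / 2 + (z - 1 / 2) * a⁻¹) ∘ x) =
          (nearIdx x).map (push b x) := List.map_congr_left fun i hi =>
        (push_near (near_of_outerIdx_eq_zero.2 (mem_nearIdx.1 hi))).symm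
      rw [this, List.filter_map]
      rfl
    have h2 : farVals (push b x) = ((farVals x + Multiset.replicate
        (n - (nearVals x).length - (farVals x).card) 0).map
        fun u => (u + 1) * a⁻¹ - 1).filter fun t => 0 < t ∧ t < 1 := by
      -- Together, the far values and the zeros list the distances from the centre, minus 1, of all
      -- coordinates with `b i ≠ 0`.
      have hA : farVals x + Multiset.replicate (n - (nearVals x).length - (farVals x).card) 0 =
          (farIdx x ∪ intFin x).val.map fun i => |x i - ctr (b i)| - 1 := by
        have hdisj : Disjoint (farIdx x) (intFin x) := Finset.disjoint_left.2 fun i hi hi' =>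
          (mem_farIdx.1 hi).2 (mem_intFin.1 hi')
        have hval : (farIdx x ∪ intFin x).val = (farIdx x).val + (intFin x).val := by
          rw [← Finset.disjUnion_eq_union _ _ hdisj, Finset.disjUnion_val]
        rw [hval, Multiset.map_add]
        congr 1
        · exact Multiset.map_congr rfl fun i hi => by
            rw [abs_eq_outward_add_one (mem_farIdx.1 hi)]; ring
        · have hcard : n - (nearVals x).length - (farVals x).card = (intFin x).card := by
            rw [length_nearVals, card_farVals]
            have := card_add_card_add_card x
            omega
          rw [hcard]
          symm
          rw [Multiset.eq_replicate]
          refine ⟨by simp, fun v hv => ?_⟩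
          obtain ⟨i, hi, rfl⟩ := Multiset.mem_map.1 hv
          rw [abs_eq_one_of_int (mem_intFin.1 hi)]; ring
      have hcomp : (fun u => (u + 1) * a⁻¹ - 1) ∘ (fun i => |x i - ctr (b i)| - 1) =
          fun i => |push b x i - ctr (b i)| - 1 := by
        funext i
        simp only [Function.comp_apply, abs_push_sub hpos.le, sub_add_cancel, ha]
      rw [hA, Multiset.map_map, hcomp, Multiset.filter_map, ← Finset.filter_val]
      have hmem : ∀ i, i ∈ farIdx x ∪ intFin x ↔ b i ≠ 0 := fun i => by
        rw [Finset.mem_union, mem_farIdx, mem_intFin]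
        constructor
        · rintro (hi | hi)
          · exact isFar_ne_zero (hc i) hi
          · exact outerIdx_ne_zero_of_int hi
        · intro hi
          rcases cases_coord (x i) with h1 | h1 | h1
          · exact absurd (near_of_outerIdx_eq_zero.2 h1) hi
          · exact Or.inl h1
          · exact Or.inr h1
      have hfar : farIdx (push b x) = (farIdx x ∪ intFin x).filter
          ((fun t => 0 < t ∧ t < 1) ∘ fun i => |push b x i - ctr (b i)| - 1) := by
        ext i
        rw [mem_farIdx, Finset.mem_filter, hmem]
        constructor
        · intro hi
          have hi0 := isFar_ne_zero (hc' i) hi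
          have h3 := (isFar_iff_abs (hc' i) hi0).1 hi
          have h4 := abs_sub_ctr_le_two (hc' i) hi0
          have h5 := habs i hi0
          refine ⟨hi0, by simp only; linarith, ?_⟩
          have := lt_of_le_of_ne h4 h3.2
          linarith
        · rintro ⟨hi0, h3, h4⟩
          refine (isFar_iff_abs (hc' i) hi0).2 ⟨fun h => ?_, fun h => ?_⟩ <;>
            linarith
      rw [← hfar, farVals]
      exact Multiset.map_congr rfl fun i hi => outward_eq_abs (hc' i)
        (isFar_ne_zero (hc' i) (mem_farIdx.1 hi)) (mem_farIdx.1 hi)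
    refine Prod.ext h1 (Prod.ext h2 ?_)
    change hi (push b x) - 1 - (k + 1) = n - 1 - (List.length _) - Multiset.card _
    simp only [datum]
    rw [← h1, ← h2, length_nearVals, card_farVals, hi_eq_lo_add]
    have h3 : lo (push b x) = k + 1 := by
      rw [← hlen]
      unfold lo len
      simp only [hin]
    have := card_add_card_add_card (push b x)
    omega

/-- The subdivision map. -/
noncomputable def subFun (s : TypeSpace n) : TypeSpace n :=
  ⟨subDatum n s.1, by
    obtain ⟨k, x, rfl⟩ := exists_toType_eq s
    exact ⟨k + 1, _, (stageEquiv n k x).2, datum_stage x⟩⟩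

lemma subFun_toType {k : ℕ} (x : sphereS n k) :
    subFun (toType n k x) = toType n (k + 1) (stage n k x) := Subtype.ext (datum_stage x).symm

lemma continuous_subFun : Continuous (subFun : TypeSpace n → TypeSpace n) := by
  refine continuous_of_comp_toType fun k => ?_
  have : subFun ∘ toType n k = toType n (k + 1) ∘ stage n k := funext subFun_toType
  rw [this]
  exact (continuous_toType n (k + 1)).comp (stage n k).continuous

/-- The faces of the covering cube that the point is projected to. -/
def pattern (s : Datum) : List (Prop × Prop) × Prop :=
  (s.1.map fun z => (2 * z - 1 = scale s ∧ s.2.2 = 0, 1 - 2 * z = scale s ∧ s.2.2 = 0),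
    (∃ u, (u = 0 ∨ u ∈ s.2.1) ∧ (u + 1) / 2 = scale s) ∧ s.2.2 = 0)

end TorusFSR

/-! ### How the projection to the outer faces cuts cells -/

namespace TorusFSR

variable {n : ℕ}

lemma push_eq_one_iff {b : Fin n → ℤ} {x : Fin n → ℝ} (hpos : 0 < boxNorm b x) {i : Fin n}
    (hi : b i = 0) : (push b x i = 1 ↔ 2 * x i - 1 = boxNorm b x) ∧
      (push b x i = 0 ↔ 1 - 2 * x i = boxNorm b x) := by
  rw [push_near hi]
  constructor <;> constructor <;> intro h
  · field_simp at h; linarith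
  · rw [← h] at hpos ⊢; field_simp; ring
  · field_simp at h; linarith
  · rw [← h] at hpos ⊢; field_simp; ring

lemma abs_push_eq_two_iff {b : Fin n → ℤ} {x : Fin n → ℝ} (hpos : 0 < boxNorm b x) {i : Fin n} :
    |push b x i - ctr (b i)| = 2 ↔ |x i - ctr (b i)| = 2 * boxNorm b x := by
  rw [abs_push_sub hpos.le, ← div_eq_mul_inv, div_eq_iff hpos.ne']

section

variable {k : ℕ} {x y : Fin n → ℝ}

/-- A common factor preserves the order of the distances, so the cell of the image records the cell
of the point and, in addition, only which coordinates reach an outer face and on which side. -/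
lemma sameTorusCell_push_iff (hx : x ∈ sphereS n k) (hx' : x ∉ sphereS n (k + 1))
    (hy : y ∈ sphereS n k) (hy' : y ∉ sphereS n (k + 1)) {b : Fin n → ℤ}
    (hbx : b = fun i => outerIdx (x i)) (hby : b = fun i => outerIdx (y i)) :
    SameTorusCell (push b x) (push b y) ↔ SameTorusCell x y ∧
      (∀ i, b i = 0 → (2 * x i - 1 = boxNorm b x ↔ 2 * y i - 1 = boxNorm b y) ∧
        (1 - 2 * x i = boxNorm b x ↔ 1 - 2 * y i = boxNorm b y)) ∧
      ∀ i, b i ≠ 0 → (|x i - ctr (b i)| = 2 * boxNorm b x ↔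
        |y i - ctr (b i)| = 2 * boxNorm b y) := by
  obtain ⟨cx, cx', -, px, lx, ix, nx, ax, ix₀, hix₀, hix₁⟩ := push_props hx hx' hbx
  obtain ⟨cy, cy', -, py, ly, iy, ny, ay, iy₀, hiy₀, hiy₁⟩ := push_props hy hy' hby
  rw [sameTorusCell_iff_of_cube cx' cy', sameTorusCell_iff_of_cube cx cy]
  have hlt : ∀ i j, (|push b x i - ctr (b i)| < |push b x j - ctr (b j)| ↔
      |push b y i - ctr (b i)| < |push b y j - ctr (b j)|) ↔
      (|x i - ctr (b i)| < |x j - ctr (b j)| ↔ |y i - ctr (b i)| < |y j - ctr (b j)|) := by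
    intro i j
    rw [abs_push_sub px.le, abs_push_sub px.le, abs_push_sub py.le, abs_push_sub py.le,
      mul_lt_mul_iff_left₀ (inv_pos.2 px), mul_lt_mul_iff_left₀ (inv_pos.2 py)]
  have htwo : ∀ i, b i ≠ 0 → |x i - ctr (b i)| ≠ 2 ∧ |y i - ctr (b i)| ≠ 2 := fun i hi => by
    have h1 := abs_sub_le_boxNorm b x i
    have h2 := abs_sub_le_boxNorm b y i
    rw [wid, if_neg hi] at h1 h2
    constructor <;> intro h <;> linarith
  constructor
  · rintro ⟨h1, h2, h3⟩
    have h3' := fun i j hi hj => (hlt i j).1 (h3 i j hi hj)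
    refine ⟨⟨fun i hi => ?_, fun i hi => ⟨?_, ?_⟩, h3'⟩, fun i hi => ?_, fun i hi => ?_⟩
    · have := nx i hi; have := ny i hi
      exact ⟨iff_of_false (by linarith) (by linarith), iff_of_false (by linarith) (by linarith)⟩
    -- Lying on an inner face is read off from the order: each point has a coordinate at the least
    -- possible distance 1, so distance 1 means that no distance is smaller.
    · have a1 := one_le_abs_sub_ctr (cx i) hi
      have a2 := one_le_abs_sub_ctr (cy i) hi
      constructor <;> intro h
      · refine le_antisymm (not_lt.1 fun h' => ?_) a2
        have := (h3' iy₀ i hiy₀ hi).2 (by rwa [hiy₁])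
        linarith [one_le_abs_sub_ctr (cx iy₀) hiy₀]
      · refine le_antisymm (not_lt.1 fun h' => ?_) a1
        have := (h3' ix₀ i hix₀ hi).1 (by rwa [hix₁])
        linarith [one_le_abs_sub_ctr (cy ix₀) hix₀]
    · exact iff_of_false (htwo i hi).1 (htwo i hi).2
    · rw [← (push_eq_one_iff px hi).1, ← (push_eq_one_iff px hi).2, ← (push_eq_one_iff py hi).1,
        ← (push_eq_one_iff py hi).2]
      exact (h1 i hi).symm
    · rw [← abs_push_eq_two_iff px, ← abs_push_eq_two_iff py]
      exact (h2 i hi).2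
  · rintro ⟨⟨h1, h2, h3⟩, h4, h5⟩
    refine ⟨fun i hi => ?_, fun i hi => ⟨?_, ?_⟩, fun i j hi hj => (hlt i j).2 (h3 i j hi hj)⟩
    · rw [(push_eq_one_iff px hi).1, (push_eq_one_iff px hi).2, (push_eq_one_iff py hi).1,
        (push_eq_one_iff py hi).2]
      exact (h4 i hi).symm
    · exact iff_of_false (ax i hi).ne' (ay i hi).ne'
    · rw [abs_push_eq_two_iff px, abs_push_eq_two_iff py]
      exact h5 i hi

/-- While the countdown is positive the pattern carries no information: cells that stay exposed are
not cut. -/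
lemma pattern_eq_of_mem (h : SameTorusCell x y) (hx : x ∈ sphereS n k) (hx' : x ∈ sphereS n (k + 1)) :
    pattern (datum k x) = pattern (datum k y) := by
  have h1 := (datum_third hx).2 hx'
  have h2 := (datum_third (h.mem_sphereS.1 hx)).2 (h.mem_sphereS.1 hx')
  have key : ∀ s : Datum, 0 < s.2.2 →
      pattern s = (List.replicate s.1.length (False, False), False) := fun s hs => by
    simp only [pattern, hs.ne', and_false]
    rw [List.map_const']
  rw [key _ h1, key _ h2, (h.sameType k).1]

/-- In the directions with `b i ≠ 0` one proposition is enough. The coordinates that reach an outer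
face are those of greatest distance, provided that any does, and the order within the cell already
tells which these are. -/
lemma pattern_eq_iff (h : SameTorusCell x y) (hx : x ∈ sphereS n k) (hx' : x ∉ sphereS n (k + 1))
    {b : Fin n → ℤ} (hb : b = fun i => outerIdx (x i)) :
    pattern (datum k x) = pattern (datum k y) ↔
      (∀ i, b i = 0 → (2 * x i - 1 = boxNorm b x ↔ 2 * y i - 1 = boxNorm b y) ∧
        (1 - 2 * x i = boxNorm b x ↔ 1 - 2 * y i = boxNorm b y)) ∧
      ∀ i, b i ≠ 0 → (|x i - ctr (b i)| = 2 * boxNorm b x ↔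
        |y i - ctr (b i)| = 2 * boxNorm b y) := by
  have hby : b = fun i => outerIdx (y i) := by rw [hb]; funext i; exact h.outerIdx_eq i
  have hy : y ∈ sphereS n k := h.mem_sphereS.1 hx
  have hy' : y ∉ sphereS n (k + 1) := mt h.mem_sphereS.2 hx'
  have hcx : (datum k x).2.2 = 0 := Nat.eq_zero_of_not_pos (mt (datum_third hx).1 hx')
  have hcy : (datum k y).2.2 = 0 := Nat.eq_zero_of_not_pos (mt (datum_third hy).1 hy')
  obtain ⟨cx, -, -, px, -⟩ := push_props hx hx' hb
  obtain ⟨cy, -, -, py, -⟩ := push_props hy hy' hby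
  have hlt := ((sameTorusCell_iff_of_cube cx cy).1 h).2.2
  unfold pattern
  rw [hcx, hcy, scale_eq hx, scale_eq hy, ← hb, ← hby]
  simp only [and_true]
  rw [Prod.ext_iff]
  refine and_congr ?_ ?_
  · simp only [datum, nearVals, List.map_map]
    rw [← h.nearIdx_eq, List.map_inj_left]
    refine forall_congr' fun i => ?_
    rw [mem_nearIdx, ← near_of_outerIdx_eq_zero, ← congrFun hb i]
    refine imp_congr_right fun hi => ?_
    simp [Prod.ext_iff]
  · have htop : ∀ z, SameTorusCell x z → z ∈ sphereS n k → ((∃ u, (u = 0 ∨ u ∈ (datum k z).2.1) ∧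
        (u + 1) / 2 = boxNorm b z) ↔ ∃ i, b i ≠ 0 ∧ |z i - ctr (b i)| = 2 * boxNorm b z) := by
      intro z hz hzk
      have hbz : ∀ i, b i = outerIdx (z i) := fun i => by rw [hb]; exact hz.outerIdx_eq i
      constructor
      · rintro ⟨u, rfl | hu, hu'⟩
        · obtain ⟨i, hi⟩ := exists_int hzk
          refine ⟨i, by rw [hbz]; exact outerIdx_ne_zero_of_int hi, ?_⟩
          rw [hbz, abs_eq_one_of_int hi]; linarith
        · obtain ⟨i, hi, rfl⟩ := mem_farVals.1 hu
          refine ⟨i, by rw [hbz]; exact isFar_ne_zero (mem_cube_outer z i) hi, ?_⟩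
          rw [hbz, abs_eq_outward_add_one hi]; linarith
      · rintro ⟨i, hi, hi'⟩
        rcases cases_coord (z i) with h1 | h1 | h1
        · exact absurd ((hbz i).trans (near_of_outerIdx_eq_zero.2 h1)) hi
        · refine ⟨outward (z i), Or.inr (mem_farVals.2 ⟨i, h1, rfl⟩), ?_⟩
          rw [hbz, abs_eq_outward_add_one h1] at hi'
          linarith
        · refine ⟨0, Or.inl rfl, ?_⟩
          rw [hbz, abs_eq_one_of_int h1] at hi'
          linarith
    have hle : ∀ z i, b i ≠ 0 → |z i - ctr (b i)| ≤ 2 * boxNorm b z := fun z i hi => by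
      have := abs_sub_le_boxNorm b z i
      rw [wid, if_neg hi] at this
      linarith
    rw [eq_iff_iff, htop x (SameTorusCell.refl x) hx, htop y h hy]
    constructor
    · intro hiff i hi
      have key : ∀ z w : Fin n → ℝ, (∀ i j, b i ≠ 0 → b j ≠ 0 → (|z i - ctr (b i)| <
          |z j - ctr (b j)| ↔ |w i - ctr (b i)| < |w j - ctr (b j)|)) →
          (∃ i, b i ≠ 0 ∧ |w i - ctr (b i)| = 2 * boxNorm b w) →
          |z i - ctr (b i)| = 2 * boxNorm b z → |w i - ctr (b i)| = 2 * boxNorm b w := by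
        rintro z w hzw ⟨j, hj, hjw⟩ hz
        refine le_antisymm (hle w i hi) (not_lt.1 fun h => ?_)
        rw [← hjw, ← hzw i j hi hj, hz] at h
        exact absurd (hle z j hj) (not_le.2 h)
      exact ⟨fun h => key x y hlt (hiff.1 ⟨i, hi, h⟩) h,
        fun h => key y x (fun i j hi hj => (hlt i j hi hj).symm) (hiff.2 ⟨i, hi, h⟩) h⟩
    · intro hiff
      exact exists_congr fun i => and_congr_right fun hi => hiff i hi

lemma stageEquiv_mem_iff (x : sphereS n k) :
    (stageEquiv n k x : Fin n → ℝ) ∈ sphereS n k ↔ (x : Fin n → ℝ) ∈ sphereS n (k + 1) := by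
  constructor
  · intro h
    by_contra hx
    rw [stageEquiv_of_notMem hx] at h
    exact (push_facts x.2 hx).2.1 h
  · intro h
    rw [stageEquiv_of_mem h]
    exact x.2

lemma innerIdx_stageEquiv {x : sphereS n k} (h : (x : Fin n → ℝ) ∉ sphereS n (k + 1)) (i : Fin n) :
    innerIdx ((stageEquiv n k x : Fin n → ℝ) i) = outerIdx (x.1 i) := by
  rw [stageEquiv_of_notMem h]
  exact congrFun (push_facts x.2 h).2.2.1 i

/-- The cells of the next sphere, in terms of the present one. -/
lemma sameTorusCell_stage_iff (x y : sphereS n k) :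
    SameTorusCell (stageEquiv n k x).1 (stageEquiv n k y).1 ↔
      SameTorusCell x.1 y.1 ∧ pattern (datum k x.1) = pattern (datum k y.1) := by
  by_cases hx : (x : Fin n → ℝ) ∈ sphereS n (k + 1)
  · constructor
    · intro h
      have hy : (y : Fin n → ℝ) ∈ sphereS n (k + 1) :=
        (stageEquiv_mem_iff y).1 (h.mem_sphereS.1 ((stageEquiv_mem_iff x).2 hx))
      rw [stageEquiv_of_mem hx, stageEquiv_of_mem hy] at h
      exact ⟨h, pattern_eq_of_mem h x.2 hx⟩
    · rintro ⟨h, -⟩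
      rw [stageEquiv_of_mem hx, stageEquiv_of_mem (h.mem_sphereS.1 hx)]
      exact h
  · constructor
    · intro h
      have hy : (y : Fin n → ℝ) ∉ sphereS n (k + 1) := fun hy =>
        hx ((stageEquiv_mem_iff x).1 (h.mem_sphereS.2 ((stageEquiv_mem_iff y).2 hy)))
      have hb : (fun i => outerIdx (x.1 i)) = fun i => outerIdx (y.1 i) := funext fun i => by
        rw [← innerIdx_stageEquiv hx, ← innerIdx_stageEquiv hy]
        exact h.innerIdx_eq i
      rw [stageEquiv_of_notMem hx, stageEquiv_of_notMem hy, ← hb,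
        sameTorusCell_push_iff x.2 hx y.2 hy rfl hb] at h
      exact ⟨h.1, (pattern_eq_iff h.1 x.2 hx rfl).2 h.2⟩
    · rintro ⟨h, hp⟩
      have hy : (y : Fin n → ℝ) ∉ sphereS n (k + 1) := mt h.mem_sphereS.2 hx
      have hb : (fun i => outerIdx (x.1 i)) = fun i => outerIdx (y.1 i) :=
        funext fun i => h.outerIdx_eq i
      rw [stageEquiv_of_notMem hx, stageEquiv_of_notMem hy, ← hb,
        sameTorusCell_push_iff x.2 hx y.2 hy rfl hb]
      exact ⟨h, (pattern_eq_iff h x.2 hx rfl).1 hp⟩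

end

/-! ### The subdivision of the subdivision complex -/

/-- The setoid of the open cells of the subdivision. -/
def subRel (n : ℕ) : Setoid (TypeSpace n) :=
  typeRel n ⊓ Setoid.ker fun s => pattern s.1

lemma subRel_iff {s t : TypeSpace n} :
    subRel n s t ↔ typeRel n s t ∧ pattern s.1 = pattern t.1 := Iff.rfl

/-- The dimension of the cell of the subdivision. -/
noncomputable def subDim (s : TypeSpace n) : ℕ := typeDim (subFun s)

/-- Two points of the subdivision complex in a common cell lift to a common cell. -/
lemma exists_lift {k : ℕ} (x : sphereS n k) {t : TypeSpace n} (h : typeRel n (toType n k x) t) :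
    ∃ y : sphereS n k, SameTorusCell x.1 y.1 ∧ toType n k y = t := by
  obtain ⟨y, hy, hyt⟩ := (bijOn_toType x).surjOn ⟨mem_univ _, h⟩
  exact ⟨y, hy, hyt⟩

lemma subRel_toType_iff {k : ℕ} {x y : sphereS n k} (h : SameTorusCell x.1 y.1) :
    subRel n (toType n k x) (toType n k y) ↔
      SameTorusCell (stage n k x).1 (stage n k y).1 := by
  rw [subRel_iff, coe_stage, sameTorusCell_stage_iff]
  exact ⟨fun h' => ⟨h, h'.2⟩, fun h' => ⟨h.sameType k, h'.2⟩⟩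

lemma subDim_toType {k : ℕ} (x : sphereS n k) :
    subDim (toType n k x) = cellDim (stage n k x).1 := by
  rw [subDim, subFun_toType]; rfl

lemma subDim_congr (s t : TypeSpace n) (h : subRel n s t) : subDim s = subDim t := by
  obtain ⟨k, x, rfl⟩ := exists_toType_eq s
  obtain ⟨y, hy, rfl⟩ := exists_lift x h.1
  rw [subDim_toType, subDim_toType]
  exact ((subRel_toType_iff hy).1 h).cellDim_eq

/-- The cells of the next sphere are mapped bijectively to the cells of the subdivision. -/
lemma bijOn_toType_stage_symm {k : ℕ} (x : sphereS n k) :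
    BijOn (fun y => toType n k ((stage n k).symm y)) {y | SameTorusCell (stage n k x).1 y.1}
      (classIn univ (subRel n) (toType n k x)) := by
  have hpre : ∀ y : sphereS n (k + 1), SameTorusCell (stage n k x).1 y.1 →
      SameTorusCell x.1 ((stage n k).symm y).1 := fun y hy => by
    have : (stage n k ((stage n k).symm y)) = y := (stage n k).apply_symm_apply y
    rw [← this] at hy
    exact ((sameTorusCell_stage_iff _ _).1 hy).1
  refine ⟨fun y hy => ⟨mem_univ _, ?_⟩, fun y hy z hz h => ?_, fun s hs => ?_⟩
  · refine (subRel_toType_iff (hpre y hy)).2 ?_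
    rw [(stage n k).apply_symm_apply]
    exact hy
  · exact (stage n k).symm.injective ((bijOn_toType x).injOn (hpre y hy) (hpre z hz) h)
  · obtain ⟨y, hy, rfl⟩ := exists_lift x hs.2.1
    refine ⟨stage n k y, (subRel_toType_iff hy).1 hs.2, ?_⟩
    simp only [(stage n k).symm_apply_apply]

/-- Cells of the subdivision are parametrized by charts of cells of the next sphere, carried back by
the inverse of `stage`. -/
lemma hasCharMaps_sub (n : ℕ) : HasCharMaps univ (subRel n) subDim fun _ _ _ => True := by
  rintro m ⟨_, s, -, hm, rfl⟩
  obtain ⟨k, x, rfl⟩ := exists_toType_eq s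
  rw [subDim_toType] at hm
  obtain ⟨ρ, hρ⟩ := exists_isCellChart (stage n k x).1 hm
  obtain ⟨f, hf, -⟩ := hρ.exists_isCharMap (C := univ) (dim := subDim)
    (fun y => toType n k ((stage n k).symm y))
    ((continuous_toType n k).comp (stage n k).symm.continuous)
    (fun y => ⟨mem_univ _, by rw [subDim_toType, (stage n k).apply_symm_apply]⟩)
    (closure_torusCell_subset (stage n k x).2)
    (fun y y' h h' he => (bijOn_toType_stage_symm x).injOn h h' he)
  rw [(bijOn_toType_stage_symm x).image_eq] at hf
  exact ⟨f, hf, trivial⟩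

lemma exists_cube_stageEquiv {k : ℕ} (x : sphereS n k) :
    ∃ b, len b = k + 1 ∧ x.1 ∈ cube b ∧ (stageEquiv n k x).1 ∈ cube b := by
  have h1 := mem_sphereS.1 x.2
  obtain ⟨b, hb, hlen⟩ := exists_cube_len_eq (x := x.1) (m := k + 1) (by omega) (by omega)
  refine ⟨b, hlen, hb, ?_⟩
  rw [stageEquiv_of_mem_cube hlen hb]
  exact push_mem_cube hb (by omega)

lemma finite_sub_classes (n : ℕ) :
    Finite (Σ m, {s : Set (TypeSpace n) // IsClassOfDim univ (subRel n) subDim m s}) := by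
  -- The bound is 3 because `stage` moves a point within a unit cube, hence by at most 1 in each
  -- coordinate, and `y` has coordinates in `[0,2]`.
  refine finite_sigma_classes subDim_congr (finite_classes_of_small (c := 3)
    (fun l c => (fun y => toType n l ((stage n l).symm y)) '' {y | y.1 ∈ c}) fun s _ => ?_)
  obtain ⟨k, ⟨x, hx⟩, rfl⟩ := exists_toType_eq s
  obtain ⟨l, hl, y, hy, hb, he⟩ := exists_small_datum_eq hx
  obtain ⟨b, -, h1, h2⟩ := exists_cube_stageEquiv ⟨y, hy⟩
  refine ⟨l, hl, (stage n l ⟨y, hy⟩).1, fun i => ?_, ?_⟩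
  · have a1 := h1 i
    have a2 := h2 i
    have a3 := hb i
    simp only [coe_stage] at a1 a2 ⊢
    push_cast
    constructor <;> linarith
  · have h1 : toType n k ⟨x, hx⟩ = toType n l ⟨y, hy⟩ := Subtype.ext he.symm
    rw [h1, ← (bijOn_toType_stage_symm ⟨y, hy⟩).image_eq]
    rfl

/-- The CW structure of the subdivision. -/
@[reducible]
noncomputable def subCW (n : ℕ) : CWComplex (univ : Set (TypeSpace n)) :=
  (hasCharMaps_sub n).cw subDim_congr (finite_sub_classes n)

lemma isSubdivision_subCW (hn : 1 ≤ n) : IsSubdivision (subCW n) (typeCW hn) := by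
  intro m c
  obtain ⟨s, -, -, hs⟩ := (hasCharMaps_sub n).exists_of_cell _ _ m c
  refine ⟨_, typeCell hn s, ?_⟩
  rw [openCell_typeCell]
  refine hs.trans_subset fun t ht => ⟨mem_univ _, ht.2.1⟩

/-- The same cell of the next sphere maps bijectively to the cell of the subdivision and to a cell
of the complex, and `subFun` intertwines the two bijections. -/
lemma bijOn_subFun (s : TypeSpace n) :
    BijOn subFun (classIn univ (subRel n) s) (classIn univ (typeRel n) (subFun s)) := by
  obtain ⟨k, x, rfl⟩ := exists_toType_eq s
  have h1 := bijOn_toType_stage_symm x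
  have h2 := bijOn_toType (stage n k x)
  have h3 : EqOn (toType n (k + 1)) (subFun ∘ fun y => toType n k ((stage n k).symm y))
      {y | SameTorusCell (stage n k x).1 y.1} := fun y _ => by
    simp only [Function.comp, subFun_toType, (stage n k).apply_symm_apply]
  rw [subFun_toType]
  have h4 := h2.congr h3
  rw [← h1.image_eq]
  exact (bijOn_comp_iff h1.injOn).1 h4

end TorusFSR

namespace TorusFSR

variable {n : ℕ}

/-! ### The tiles -/

/-- The type of the standard point. -/
noncomputable def stdType (n : ℕ) (p : Icc 1 n) : TypeSpace n :=
  toType n (p - 1) ⟨stdPt n p, stdPt_mem_sphereS p.2.1 p.2.2⟩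

lemma typeDim_stdType (p : Icc 1 n) : typeDim (stdType n p) = n - 1 := cellDim_stdPt p.2.1 p.2.2

/-- The tile of the standard point. -/
noncomputable def stdCell (hn : 1 ≤ n) (p : Icc 1 n) : Cell (typeCW hn) (n - 1) :=
  Classical.choose (exists_openCell_typeCW hn (stdType n p) (typeDim_stdType p))

lemma openCell_stdCell (hn : 1 ≤ n) (p : Icc 1 n) :
    openCell (typeCW hn) (n - 1) (stdCell hn p) = classIn univ (typeRel n) (stdType n p) :=
  Classical.choose_spec (exists_openCell_typeCW hn (stdType n p) (typeDim_stdType p))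

lemma typeRel_stdType_iff (hn : 1 ≤ n) {p : Icc 1 n} {k : ℕ} {x : sphereS n k}
    (hd : cellDim x.1 = n - 1) :
    typeRel n (stdType n p) (toType n k x) ↔ (nearFin x.1).card + p = n := by
  have hp := p.2
  have h0 := card_nearFin_stdPt hp.2
  constructor
  · intro h
    have h1 : (nearVals (stdPt n p)).length = (nearVals x.1).length := h.1
    rw [length_nearVals, length_nearVals] at h1
    have := hp.2
    omega
  · intro h
    obtain ⟨h1, h2⟩ := sameType_stdPt hn x.2 hd
    have h3 := top_facts hn x.2 hd
    have h4 : (farVals x.1).card + 1 = p := by omega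
    have h5 : (farVals x.1).card = p - 1 := by omega
    rw [h4, h5] at h2
    exact h2

lemma cell_eq_of_openCell_eq {X : Type*} [TopologicalSpace X] {C : Set X} (K : CWComplex C) {m : ℕ}
    {c c' : Cell K m} (h : openCell K m c = openCell K m c') : c = c' := by
  have h1 : charMap K m c 0 ∈ openCell K m c := ⟨0, by simp, rfl⟩
  have := cell_eq_of_mem_openCell K h1 (h ▸ h1)
  simpa using this

lemma stdCell_injective (hn : 1 ≤ n) : Function.Injective (stdCell hn) := by
  intro p p' h
  have h1 : stdType n p' ∈ classIn univ (typeRel n) (stdType n p) := by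
    rw [← openCell_stdCell hn, h, openCell_stdCell]
    exact mem_classIn_self (mem_univ _)
  have h2 := (typeRel_stdType_iff hn (x := ⟨stdPt n p', stdPt_mem_sphereS p'.2.1 p'.2.2⟩)
    (cellDim_stdPt p'.2.1 p'.2.2)).1 h1.2
  rw [card_nearFin_stdPt p'.2.2] at h2
  have := p'.2.2
  exact Subtype.ext (by omega)

lemma exists_stdCell_eq (hn : 1 ≤ n) {k : ℕ} {x : sphereS n k} (hd : cellDim x.1 = n - 1) :
    ∃ p : Icc 1 n, (nearFin x.1).card + p = n ∧ typeRel n (stdType n p) (toType n k x) := by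
  have h3 := top_facts hn x.2 hd
  have hp : n - (nearFin x.1).card ∈ Icc 1 n := ⟨by omega, by omega⟩
  have h4 : (nearFin x.1).card + (n - (nearFin x.1).card) = n := by omega
  exact ⟨⟨_, hp⟩, h4, (typeRel_stdType_iff hn hd).2 h4⟩

lemma exists_openCell_eq (hn : 1 ≤ n) (c : Cell (typeCW hn) (n - 1)) : ∃ k, ∃ x : sphereS n k,
    cellDim x.1 = n - 1 ∧
      openCell (typeCW hn) (n - 1) c = classIn univ (typeRel n) (toType n k x) := by
  obtain ⟨s, -, hs, hc⟩ := (hasCharMaps_type hn).exists_of_cell _ _ _ c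
  obtain ⟨k, x, rfl⟩ := exists_toType_eq s
  exact ⟨k, x, hs, hc⟩

lemma stdCell_surjective (hn : 1 ≤ n) : Function.Surjective (stdCell hn) := by
  intro c
  obtain ⟨k, x, hd, hc⟩ := exists_openCell_eq hn c
  obtain ⟨p, -, hp⟩ := exists_stdCell_eq hn hd
  refine ⟨p, cell_eq_of_openCell_eq _ ?_⟩
  rw [openCell_stdCell, hc, classIn_eq hp]

/-- The bijection between `{1, …, n}` and the tiles. -/
noncomputable def tileEquiv (hn : 1 ≤ n) : Icc 1 n ≃ Cell (typeCW hn) (n - 1) :=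
  Equiv.ofBijective (stdCell hn) ⟨stdCell_injective hn, stdCell_surjective hn⟩

lemma openCell_tileEquiv (hn : 1 ≤ n) (p : Icc 1 n) :
    openCell (typeCW hn) (n - 1) (tileEquiv hn p) = classIn univ (typeRel n) (stdType n p) :=
  openCell_stdCell hn p

/-! ### The subdivision of a tile -/

/-- The cube that covers the standard point. -/
def stdBox (n p : ℕ) : Fin n → ℤ := fun i => if (i : ℕ) < p then 1 else 0

lemma stdBox_of_lt {p : ℕ} {i : Fin n} (h : (i : ℕ) < p) : stdBox n p i = 1 := if_pos h

lemma stdBox_of_le {p : ℕ} {i : Fin n} (h : p ≤ i) : stdBox n p i = 0 := if_neg (not_lt.2 h)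

lemma stdBox_eq_zero {p : ℕ} {i : Fin n} : stdBox n p i = 0 ↔ p ≤ i := by
  unfold stdBox; split_ifs with h <;> simp <;> omega

lemma ctr_one : ctr 1 = 0 := by simp [ctr]

lemma outerIdx_of_same {p : ℕ} {y : Fin n → ℝ} (h : SameTorusCell (stdPt n p) y) :
    stdBox n p = fun i => outerIdx (y i) := by
  funext i
  rw [← h.outerIdx_eq i]
  by_cases hi : (i : ℕ) < p
  · rw [stdBox_of_lt hi]
    by_cases h0 : 0 < (i : ℕ)
    · have := floor_ceil_of_mem_Ioo (stdPt_mem hi h0)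
      rw [outerIdx_eq, this.1, this.2]; simp
    · rw [stdPt_of_lt hi, Nat.eq_zero_of_not_pos h0]; simp [outerIdx_eq]
  · rw [stdBox_of_le (not_lt.1 hi), near_of_outerIdx_eq_zero.2 (near_stdPt.2 (not_lt.1 hi))]

/-- `i` is the only coordinate that is projected to an outer face. -/
def IsOnlyOuter (b : Fin n → ℤ) (x : Fin n → ℝ) (i : Fin n) : Prop :=
  ∀ j, |x j - ctr (b j)| = boxNorm b x * wid (b j) ↔ j = i

lemma isOnlyOuter_of {b : Fin n → ℤ} {x : Fin n → ℝ} {i : Fin n} {a : ℝ} (ha : 0 < a)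
    (hi : |x i - ctr (b i)| = a * wid (b i))
    (h : ∀ j, j ≠ i → |x j - ctr (b j)| < a * wid (b j)) : IsOnlyOuter b x i := by
  have hnorm : boxNorm b x = a := by
    refine le_antisymm ((pi_norm_le_iff_of_nonneg ha.le).2 fun j => ?_) ?_
    · rw [Real.norm_eq_abs, abs_div, abs_of_pos (wid_pos _), div_le_iff₀ (wid_pos _)]
      by_cases hj : j = i
      · rw [hj]; exact hi.le
      · exact (h j hj).le
    · have := abs_sub_le_boxNorm b x i
      rw [hi] at this
      exact le_of_mul_le_mul_right this (wid_pos _)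
  intro j
  rw [hnorm]
  refine ⟨fun hj => ?_, fun hj => hj ▸ hi⟩
  by_contra hne
  exact (h j hne).ne hj

section

variable {k : ℕ} {x y : Fin n → ℝ} {b : Fin n → ℤ}

/-- The shortest cube of the image is `b` itself, so its integer coordinates are exactly those on
outer faces. -/
lemma mem_intFin_push (hx : x ∈ sphereS n k) (hx' : x ∉ sphereS n (k + 1))
    (hb : b = fun i => outerIdx (x i)) {j : Fin n} :
    j ∈ intFin (push b x) ↔ |x j - ctr (b j)| = boxNorm b x * wid (b j) := by
  obtain ⟨cx, cx', -, px, lx, ix, nx, ax, -⟩ := push_props hx hx' hb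
  have h1 := natAbs_lt_outerIdx_iff (cx' j)
  rw [natAbs_outerIdx_eq, ix] at h1
  rw [mem_intFin, mul_comm, ← div_eq_iff px.ne', div_eq_mul_inv, ← abs_push_sub px.le, ← h1]
  split_ifs with h <;> simp [h]

lemma mem_nearFin_push (hx : x ∈ sphereS n k) (hx' : x ∉ sphereS n (k + 1))
    (hb : b = fun i => outerIdx (x i)) {j : Fin n} :
    j ∈ nearFin (push b x) ↔ j ∈ nearFin x ∧ j ∉ intFin (push b x) := by
  obtain ⟨cx, cx', -, px, lx, ix, nx, ax, -⟩ := push_props hx hx' hb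
  rw [mem_nearFin, mem_nearFin, mem_intFin, ← near_of_outerIdx_eq_zero (t := x j),
    ← congrFun hb j, ← ix j, near_iff, innerIdx_eq]
  obtain ⟨h1, h2, -⟩ := floor_ceil_cases (push b x j)
  split_ifs <;> omega

lemma two_mul_sub_one_iff {t a : ℝ} (ha : 0 < a) :
    (2 * t - 1 = a ↔ |t - ctr 0| = a * wid 0 ∧ 1 / 2 < t) ∧
      (1 - 2 * t = a ↔ |t - ctr 0| = a * wid 0 ∧ ¬ 1 / 2 < t) := by
  rw [abs_sub_half, mul_left_inj' (wid_pos 0).ne']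
  constructor <;> constructor
  · intro h; exact ⟨by rw [h, abs_of_pos ha], by linarith⟩
  · rintro ⟨h, h'⟩; rwa [abs_of_pos (by linarith)] at h
  · intro h; exact ⟨by rw [← abs_neg, neg_sub, h, abs_of_pos ha], by linarith⟩
  · rintro ⟨h, h'⟩; rw [abs_of_nonpos (by linarith)] at h; linarith

lemma sameTorusCell_push_of_isOnlyOuter (hx : x ∈ sphereS n k) (hx' : x ∉ sphereS n (k + 1))
    (h : SameTorusCell x y) (hb : b = fun i => outerIdx (x i)) {i : Fin n}
    (hix : IsOnlyOuter b x i) (hiy : IsOnlyOuter b y i)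
    (hs : b i = 0 → (1 / 2 < x i ↔ 1 / 2 < y i)) :
    SameTorusCell (push b x) (push b y) := by
  have hb' : b = fun i => outerIdx (y i) := hb.trans (funext fun i => h.outerIdx_eq i)
  have hy' := mt h.mem_sphereS.2 hx'
  have hy := h.mem_sphereS.1 hx
  obtain ⟨-, -, -, px, -⟩ := push_props hx hx' hb
  obtain ⟨-, -, -, py, -⟩ := push_props hy hy' hb'
  refine (sameTorusCell_push_iff hx hx' hy hy' hb hb').2 ⟨h, fun j hj => ?_, fun j hj => ?_⟩
  · have h1 := hix j
    have h2 := hiy j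
    rw [hj] at h1 h2
    rw [(two_mul_sub_one_iff px).1, (two_mul_sub_one_iff px).2, (two_mul_sub_one_iff py).1,
      (two_mul_sub_one_iff py).2, h1, h2]
    constructor <;> refine and_congr_right ?_ <;> rintro rfl
    · exact hs hj
    · exact not_congr (hs hj)
  · have h1 := hix j
    have h2 := hiy j
    rw [wid, if_neg hj] at h1 h2
    rw [mul_comm, h1, mul_comm, h2]

end

/-- Points of the `p`-th tile that represent its subdivision: `none` belongs to the tile on the
outer simplicial side, `some (j, s)` to the tile on a side of the cubical factor. -/
noncomputable def repPt (n p : ℕ) (o : Option (Fin (n - p) × Bool)) : Fin n → ℝ := fun i =>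
  match o with
  | none => stdPt n p i
  -- The margin `1 / (8 * p)` gives the scaled distance `1 - 1 / (4 * p)`, above the bound `1 - 1 /
  -- (2 * p)` for the first `p` coordinates, so that coordinate `p + j` alone reaches an outer face.
  | some (j, s) => if (i : ℕ) = p + j then (if s then 1 - 1 / (8 * p) else 1 / (8 * p))
      else stdPt n p i

/-- The index of the coordinate which is projected to an outer face. -/
def repIdx {p : ℕ} (hp : 1 ≤ p) (hpn : p ≤ n) (o : Option (Fin (n - p) × Bool)) : Fin n :=
  match o with
  | none => ⟨p - 1, by omega⟩
  | some (j, _) => ⟨p + j, by omega⟩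

section

variable {p : ℕ}

lemma repPt_mem (hp : 1 ≤ p) (s : Bool) : 0 < (if s then 1 - 1 / (8 * p : ℝ) else 1 / (8 * p)) ∧
    (if s then 1 - 1 / (8 * p : ℝ) else 1 / (8 * p)) < 1 := by
  have hp' : (1 : ℝ) ≤ p := by exact_mod_cast hp
  have h1 : 0 < 1 / (8 * p : ℝ) := by positivity
  have h2 : 1 / (8 * p : ℝ) < 1 := by rw [div_lt_one (by positivity)]; linarith
  split_ifs <;> constructor <;> linarith

lemma same_repPt (hp : 1 ≤ p) (o : Option (Fin (n - p) × Bool)) :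
    SameTorusCell (stdPt n p) (repPt n p o) := by
  rcases o with _ | ⟨j, s⟩
  · exact SameTorusCell.refl _
  have h1 : ∀ i : Fin n, (i : ℕ) ≠ p + j → repPt n p (some (j, s)) i = stdPt n p i := fun i hi =>
    if_neg hi
  refine sameTorusCell_of (fun i => ?_) fun i i' hi hi' => ?_
  · by_cases h : (i : ℕ) = p + j
    · have h2 : 0 < repPt n p (some (j, s)) i ∧ repPt n p (some (j, s)) i < 1 := by
        simp only [repPt, if_pos h]; exact repPt_mem hp s
      have h3 := near_iff.1 (near_stdPt (n := n) (p := p) (i := i) |>.2 (by omega))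
      have h4 := near_iff.1 h2
      omega
    · rw [h1 i h]; exact ⟨rfl, rfl⟩
  · have := far_stdPt.1 hi
    have := far_stdPt.1 hi'
    rw [h1 i (by omega), h1 i' (by omega)]

lemma isOnlyOuter_repPt (hp : 1 ≤ p) (hpn : p ≤ n) (o : Option (Fin (n - p) × Bool)) :
    IsOnlyOuter (stdBox n p) (repPt n p o) (repIdx hp hpn o) := by
  have hp' : (1 : ℝ) ≤ p := by exact_mod_cast hp
  have hstd : ∀ i : Fin n, (i : ℕ) < p → |stdPt n p i - ctr (stdBox n p i)| = 1 + (i : ℝ) / p ∧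
      wid (stdBox n p i) = 2 := fun i hi => by
    rw [stdBox_of_lt hi, ctr_one, sub_zero, stdPt_of_lt hi]
    exact ⟨abs_of_nonneg (by positivity), by simp [wid]⟩
  have hstd' : ∀ i : Fin n, p ≤ (i : ℕ) → |stdPt n p i - ctr (stdBox n p i)| = 0 := fun i hi => by
    rw [stdBox_of_le hi, stdPt_of_le hi]; simp [ctr]
  rcases o with _ | ⟨j, s⟩
  · have hcast : ((p - 1 : ℕ) : ℝ) = p - 1 := by rw [Nat.cast_sub hp]; simp
    have hpos : 0 ≤ ((p : ℝ) - 1) / p := by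
      have : (0 : ℝ) ≤ p - 1 := by linarith
      positivity
    refine isOnlyOuter_of (a := (1 + (p - 1 : ℝ) / p) / 2) (by linarith) ?_ fun i hi => ?_
    · have := hstd (repIdx hp hpn none) (by simp [repIdx]; omega)
      simp only [repPt]
      rw [this.1, this.2]
      simp only [repIdx, hcast]
      ring
    · simp only [repPt]
      by_cases h : (i : ℕ) < p
      · rw [(hstd i h).1, (hstd i h).2]
        have h1 : (i : ℕ) < p - 1 := by
          rcases Nat.lt_or_ge i (p - 1) with h' | h'
          · exact h'
          · exact absurd (Fin.ext (by simp [repIdx]; omega)) hi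
        have h2 : ((i : ℕ) : ℝ) < p - 1 := by rw [← hcast]; exact_mod_cast h1
        have h3 : (i : ℝ) / p < ((p : ℝ) - 1) / p := by gcongr
        linarith
      · rw [hstd' i (not_lt.1 h)]
        have := wid_pos (stdBox n p i)
        have h4 : (0 : ℝ) < (1 + (p - 1 : ℝ) / p) / 2 := by linarith
        positivity
  · have hq : 1 / (4 * p : ℝ) ≤ 1 / 4 := by
      rw [div_le_div_iff₀ (by positivity) (by positivity)]; linarith
    have h8 : 1 / (8 * p : ℝ) = 1 / (4 * p) / 2 := by field_simp; norm_num
    have h4 : 0 < 1 / (4 * p : ℝ) := by positivity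
    refine isOnlyOuter_of (a := 1 - 1 / (4 * p)) (by linarith) ?_ fun i hi => ?_
    · have h1 : ((repIdx hp hpn (some (j, s)) : Fin n) : ℕ) = p + j := rfl
      have h2 : stdBox n p (repIdx hp hpn (some (j, s))) = 0 := stdBox_of_le (by omega)
      simp only [repPt, if_pos h1]
      rw [h2]
      simp only [ctr, wid, if_true]
      rcases s with _ | _
      · simp only [Bool.false_eq_true, if_false]
        rw [abs_of_nonpos (by linarith), h8]; ring
      · simp only [if_true]
        rw [abs_of_nonneg (by linarith), h8]; ring
    · have h1 : (i : ℕ) ≠ p + j := fun h => hi (Fin.ext h)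
      simp only [repPt, if_neg h1]
      by_cases h : (i : ℕ) < p
      · rw [(hstd i h).1, (hstd i h).2]
        have h2 : ((i : ℕ) : ℝ) + 1 ≤ p := by exact_mod_cast h
        have h3 : (i : ℝ) / p ≤ 1 - 1 / p := by
          rw [div_le_iff₀ (by linarith), sub_mul, div_mul_cancel₀ _ (by linarith)]; linarith
        have h5 : 1 / (p : ℝ) = 4 * (1 / (4 * p)) := by field_simp
        linarith
      · rw [hstd' i (not_lt.1 h)]
        have := wid_pos (stdBox n p i)
        exact mul_pos (by linarith) this

lemma half_lt_repPt (hp : 1 ≤ p) (hpn : p ≤ n) (j : Fin (n - p)) (s : Bool) :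
    1 / 2 < repPt n p (some (j, s)) (repIdx hp hpn (some (j, s))) ↔ s = true := by
  have h1 : ((repIdx hp hpn (some (j, s)) : Fin n) : ℕ) = p + j := rfl
  have hp' : (1 : ℝ) ≤ p := by exact_mod_cast hp
  have h2 : 1 / (8 * p : ℝ) ≤ 1 / 8 := by
      rw [div_le_div_iff₀ (by positivity) (by positivity)]; linarith
  simp only [repPt, if_pos h1]
  rcases s with _ | _
  · simp only [Bool.false_eq_true, if_false, iff_false]; linarith
  · simp only [if_true, iff_true]; linarith

end

section

variable {p : ℕ} {y : Fin n → ℝ}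

lemma mem_of_same_stdPt (hp : 1 ≤ p) (hpn : p ≤ n) (h : SameTorusCell (stdPt n p) y) :
    y ∈ sphereS n (p - 1) ∧ y ∉ sphereS n (p - 1 + 1) := by
  have h1 := stdPt_mem_sphereS hp hpn
  have h2 := top_facts (hp.trans hpn) h1 (cellDim_stdPt hp hpn)
  refine ⟨h.mem_sphereS.1 h1, fun h3 => ?_⟩
  have h4 := mem_sphereS.1 (h.mem_sphereS.2 h3)
  omega

lemma strictMono_of_same (hp : 1 ≤ p) (h : SameTorusCell (stdPt n p) y) {i j : Fin n}
    (hij : i < j) (hj : (j : ℕ) < p) :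
    |y i - ctr (stdBox n p i)| < |y j - ctr (stdBox n p j)| := by
  have hi : (i : ℕ) < p := lt_trans hij hj
  have hc : stdPt n p ∈ cube (stdBox n p) := by
    rw [outerIdx_of_same (SameTorusCell.refl (stdPt n p))]; exact mem_cube_outer _
  have hc' : y ∈ cube (stdBox n p) := h.mem_cube.1 hc
  refine (((sameTorusCell_iff_of_cube hc hc').1 h).2.2 i j ?_ ?_).1 ?_
  · rw [stdBox_of_lt hi]; exact one_ne_zero
  · rw [stdBox_of_lt hj]; exact one_ne_zero
  · rw [stdBox_of_lt hi, stdBox_of_lt hj, ctr_one, sub_zero, sub_zero, stdPt_of_lt hi, stdPt_of_lt hj,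
      abs_of_nonneg (by positivity), abs_of_nonneg (by positivity)]
    have : (0 : ℝ) < p := by exact_mod_cast hp
    have : ((i : ℕ) : ℝ) < j := by exact_mod_cast hij
    gcongr

lemma injective_of_same (hp : 1 ≤ p) (h : SameTorusCell (stdPt n p) y) {i j : Fin n}
    (hi : (i : ℕ) < p) (hj : (j : ℕ) < p)
    (heq : |y i - ctr (stdBox n p i)| = |y j - ctr (stdBox n p j)|) : i = j := by
  rcases lt_trichotomy i j with h1 | h1 | h1
  · exact absurd heq (strictMono_of_same hp h h1 hj).ne
  · exact h1
  · exact absurd heq (strictMono_of_same hp h h1 hi).ne'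

lemma intFin_push_eq (hp : 1 ≤ p) (hpn : p ≤ n) (h : SameTorusCell (stdPt n p) y) {i : Fin n}
    (hi : IsOnlyOuter (stdBox n p) y i) : intFin (push (stdBox n p) y) = {i} := by
  obtain ⟨h1, h2⟩ := mem_of_same_stdPt hp hpn h
  ext j
  rw [mem_intFin_push h1 h2 (outerIdx_of_same h), hi j, Finset.mem_singleton]

/-- Within the standard cell the first `p` distances are distinct, and a common factor keeps them
so. With a single integer coordinate the dimension is `n - 1`. -/
lemma cellDim_push (hp : 1 ≤ p) (hpn : p ≤ n) (h : SameTorusCell (stdPt n p) y) {i : Fin n}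
    (hi : IsOnlyOuter (stdBox n p) y i) : cellDim (push (stdBox n p) y) = n - 1 := by
  obtain ⟨h1, h2⟩ := mem_of_same_stdPt hp hpn h
  obtain ⟨cx, cx', -, px, lx, ix, nx, ax, -⟩ := push_props h1 h2 (outerIdx_of_same h)
  rw [cellDim_eq_of_nodup, intFin_push_eq hp hpn h hi, Finset.card_singleton]
  refine Multiset.Nodup.map_on ?_ (farIdx _).nodup
  intro j hj j' hj' heq
  have f1 := mem_farIdx.1 hj
  have f2 := mem_farIdx.1 hj'
  have b1 := isFar_ne_zero (cx' j) f1
  have b2 := isFar_ne_zero (cx' j') f2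
  rw [outward_eq_abs (cx' j) b1 f1, outward_eq_abs (cx' j') b2 f2, sub_left_inj,
    abs_push_sub px.le, abs_push_sub px.le, mul_left_inj' (inv_pos.2 px).ne'] at heq
  exact injective_of_same hp h (not_le.1 (mt stdBox_eq_zero.2 b1))
    (not_le.1 (mt stdBox_eq_zero.2 b2)) heq

lemma nearFin_of_same (h : SameTorusCell (stdPt n p) y) : nearFin y = nearFin (stdPt n p) := by
  ext i
  rw [mem_nearFin, mem_nearFin, h.near_iff]

/-- A near coordinate is lost exactly when the coordinate reaching an outer face was near. This
number determines the type of the new tile. -/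
lemma card_nearFin_push (hp : 1 ≤ p) (hpn : p ≤ n) (h : SameTorusCell (stdPt n p) y) {i : Fin n}
    (hi : IsOnlyOuter (stdBox n p) y i) :
    (nearFin (push (stdBox n p) y)).card = n - p - if p ≤ i then 1 else 0 := by
  classical
  obtain ⟨h1, h2⟩ := mem_of_same_stdPt hp hpn h
  have h3 : nearFin (push (stdBox n p) y) = (nearFin (stdPt n p)).erase i := by
    ext j
    rw [mem_nearFin_push h1 h2 (outerIdx_of_same h), intFin_push_eq hp hpn h hi, nearFin_of_same h,
      Finset.mem_erase, Finset.mem_singleton, and_comm]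
  rw [h3]
  split_ifs with hpi
  · rw [Finset.card_erase_of_mem (mem_nearFin.2 (near_stdPt.2 hpi)), card_nearFin_stdPt hpn]
  · rw [Finset.erase_eq_of_notMem (fun h => hpi (near_stdPt.1 (mem_nearFin.1 h))),
      card_nearFin_stdPt hpn]; rfl

lemma exists_isOnlyOuter (hp : 1 ≤ p) (hpn : p ≤ n) (h : SameTorusCell (stdPt n p) y)
    (hd : cellDim (push (stdBox n p) y) = n - 1) : ∃ i, IsOnlyOuter (stdBox n p) y i := by
  obtain ⟨h1, h2⟩ := mem_of_same_stdPt hp hpn h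
  have hmem : push (stdBox n p) y ∈ sphereS n (p - 1 + 1) := by
    rw [outerIdx_of_same h]; exact (push_facts h1 h2).1
  obtain ⟨i, hi⟩ := Finset.card_eq_one.1 (top_facts (hp.trans hpn) hmem hd).2.2.1
  refine ⟨i, fun j => ?_⟩
  rw [← mem_intFin_push h1 h2 (outerIdx_of_same h), hi, Finset.mem_singleton]

/-- Every tile of the subdivision is represented. -/
lemma exists_repPt (hp : 1 ≤ p) (hpn : p ≤ n) (h : SameTorusCell (stdPt n p) y)
    (hd : cellDim (push (stdBox n p) y) = n - 1) :
    ∃ o, SameTorusCell (push (stdBox n p) (repPt n p o)) (push (stdBox n p) y) := by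
  obtain ⟨i, hi⟩ := exists_isOnlyOuter hp hpn h hd
  have key : ∀ o, repIdx hp hpn o = i →
      (p ≤ i → (1 / 2 < repPt n p o i ↔ 1 / 2 < y i)) →
      SameTorusCell (push (stdBox n p) (repPt n p o)) (push (stdBox n p) y) := by
    rintro o rfl hs
    have ho := same_repPt (n := n) hp o
    obtain ⟨h1, h2⟩ := mem_of_same_stdPt hp hpn ho
    exact sameTorusCell_push_of_isOnlyOuter h1 h2 (ho.symm.trans h) (outerIdx_of_same ho)
      (isOnlyOuter_repPt hp hpn o) hi fun h0 => hs (stdBox_eq_zero.1 h0)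
  by_cases hpi : p ≤ i
  · have hidx : repIdx hp hpn (some (⟨i - p, by omega⟩, decide (1 / 2 < y i))) = i :=
      Fin.ext (by simp [repIdx]; omega)
    refine ⟨some (⟨i - p, by omega⟩, decide (1 / 2 < y i)), key _ hidx fun _ => ?_⟩
    have := half_lt_repPt hp hpn ⟨i - p, by omega⟩ (decide (1 / 2 < y i))
    rw [hidx] at this
    rw [this, decide_eq_true_iff]
  -- If the coordinate that reaches an outer face is among the first `p`, it must be the last of
  -- them, since their distances increase strictly.
  · refine ⟨none, key _ ?_ fun h => absurd h hpi⟩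
    by_contra hne
    have hlt : i < repIdx hp hpn none := by
      refine lt_of_le_of_ne (Fin.le_def.2 ?_) (Ne.symm hne)
      simp only [repIdx]; omega
    have hlt' : ((repIdx hp hpn none : Fin n) : ℕ) < p := by simp only [repIdx]; omega
    have h1 := strictMono_of_same hp h hlt hlt'
    have h2 := abs_sub_le_boxNorm (stdBox n p) y (repIdx hp hpn none)
    have h3 := (hi i).2 rfl
    rw [stdBox_of_lt hlt'] at h1 h2
    rw [stdBox_of_lt (not_le.1 hpi)] at h1 h3
    linarith

/-- The unique integer coordinate of the image reveals the index, and its value 0 or 1 reveals the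
side. -/
lemma repPt_injective (hp : 1 ≤ p) (hpn : p ≤ n) {o o' : Option (Fin (n - p) × Bool)}
    (h : SameTorusCell (push (stdBox n p) (repPt n p o)) (push (stdBox n p) (repPt n p o'))) :
    o = o' := by
  have ho := same_repPt (n := n) hp o
  have ho' := same_repPt (n := n) hp o'
  have hidx : repIdx hp hpn o = repIdx hp hpn o' := by
    have h1 := intFin_push_eq hp hpn ho (isOnlyOuter_repPt hp hpn o)
    have h2 := intFin_push_eq hp hpn ho' (isOnlyOuter_repPt hp hpn o')
    have h3 : intFin (push (stdBox n p) (repPt n p o)) =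
        intFin (push (stdBox n p) (repPt n p o')) := by
      ext i; rw [mem_intFin, mem_intFin, (h.1 i).1, (h.1 i).2]
    rw [h1, h2] at h3
    exact Finset.singleton_injective h3
  obtain ⟨h1, h2⟩ := mem_of_same_stdPt hp hpn ho
  obtain ⟨h1', h2'⟩ := mem_of_same_stdPt hp hpn ho'
  obtain ⟨-, -, -, px, -⟩ := push_props h1 h2 (outerIdx_of_same ho)
  obtain ⟨-, -, -, py, -⟩ := push_props h1' h2' (outerIdx_of_same ho')
  rcases o with _ | ⟨j, s⟩ <;> rcases o' with _ | ⟨j', s'⟩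
  · rfl
  · have := Fin.ext_iff.1 hidx
    simp only [repIdx] at this; omega
  · have := Fin.ext_iff.1 hidx
    simp only [repIdx] at this; omega
  · have hj : j = j' := by
      have := Fin.ext_iff.1 hidx
      simp only [repIdx] at this; exact Fin.ext (by omega)
    subst hj
    have h3 := ((sameTorusCell_push_iff h1 h2 h1' h2' (outerIdx_of_same ho)
      (outerIdx_of_same ho')).1 h).2.1 (repIdx hp hpn (some (j, s))) (stdBox_of_le (by
        simp only [repIdx]; omega))
    have h4 := (isOnlyOuter_repPt hp hpn (some (j, s)) (repIdx hp hpn (some (j, s)))).2 rfl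
    have h5 := (isOnlyOuter_repPt hp hpn (some (j, s')) (repIdx hp hpn (some (j, s')))).2 rfl
    rw [stdBox_of_le (show p ≤ (repIdx hp hpn (some (j, s)) : ℕ) by simp only [repIdx]; omega)] at h4
    rw [stdBox_of_le (show p ≤ (repIdx hp hpn (some (j, s')) : ℕ) by simp only [repIdx]; omega)] at h5
    rw [(two_mul_sub_one_iff px).1, (two_mul_sub_one_iff py).1] at h3
    have h6 := half_lt_repPt hp hpn j s
    have h7 := half_lt_repPt hp hpn j s'
    have h8 : (s = true) ↔ (s' = true) := by
      rw [← h6, ← h7]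
      exact ⟨fun h => (h3.1.1 ⟨h4, h⟩).2, fun h => (h3.1.2 ⟨h5, h⟩).2⟩
    have : s = s' := by
      rcases s with _ | _ <;> rcases s' with _ | _ <;> simp at h8 ⊢
    rw [this]

end

end TorusFSR

/-! ### Counting the tiles in a subdivided tile -/

namespace TorusFSR

variable {n : ℕ}

lemma stageEquiv_of_same {p : ℕ} (hp : 1 ≤ p) (hpn : p ≤ n) {y : sphereS n (p - 1)}
    (h : SameTorusCell (stdPt n p) y.1) : (stageEquiv n (p - 1) y).1 = push (stdBox n p) y.1 := by
  rw [stageEquiv_of_notMem (mem_of_same_stdPt hp hpn h).2, outerIdx_of_same h]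

/-- The representative as a point of a sphere. -/
noncomputable def repSph (p : Icc 1 n) (o : Option (Fin (n - p) × Bool)) : sphereS n (p - 1) :=
  ⟨repPt n p o, (mem_of_same_stdPt p.2.1 p.2.2 (same_repPt p.2.1 o)).1⟩

lemma stage_repSph (p : Icc 1 n) (o : Option (Fin (n - p) × Bool)) :
    (stage n (p - 1) (repSph p o)).1 = push (stdBox n p) (repPt n p o) :=
  stageEquiv_of_same p.2.1 p.2.2 (same_repPt p.2.1 o)

lemma cellDim_stage_repSph (p : Icc 1 n) (o : Option (Fin (n - p) × Bool)) :
    cellDim (stage n (p - 1) (repSph p o)).1 = n - 1 := by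
  rw [stage_repSph]
  exact cellDim_push p.2.1 p.2.2 (same_repPt p.2.1 o) (isOnlyOuter_repPt p.2.1 p.2.2 o)

lemma exists_openCell_subCW (s : TypeSpace n) {m : ℕ} (hm : subDim s = m) :
    ∃ c : Cell (subCW n) m, openCell (subCW n) m c = classIn univ (subRel n) s := by
  subst hm
  exact ⟨(hasCharMaps_sub n).cellOf subDim_congr (finite_sub_classes n) (mem_univ s),
    (hasCharMaps_sub n).openCell_cellOf _ _ _⟩

/-- The tiles of the subdivision of the `p`-th tile. -/
noncomputable def repCell (p : Icc 1 n) (o : Option (Fin (n - p) × Bool)) : Cell (subCW n) (n - 1) :=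
  Classical.choose (exists_openCell_subCW (toType n (p - 1) (repSph p o)) (m := n - 1)
    ((subDim_toType _).trans (cellDim_stage_repSph p o)))

lemma openCell_repCell (p : Icc 1 n) (o : Option (Fin (n - p) × Bool)) :
    openCell (subCW n) (n - 1) (repCell p o) =
      classIn univ (subRel n) (toType n (p - 1) (repSph p o)) :=
  Classical.choose_spec (exists_openCell_subCW (toType n (p - 1) (repSph p o)) (m := n - 1)
    ((subDim_toType _).trans (cellDim_stage_repSph p o)))

lemma typeRel_repSph (p : Icc 1 n) (o : Option (Fin (n - p) × Bool)) :
    typeRel n (stdType n p) (toType n (p - 1) (repSph p o)) :=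
  (same_repPt p.2.1 o).sameType _

lemma openCell_repCell_subset (hn : 1 ≤ n) (p : Icc 1 n) (o : Option (Fin (n - p) × Bool)) :
    openCell (subCW n) (n - 1) (repCell p o) ⊆
      openCell (typeCW hn) (n - 1) (tileEquiv hn p) := by
  rw [openCell_repCell, openCell_tileEquiv]
  exact fun s hs => ⟨mem_univ _, (typeRel n).trans (typeRel_repSph p o) hs.2.1⟩

lemma repCell_injective (p : Icc 1 n) : Function.Injective (repCell p) := by
  intro o o' h
  have h1 : toType n (p - 1) (repSph p o') ∈ classIn univ (subRel n)
      (toType n (p - 1) (repSph p o)) := by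
    rw [← openCell_repCell, h, openCell_repCell]
    exact mem_classIn_self (mem_univ _)
  have h2 : SameTorusCell (repSph p o).1 (repSph p o').1 :=
    (same_repPt p.2.1 o).symm.trans (same_repPt p.2.1 o')
  have h3 := (subRel_toType_iff h2).1 h1.2
  rw [stage_repSph, stage_repSph] at h3
  exact repPt_injective p.2.1 p.2.2 h3

lemma exists_repCell_eq (hn : 1 ≤ n) (p : Icc 1 n) {c : Cell (subCW n) (n - 1)}
    (hc : openCell (subCW n) (n - 1) c ⊆ openCell (typeCW hn) (n - 1) (tileEquiv hn p)) :
    ∃ o, repCell p o = c := by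
  obtain ⟨s, -, hs, hcs⟩ := (hasCharMaps_sub n).exists_of_cell _ _ _ c
  replace hcs : openCell (subCW n) (n - 1) c = classIn univ (subRel n) s := hcs
  have h1 : s ∈ openCell (typeCW hn) (n - 1) (tileEquiv hn p) := hc (by
    rw [hcs]; exact mem_classIn_self (mem_univ _))
  rw [openCell_tileEquiv] at h1
  obtain ⟨y, hy, rfl⟩ := exists_lift _ h1.2
  rw [subDim_toType, coe_stage, stageEquiv_of_same p.2.1 p.2.2 hy] at hs
  obtain ⟨o, ho⟩ := exists_repPt p.2.1 p.2.2 hy hs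
  refine ⟨o, cell_eq_of_openCell_eq _ ?_⟩
  have h2 : SameTorusCell (repSph p o).1 y.1 := (same_repPt p.2.1 o).symm.trans hy
  rw [openCell_repCell, hcs]
  refine classIn_eq ((subRel_toType_iff h2).2 ?_)
  rw [stage_repSph, coe_stage, stageEquiv_of_same p.2.1 p.2.2 hy]
  exact ho

lemma image_repCell_iff (hn : 1 ≤ n) (p p' : Icc 1 n) (o : Option (Fin (n - p) × Bool)) :
    subFun '' openCell (subCW n) (n - 1) (repCell p o) =
      openCell (typeCW hn) (n - 1) (tileEquiv hn p') ↔
        (p' : ℕ) = p + if o.isSome then 1 else 0 := by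
  have hp := p.2
  have hp' := p'.2
  have h1 : (nearFin (stage n (p - 1) (repSph p o)).1).card + (p + if o.isSome then 1 else 0) = n := by
    rw [stage_repSph, card_nearFin_push hp.1 hp.2 (same_repPt hp.1 o)
      (isOnlyOuter_repPt hp.1 hp.2 o)]
    rcases o with _ | ⟨j, s⟩
    · have h1 := hp.1
      have h2 := hp.2
      have h3 : ¬ (p : ℕ) ≤ p - 1 := by omega
      simp [repIdx, h3]; omega
    · have := j.2
      simp [repIdx]; omega
  have h2 := typeRel_stdType_iff hn (p := p') (cellDim_stage_repSph p o)
  rw [openCell_repCell, (bijOn_subFun _).image_eq, openCell_tileEquiv, subFun_toType]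
  have h3 : (classIn univ (typeRel n) (toType n (p - 1 + 1) (stage n (p - 1) (repSph p o))) =
      classIn univ (typeRel n) (stdType n p')) ↔
      typeRel n (stdType n p') (toType n (p - 1 + 1) (stage n (p - 1) (repSph p o))) := by
    constructor
    · intro h
      have := mem_classIn_self (C := univ) (r := typeRel n)
        (mem_univ (toType n (p - 1 + 1) (stage n (p - 1) (repSph p o))))
      rw [h] at this
      exact this.2
    · exact fun h => (classIn_eq h).symm
  rw [h3, h2]
  omega

/-- The tiles of the subdivision are indexed by `Option (Fin (n - p) × Bool)`: `none` has type `p`,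
and each of the `2 * (n - p)` other values has type `p + 1`. -/
lemma card_subtiles (hn : 1 ≤ n) (p p' : Icc 1 n) :
    Nat.card {c : Cell (subCW n) (n - 1) //
      openCell (subCW n) (n - 1) c ⊆ openCell (typeCW hn) (n - 1) (tileEquiv hn p) ∧
      subFun '' openCell (subCW n) (n - 1) c =
        openCell (typeCW hn) (n - 1) (tileEquiv hn p')} =
    if (p' : ℕ) = p then 1 else if (p' : ℕ) = p + 1 then 2 * (n - p) else 0 := by
  have e : {o : Option (Fin (n - p) × Bool) // (p' : ℕ) = p + if o.isSome then 1 else 0} ≃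
      {c : Cell (subCW n) (n - 1) //
      openCell (subCW n) (n - 1) c ⊆ openCell (typeCW hn) (n - 1) (tileEquiv hn p) ∧
      subFun '' openCell (subCW n) (n - 1) c =
        openCell (typeCW hn) (n - 1) (tileEquiv hn p')} :=
    Equiv.ofBijective (fun o => ⟨repCell p o.1, openCell_repCell_subset hn p o.1,
      (image_repCell_iff hn p p' o.1).2 o.2⟩) ⟨fun o o' h => Subtype.ext (repCell_injective p
        (congrArg Subtype.val h)), fun c => by
        obtain ⟨o, ho⟩ := exists_repCell_eq hn p c.2.1
        exact ⟨⟨o, (image_repCell_iff hn p p' o).1 (ho ▸ c.2.2)⟩, Subtype.ext ho⟩⟩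
  rw [← Nat.card_congr e]
  split_ifs with h1 h2
  · rw [Nat.card_eq_one_iff_exists]
    refine ⟨⟨none, by simpa using h1⟩, ?_⟩
    rintro ⟨_ | o, ho⟩
    · rfl
    · simp at ho; omega
  · have e' : Fin (n - p) × Bool ≃
        {o : Option (Fin (n - p) × Bool) // (p' : ℕ) = p + if o.isSome then 1 else 0} :=
      Equiv.ofBijective (fun a => ⟨some a, by simpa using h2⟩)
        ⟨fun a a' h => by simpa using h, by
          rintro ⟨_ | a, ha⟩
          · simp at ha; omega
          · exact ⟨a, rfl⟩⟩
    rw [← Nat.card_congr e']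
    simp [mul_comm]
  · have : IsEmpty {o : Option (Fin (n - p) × Bool) // (p' : ℕ) = p + if o.isSome then 1 else 0} := by
      refine ⟨?_⟩
      rintro ⟨_ | a, ha⟩
      · simp at ha; omega
      · simp at ha; omega
    exact Nat.card_of_isEmpty

end TorusFSR

namespace TorusFSR

variable {n : ℕ}

/-! ### Closed tiles -/

/-- The closed tile of the standard point. -/
def closedTile (n p : ℕ) : Set (Fin n → ℝ) :=
  {y | y ∈ cube (stdBox n p) ∧ (∀ i : Fin n, (i : ℕ) = 0 → y i = 1) ∧
    ∀ i j : Fin n, i ≤ j → (j : ℕ) < p → y i ≤ y j}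

section

variable {p : ℕ} {y z : Fin n → ℝ}

lemma mem_cube_stdBox_of_lt (h : y ∈ cube (stdBox n p)) {i : Fin n} (hi : (i : ℕ) < p) :
    1 ≤ y i ∧ y i ≤ 2 ∧ |y i - ctr (stdBox n p i)| = y i := by
  have := h i
  rw [stdBox_of_lt hi] at this ⊢
  rw [ctr_one, sub_zero]
  push_cast at this
  exact ⟨this.1, by linarith [this.2], abs_of_nonneg (by linarith [this.1])⟩

lemma mem_cube_stdBox_of_le (h : y ∈ cube (stdBox n p)) {i : Fin n} (hi : p ≤ i) :
    0 ≤ y i ∧ y i ≤ 1 := by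
  have := h i
  rw [stdBox_of_le hi] at this
  simpa using this

lemma sameTorusCell_iff_of_stdBox (hy : y ∈ cube (stdBox n p)) (hz : z ∈ cube (stdBox n p)) :
    SameTorusCell y z ↔
      (∀ i : Fin n, p ≤ i → (y i = 0 ↔ z i = 0) ∧ (y i = 1 ↔ z i = 1)) ∧
      (∀ i : Fin n, (i : ℕ) < p → (y i = 1 ↔ z i = 1) ∧ (y i = 2 ↔ z i = 2)) ∧
      ∀ i j : Fin n, (i : ℕ) < p → (j : ℕ) < p → (y i < y j ↔ z i < z j) := by
  rw [sameTorusCell_iff_of_cube hy hz]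
  have h0 : ∀ i : Fin n, stdBox n p i ≠ 0 ↔ (i : ℕ) < p := fun i => by
    rw [Ne, stdBox_eq_zero, not_le]
  simp only [h0, stdBox_eq_zero]
  refine and_congr Iff.rfl (and_congr ?_ ?_)
  · refine forall_congr' fun i => imp_congr_right fun hi => ?_
    rw [(mem_cube_stdBox_of_lt hy hi).2.2, (mem_cube_stdBox_of_lt hz hi).2.2]
  · refine forall_congr' fun i => forall_congr' fun j => imp_congr_right fun hi =>
      imp_congr_right fun hj => ?_
    rw [(mem_cube_stdBox_of_lt hy hi).2.2, (mem_cube_stdBox_of_lt hz hi).2.2,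
      (mem_cube_stdBox_of_lt hy hj).2.2, (mem_cube_stdBox_of_lt hz hj).2.2]

lemma isClosed_closedTile (n p : ℕ) : IsClosed (closedTile n p) := by
  have : closedTile n p = cube (stdBox n p) ∩ ((⋂ i : Fin n, ⋂ _ : (i : ℕ) = 0, {y | y i = 1}) ∩
      ⋂ i : Fin n, ⋂ j : Fin n, ⋂ _ : i ≤ j, ⋂ _ : (j : ℕ) < p, {y | y i ≤ y j}) := by
    ext y; simp [closedTile]; tauto
  rw [this]
  refine (isClosed_cube _).inter (IsClosed.inter ?_ ?_)
  · exact isClosed_iInter fun i => isClosed_iInter fun _ => isClosed_eq (by fun_prop) (by fun_prop)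
  · exact isClosed_iInter fun i => isClosed_iInter fun j => isClosed_iInter fun _ =>
      isClosed_iInter fun _ => isClosed_le (by fun_prop) (by fun_prop)

lemma isCompact_closedTile (n p : ℕ) : IsCompact (closedTile n p) :=
  (isCompact_cube (stdBox n p)).of_isClosed_subset (isClosed_closedTile n p) fun _ h => h.1

lemma stdPt_strictMono (hp : 1 ≤ p) {i j : Fin n} (hij : i < j) (hj : (j : ℕ) < p) :
    stdPt n p i < stdPt n p j := by
  rw [stdPt_of_lt (lt_trans hij hj), stdPt_of_lt hj]
  have : (0 : ℝ) < p := by exact_mod_cast hp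
  have : ((i : ℕ) : ℝ) < j := by exact_mod_cast hij
  gcongr

lemma stdPt_zero (hp : 1 ≤ p) {i : Fin n} (h : (i : ℕ) = 0) : stdPt n p i = 1 := by
  rw [stdPt_of_lt (by omega), h]; simp

lemma stdPt_mem_closedTile (hp : 1 ≤ p) : stdPt n p ∈ closedTile n p := by
  refine ⟨?_, fun i hi => stdPt_zero hp hi, fun i j hij hj => ?_⟩
  · rw [outerIdx_of_same (SameTorusCell.refl (stdPt n p))]; exact mem_cube_outer _
  · rcases hij.eq_or_lt with rfl | h
    · exact le_rfl
    · exact (stdPt_strictMono hp h hj).le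

lemma mem_closedTile_of_same (hy : y ∈ closedTile n p) (h : SameTorusCell y z) :
    z ∈ closedTile n p := by
  have hc := h.mem_cube.1 hy.1
  refine ⟨hc, fun i hi => ?_, fun i j hij hj => ?_⟩
  · rw [← hy.2.1 i hi]
    exact (h.eq_of_int (by rw [hy.2.1 i hi]; simp)).symm
  · have := ((sameTorusCell_iff_of_stdBox hy.1 hc).1 h).2.2 j i hj (lt_of_le_of_lt hij hj)
    exact not_lt.1 fun h' => absurd (this.2 h') (not_lt.2 (hy.2.2 i j hij hj))

-- On the segment from a point of the closed tile towards the standard point, every defining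
-- inequality becomes strict at once, while the equation `y₀ = 1` persists.
open Filter in
lemma closure_torusCell_stdPt (hp : 1 ≤ p) : closure (torusCell (stdPt n p)) = closedTile n p := by
  have hs := stdPt_mem_closedTile (n := n) hp
  refine subset_antisymm (closure_minimal (fun z hz => mem_closedTile_of_same hs hz)
    (isClosed_closedTile n p)) fun y hy => ?_
  let w : ℝ → Fin n → ℝ := fun t i => (1 - t) * y i + t * stdPt n p i
  have hw : Tendsto w (𝓝[>] 0) (𝓝 y) := by
    have : Continuous w := by fun_prop
    have h := this.tendsto 0
    have h0 : w 0 = y := by funext i; simp [w]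
    rw [h0] at h
    exact h.mono_left nhdsWithin_le_nhds
  refine mem_closure_of_tendsto hw ?_
  filter_upwards [Ioo_mem_nhdsGT (zero_lt_one (α := ℝ))] with t ht
  have ht1 : 0 < 1 - t := by linarith [ht.2]
  have hcube : w t ∈ cube (stdBox n p) := fun i => by
    have h1 := hy.1 i
    have h2 := hs.1 i
    simp only [w]
    constructor <;> nlinarith [ht.1, mul_le_mul_of_nonneg_left h1.1 ht1.le,
      mul_le_mul_of_nonneg_left h1.2 ht1.le, mul_le_mul_of_nonneg_left h2.1 ht.1.le,
      mul_le_mul_of_nonneg_left h2.2 ht.1.le]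
  have hmono : ∀ i j : Fin n, i < j → (j : ℕ) < p → w t i < w t j := fun i j hij hj => by
    have h1 := mul_le_mul_of_nonneg_left (hy.2.2 i j hij.le hj) ht1.le
    have h2 := mul_lt_mul_of_pos_left (stdPt_strictMono hp hij hj) ht.1
    simp only [w]; linarith
  refine (sameTorusCell_iff_of_stdBox hs.1 hcube).2 ⟨fun i hi => ?_, fun i hi => ?_,
    fun i j hi hj => ?_⟩
  · have h1 := mem_cube_stdBox_of_le hy.1 hi
    have h2 := stdPt_of_le hi
    have h3 : 0 < w t i ∧ w t i < 1 := by
      simp only [w, h2]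
      constructor <;> nlinarith [ht.1, mul_nonneg ht1.le h1.1, mul_le_mul_of_nonneg_left h1.2 ht1.le]
    rw [h2]
    exact ⟨iff_of_false (by norm_num) h3.1.ne', iff_of_false (by norm_num) h3.2.ne⟩
  · have h1 := mem_cube_stdBox_of_lt hy.1 hi
    by_cases h0 : (i : ℕ) = 0
    · have : w t i = 1 := by simp only [w, hy.2.1 i h0, stdPt_zero hp h0]; ring
      rw [this, stdPt_zero hp h0]; simp
    · have h2 := stdPt_mem hi (Nat.pos_of_ne_zero h0)
      push_cast at h2
      have h3 : 1 < w t i ∧ w t i < 2 := by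
        have h4 := mul_lt_mul_of_pos_left h2.1 ht.1
        have h5 := mul_lt_mul_of_pos_left h2.2 ht.1
        have h6 := mul_le_mul_of_nonneg_left h1.1 ht1.le
        have h7 := mul_le_mul_of_nonneg_left h1.2.1 ht1.le
        simp only [w]
        constructor <;> linarith
      exact ⟨iff_of_false h2.1.ne' h3.1.ne', iff_of_false (by linarith [h2.2]) h3.2.ne⟩
  · rcases lt_trichotomy i j with h | h | h
    · exact iff_of_true (stdPt_strictMono hp h hj) (hmono i j h hj)
    · rw [h]; simp
    · exact iff_of_false (stdPt_strictMono hp h hi).not_gt (hmono j i h hi).not_gt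

/-- The first `p` coordinates, followed by `2`. -/
noncomputable def extend (p : ℕ) (y : Fin n → ℝ) (i : ℕ) : ℝ :=
  if h : i < p ∧ i < n then y ⟨i, h.2⟩ else 2

lemma extend_of_lt (hpn : p ≤ n) {i : ℕ} (h : i < p) : extend p y i = y ⟨i, h.trans_le hpn⟩ :=
  dif_pos ⟨h, h.trans_le hpn⟩

lemma extend_coe {i : Fin n} (h : (i : ℕ) < p) : extend p y i = y i := dif_pos ⟨h, i.2⟩

lemma extend_self : extend p y p = 2 := dif_neg (by simp)

lemma continuous_extend (p i : ℕ) : Continuous fun y : Fin n → ℝ => extend p y i := by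
  unfold extend; split_ifs <;> fun_prop

lemma extend_zero (hp : 1 ≤ p) (hpn : p ≤ n) (hy : y ∈ closedTile n p) : extend p y 0 = 1 := by
  rw [extend_of_lt hpn hp]; exact hy.2.1 _ rfl

lemma extend_le_succ (hpn : p ≤ n) (hy : y ∈ closedTile n p) {i : ℕ} (hi : i < p) :
    extend p y i ≤ extend p y (i + 1) := by
  rcases Nat.lt_or_ge (i + 1) p with h | h
  · rw [extend_of_lt hpn hi, extend_of_lt hpn h]
    exact hy.2.2 _ _ (Fin.mk_le_mk.2 (Nat.le_succ i)) h
  · have : i + 1 = p := by omega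
    rw [this, extend_self, extend_of_lt hpn hi]
    exact (mem_cube_stdBox_of_lt hy.1 (i := ⟨i, hi.trans_le hpn⟩) hi).2.1

lemma extend_mono (hpn : p ≤ n) (hy : y ∈ closedTile n p) (i m : ℕ) (h : i + m ≤ p) :
    extend p y i ≤ extend p y (i + m) := by
  induction m with
  | zero => exact le_rfl
  | succ m ih => exact (ih (by omega)).trans (extend_le_succ hpn hy (by omega))

/-- The coordinates on a closed tile as a product of a simplex and a cube. -/
noncomputable def tileCoord (hpn : p ≤ n) (y : Fin n → ℝ) : (Fin p → ℝ) × (Fin (n - p) → ℝ) :=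
  (fun j => extend p y (j + 1) - extend p y j, fun j => y ⟨p + j, by omega⟩)

lemma continuous_tileCoord (hpn : p ≤ n) : Continuous (tileCoord hpn) := by
  refine Continuous.prodMk (continuous_pi fun j => ?_) (by fun_prop)
  exact (continuous_extend p _).sub (continuous_extend p _)

lemma tileCoord_mem (hp : 1 ≤ p) (hpn : p ≤ n) (hy : y ∈ closedTile n p) :
    tileCoord hpn y ∈ simplexCube p (n - p) := by
  refine ⟨⟨fun j => sub_nonneg.2 (extend_le_succ hpn hy j.2), ?_⟩, fun j => ?_, fun j => ?_⟩
  · simp only [tileCoord]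
    rw [Fin.sum_univ_eq_sum_range (fun j => extend p y (j + 1) - extend p y j) p,
      Finset.sum_range_sub, extend_self, extend_zero hp hpn hy]
    norm_num
  · exact (mem_cube_stdBox_of_le hy.1 (i := ⟨p + j, by omega⟩) (by simp)).1
  · exact (mem_cube_stdBox_of_le hy.1 (i := ⟨p + j, by omega⟩) (by simp)).2

lemma tileCoord_injOn (hp : 1 ≤ p) (hpn : p ≤ n) : InjOn (tileCoord hpn) (closedTile n p) := by
  intro y hy z hz h
  have h1 : ∀ i, i ≤ p → extend p y i = extend p z i := by
    intro i hi
    induction i with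
    | zero => rw [extend_zero hp hpn hy, extend_zero hp hpn hz]
    | succ i ih =>
      have h2 := congrFun (congrArg Prod.fst h) ⟨i, hi⟩
      have h3 := ih (by omega)
      simp only [tileCoord] at h2
      linarith
  funext i
  by_cases hi : (i : ℕ) < p
  · rw [← extend_coe (y := y) hi, h1 i hi.le, extend_coe hi]
  · have h2 := congrFun (congrArg Prod.snd h) ⟨i - p, by omega⟩
    simp only [tileCoord] at h2
    have h3 : (⟨p + (i - p), by omega⟩ : Fin n) = i := Fin.ext (by simp; omega)
    rwa [h3] at h2

/-- The inverse of taking successive differences: the first `p` coordinates are 1 plus partial sums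
of the barycentric coordinates, whose total 1 accounts for the final value 2. -/
lemma exists_tileCoord_eq (hp : 1 ≤ p) (hpn : p ≤ n) {w : (Fin p → ℝ) × (Fin (n - p) → ℝ)}
    (hw : w ∈ simplexCube p (n - p)) : ∃ y ∈ closedTile n p, tileCoord hpn y = w := by
  obtain ⟨⟨hw1, hw2⟩, hw3, hw4⟩ := hw
  let v : ℕ → ℝ := fun j => if h : j < p then w.1 ⟨j, h⟩ else 0
  have hv : ∀ j, 0 ≤ v j := fun j => by
    simp only [v]; split_ifs
    · exact hw1 _
    · exact le_rfl
  have hsum : ∑ j ∈ Finset.range p, v j = 1 := by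
    rw [← hw2, ← Fin.sum_univ_eq_sum_range]
    exact Finset.sum_congr rfl fun j _ => dif_pos j.2
  have hmono : ∀ i j : ℕ, i ≤ j → ∑ l ∈ Finset.range i, v l ≤ ∑ l ∈ Finset.range j, v l :=
    fun i j hij => Finset.sum_le_sum_of_subset_of_nonneg (Finset.range_mono hij) fun l _ _ => hv l
  let y : Fin n → ℝ := fun i => if (i : ℕ) < p then 1 + ∑ l ∈ Finset.range i, v l else
    if h : (i : ℕ) - p < n - p then w.2 ⟨i - p, h⟩ else 0
  have hy1 : ∀ i : Fin n, (i : ℕ) < p → y i = 1 + ∑ l ∈ Finset.range i, v l := fun i hi => if_pos hi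
  have hy2 : ∀ (i : Fin n) (hi : p ≤ (i : ℕ)), y i = w.2 ⟨i - p, by omega⟩ := fun i hi => by
    simp only [y, if_neg (not_lt.2 hi)]
    exact dif_pos (by omega)
  refine ⟨y, ⟨fun i => ?_, fun i hi => ?_, fun i j hij hj => ?_⟩, Prod.ext ?_ ?_⟩
  · by_cases hi : (i : ℕ) < p
    · rw [stdBox_of_lt hi, hy1 i hi]
      have h1 := hmono 0 i (Nat.zero_le _)
      have h2 := hmono i p hi.le
      rw [hsum] at h2
      simp only [Finset.range_zero, Finset.sum_empty] at h1
      push_cast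
      constructor <;> linarith
    · rw [stdBox_of_le (not_lt.1 hi), hy2 i (not_lt.1 hi)]
      have h1 := hw3 ⟨i - p, by omega⟩
      have h2 := hw4 ⟨i - p, by omega⟩
      simp only [Pi.zero_apply, Pi.one_apply] at h1 h2
      push_cast
      constructor <;> linarith
  · rw [hy1 i (by omega), hi]; simp
  · rw [hy1 i (lt_of_le_of_lt hij hj), hy1 j hj]
    linarith [hmono i j hij]
  · funext j
    have h1 : extend p y j = 1 + ∑ l ∈ Finset.range j, v l := by
      rw [extend_of_lt hpn j.2]; exact hy1 _ j.2
    have h2 : extend p y (j + 1) = 1 + ∑ l ∈ Finset.range (j + 1), v l := by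
      rcases Nat.lt_or_ge (j + 1) p with h | h
      · rw [extend_of_lt hpn h]; exact hy1 _ h
      · have : (j : ℕ) + 1 = p := by omega
        rw [this, extend_self, hsum]; norm_num
    simp only [tileCoord]
    rw [h1, h2, Finset.sum_range_succ]
    have : v j = w.1 j := dif_pos j.2
    rw [this]; ring
  · funext j
    simp only [tileCoord]
    rw [hy2 ⟨p + j, by omega⟩ (Nat.le_add_right _ _)]
    exact congrArg w.2 (Fin.ext (Nat.add_sub_cancel_left p j))

/-- A closed tile is homeomorphic to a product of a simplex and a cube. -/
noncomputable def tileHomeo (hp : 1 ≤ p) (hpn : p ≤ n) : closedTile n p ≃ₜ simplexCube p (n - p) :=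
  haveI : CompactSpace (closedTile n p) := isCompact_iff_compactSpace.1 (isCompact_closedTile n p)
  Continuous.homeoOfEquivCompactToT2
    (f := Equiv.ofBijective (fun y => ⟨tileCoord hpn y.1, tileCoord_mem hp hpn y.2⟩)
      ⟨fun y z h => Subtype.ext (tileCoord_injOn hp hpn y.2 z.2 (congrArg Subtype.val h)),
        fun w => by
          obtain ⟨y, hy, hyw⟩ := exists_tileCoord_eq hp hpn w.2
          exact ⟨⟨y, hy⟩, Subtype.ext hyw⟩⟩)
    (((continuous_tileCoord hpn).comp continuous_subtype_val).subtype_mk _)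

/-- A barycentric coordinate vanishes exactly when two neighbours in the chain `1 = y₀ ≤ … ≤ y_{p-1}
≤ 2` coincide; these coincidences determine the order pattern and which coordinates equal 1 or 2. -/
lemma sameTorusCell_iff_sameOpenFace (hp : 1 ≤ p) (hpn : p ≤ n) (hy : y ∈ closedTile n p)
    (hz : z ∈ closedTile n p) :
    SameTorusCell y z ↔ SameOpenFace (tileCoord hpn y) (tileCoord hpn z) := by
  rw [sameTorusCell_iff_of_stdBox hy.1 hz.1]
  have hsnd : (∀ i : Fin n, p ≤ i → (y i = 0 ↔ z i = 0) ∧ (y i = 1 ↔ z i = 1)) ↔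
      ∀ j : Fin (n - p), ((tileCoord hpn y).2 j = 0 ↔ (tileCoord hpn z).2 j = 0) ∧
        ((tileCoord hpn y).2 j = 1 ↔ (tileCoord hpn z).2 j = 1) := by
    constructor
    · exact fun h j => h ⟨p + j, by omega⟩ (by simp)
    · intro h i hi
      have h1 := h ⟨i - p, by omega⟩
      have h3 : (⟨p + (i - p), by omega⟩ : Fin n) = i := Fin.ext (by simp; omega)
      simp only [tileCoord, h3] at h1
      exact h1
  have hstep : ∀ (y : Fin n → ℝ) (j : Fin p),
      (tileCoord hpn y).1 j = 0 ↔ extend p y j = extend p y (j + 1) := fun y j => by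
    simp only [tileCoord]; rw [sub_eq_zero, eq_comm]
  constructor
  · rintro ⟨h1, h2, h3⟩
    refine ⟨fun j => ?_, hsnd.1 h1⟩
    rw [hstep, hstep]
    rcases Nat.lt_or_ge (j + 1) p with h | h
    · have ey := extend_le_succ hpn hy j.2
      have ez := extend_le_succ hpn hz j.2
      have := h3 ⟨j, by omega⟩ ⟨j + 1, by omega⟩ j.2 h
      rw [← extend_of_lt (y := y) hpn j.2, ← extend_of_lt (y := y) hpn h,
        ← extend_of_lt (y := z) hpn j.2, ← extend_of_lt (y := z) hpn h, ey.lt_iff_ne, ez.lt_iff_ne] at this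
      exact not_iff_not.1 this
    · have : (j : ℕ) + 1 = p := by omega
      rw [this, extend_self, extend_self, extend_of_lt hpn j.2, extend_of_lt hpn j.2]
      exact (h2 ⟨j, by omega⟩ j.2).2
  · rintro ⟨h1, h2⟩
    -- In a monotone chain, two entries are equal exactly when all consecutive entries between them
    -- are.
    have key : ∀ i m : ℕ, i + m ≤ p →
        (extend p y i = extend p y (i + m) ↔ extend p z i = extend p z (i + m)) := by
      intro i m
      induction m with
      | zero => simp
      | succ m ih =>
        intro h
        have h3 := h1 ⟨i + m, by omega⟩
        rw [hstep, hstep] at h3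
        have h4 := ih (by omega)
        have split : ∀ y : Fin n → ℝ, y ∈ closedTile n p → (extend p y i = extend p y (i + (m + 1)) ↔
            extend p y i = extend p y (i + m) ∧ extend p y (i + m) = extend p y (i + m + 1)) := by
          intro y hy
          have a1 := extend_mono hpn hy i m (by omega)
          have a2 := extend_le_succ hpn hy (i := i + m) (by omega)
          rw [← add_assoc]
          constructor
          · intro h; constructor <;> linarith
          · rintro ⟨h, h'⟩; rw [h, h']
        rw [split y hy, split z hz, h4, h3]
    refine ⟨hsnd.2 h2, fun i hi => ⟨?_, ?_⟩, fun i j hi hj => ?_⟩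
    · have := key 0 i (by omega)
      rw [zero_add, extend_zero hp hpn hy, extend_zero hp hpn hz, extend_coe hi, extend_coe hi] at this
      rw [eq_comm, this, eq_comm]
    · have := key i (p - i) (by omega)
      rwa [show (i : ℕ) + (p - i) = p by omega, extend_self, extend_self, extend_coe hi,
        extend_coe hi] at this
    · rcases Nat.lt_or_ge i j with h | h
      · have := key i (j - i) (by omega)
        rw [show (i : ℕ) + (j - i) = j by omega, extend_coe hi, extend_coe hi, extend_coe hj,
          extend_coe hj] at this
        rw [(hy.2.2 i j (Fin.le_def.2 h.le) hj).lt_iff_ne, (hz.2.2 i j (Fin.le_def.2 h.le) hj).lt_iff_ne]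
        exact not_congr this
      · exact iff_of_false (not_lt.2 (hy.2.2 j i h hi)) (not_lt.2 (hz.2.2 j i h hi))

end

/-! ### The faces of `Δ^{p-1} × I^q` -/

section

variable {p q : ℕ}

/-- `y` lies in the closed face spanned by `x`. -/
def FaceLE (y x : (Fin p → ℝ) × (Fin q → ℝ)) : Prop :=
  (∀ i, x.1 i = 0 → y.1 i = 0) ∧ ∀ j, (x.2 j = 0 → y.2 j = 0) ∧ (x.2 j = 1 → y.2 j = 1)

lemma isClosed_faceLE (x : (Fin p → ℝ) × (Fin q → ℝ)) : IsClosed {y | FaceLE y x} := by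
  have : {y | FaceLE y x} = (⋂ i, ⋂ _ : x.1 i = 0, {y | y.1 i = 0}) ∩
      ⋂ j, ((⋂ _ : x.2 j = 0, {y | y.2 j = 0}) ∩ ⋂ _ : x.2 j = 1, {y | y.2 j = 1}) := by
    ext y; simp [FaceLE]
  rw [this]
  refine IsClosed.inter (isClosed_iInter fun i => isClosed_iInter fun _ =>
    isClosed_eq (by fun_prop) (by fun_prop)) (isClosed_iInter fun j => IsClosed.inter ?_ ?_) <;>
  exact isClosed_iInter fun _ => isClosed_eq (by fun_prop) (by fun_prop)

open Filter in
/-- The closed faces are the closures of the open faces. -/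
lemma closure_sameOpenFace (x : simplexCube p q) :
    closure {y : simplexCube p q | SameOpenFace x.1 y.1} = {y | FaceLE y.1 x.1} := by
  refine subset_antisymm (closure_minimal (fun y hy => ⟨fun i => (hy.1 i).1, fun j =>
    ⟨(hy.2 j).1.1, (hy.2 j).2.1⟩⟩) ((isClosed_faceLE x.1).preimage continuous_subtype_val)) ?_
  intro y hy
  obtain ⟨x, ⟨hx1, hx2⟩, hx3, hx4⟩ := x
  obtain ⟨y, ⟨hy1, hy2⟩, hy3, hy4⟩ := y
  rw [closure_subtype]
  let w : ℝ → (Fin p → ℝ) × (Fin q → ℝ) := fun t =>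
    (fun i => (1 - t) * y.1 i + t * x.1 i, fun j => (1 - t) * y.2 j + t * x.2 j)
  have hw : Tendsto w (𝓝[>] 0) (𝓝 y) := by
    have : Continuous w := by fun_prop
    have h := this.tendsto 0
    have h0 : w 0 = y := by simp [w]
    rw [h0] at h
    exact h.mono_left nhdsWithin_le_nhds
  refine mem_closure_of_tendsto hw ?_
  filter_upwards [Ioo_mem_nhdsGT (zero_lt_one (α := ℝ))] with t ht
  have ht1 : 0 < 1 - t := by linarith [ht.2]
  have ht0 := ht.1
  have hnn : ∀ i, 0 ≤ (1 - t) * y.1 i ∧ 0 ≤ t * x.1 i := fun i =>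
    ⟨mul_nonneg ht1.le (hy1 i), mul_nonneg ht0.le (hx1 i)⟩
  have hzero : ∀ j, 0 ≤ (1 - t) * y.2 j ∧ 0 ≤ t * x.2 j := fun j =>
    ⟨mul_nonneg ht1.le (hy3 j), mul_nonneg ht0.le (hx3 j)⟩
  have hone : ∀ j, (1 - t) * y.2 j ≤ 1 - t ∧ t * x.2 j ≤ t := fun j =>
    ⟨mul_le_of_le_one_right ht1.le (hy4 j), mul_le_of_le_one_right ht0.le (hx4 j)⟩
  have hmem : w t ∈ simplexCube p q := by
    refine ⟨⟨fun i => add_nonneg (hnn i).1 (hnn i).2, ?_⟩, fun j => add_nonneg (hzero j).1 (hzero j).2,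
      fun j => ?_⟩
    · simp only [w]
      rw [Finset.sum_add_distrib, ← Finset.mul_sum, ← Finset.mul_sum, hx2, hy2]; ring
    · have := hone j
      simp only [w, Pi.one_apply]; linarith
  refine ⟨⟨w t, hmem⟩, ⟨fun i => ?_, fun j => ⟨?_, ?_⟩⟩, rfl⟩
  · simp only [w]
    constructor
    · intro h; rw [h, hy.1 i h]; simp
    · intro h
      have h1 : t * x.1 i = 0 := by linarith [hnn i]
      exact (mul_eq_zero.1 h1).resolve_left ht0.ne'
  · simp only [w]
    constructor
    · intro h; rw [h, (hy.2 j).1 h]; simp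
    · intro h
      have h1 : t * x.2 j = 0 := by linarith [hzero j]
      exact (mul_eq_zero.1 h1).resolve_left ht0.ne'
  · simp only [w]
    constructor
    · intro h; rw [h, (hy.2 j).2 h]; ring
    · intro h
      have h1 : t * x.2 j = t * 1 := by linarith [hone j]
      exact mul_left_cancel₀ ht0.ne' h1

/-- Two closed faces that meet do so in a closed face. -/
lemma exists_faceLE_inter {x x' y : (Fin p → ℝ) × (Fin q → ℝ)} (hx : x ∈ simplexCube p q)
    (hx' : x' ∈ simplexCube p q) (hy : y ∈ simplexCube p q) (h : FaceLE y x) (h' : FaceLE y x') :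
    ∃ x'' ∈ simplexCube p q, ∀ z, FaceLE z x'' ↔ FaceLE z x ∧ FaceLE z x' := by
  classical
  obtain ⟨⟨hx1, -⟩, -, -⟩ := hx
  obtain ⟨⟨hx1', -⟩, -, -⟩ := hx'
  have hpos : 0 < ∑ i, x.1 i * x'.1 i := by
    obtain ⟨i, -, hi⟩ := Finset.exists_ne_zero_of_sum_ne_zero (s := Finset.univ) (f := y.1)
      (by rw [hy.1.2]; exact one_ne_zero)
    refine Finset.sum_pos' (fun i _ => mul_nonneg (hx1 i) (hx1' i)) ⟨i, Finset.mem_univ i, ?_⟩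
    exact mul_pos (lt_of_le_of_ne (hx1 i) fun h0 => hi (h.1 i h0.symm))
      (lt_of_le_of_ne (hx1' i) fun h0 => hi (h'.1 i h0.symm))
  -- Products of barycentric coordinates vanish where either factor does; the sum is positive
  -- because the two faces share `y`. A cube coordinate free in both faces gets the interior value
  -- `1 / 2`.
  refine ⟨(fun i => x.1 i * x'.1 i / ∑ i, x.1 i * x'.1 i, fun j =>
    if x.2 j = 0 ∨ x'.2 j = 0 then 0 else if x.2 j = 1 ∨ x'.2 j = 1 then 1 else 1 / 2),
    ⟨⟨fun i => div_nonneg (mul_nonneg (hx1 i) (hx1' i)) hpos.le, ?_⟩, fun j => ?_, fun j => ?_⟩,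
    fun z => ⟨fun hz => ?_, fun hz => ?_⟩⟩
  · simp only
    rw [← Finset.sum_div, div_self hpos.ne']
  · simp only [Pi.zero_apply]; split_ifs <;> norm_num
  · simp only [Pi.one_apply]; split_ifs <;> norm_num
  · have h1 : ∀ i, x.1 i = 0 ∨ x'.1 i = 0 → z.1 i = 0 := fun i hi => hz.1 i (by
      rcases hi with hi | hi <;> simp [hi])
    have h2 : ∀ j, x.2 j = 0 ∨ x'.2 j = 0 → z.2 j = 0 := fun j hj => (hz.2 j).1 (by simp [hj])
    have h3 : ∀ j, x.2 j = 1 ∨ x'.2 j = 1 → z.2 j = 1 := fun j hj => (hz.2 j).2 (by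
      have hyj : y.2 j = 1 := hj.elim (h.2 j).2 (h'.2 j).2
      have hn : ¬ (x.2 j = 0 ∨ x'.2 j = 0) := fun h0 => by
        rw [h0.elim (h.2 j).1 (h'.2 j).1] at hyj
        exact zero_ne_one hyj
      simp [hn, hj])
    exact ⟨⟨fun i hi => h1 i (.inl hi), fun j => ⟨fun hj => h2 j (.inl hj), fun hj => h3 j (.inl hj)⟩⟩,
      ⟨fun i hi => h1 i (.inr hi), fun j => ⟨fun hj => h2 j (.inr hj), fun hj => h3 j (.inr hj)⟩⟩⟩
  · refine ⟨fun i hi => ?_, fun j => ?_⟩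
    · simp only [div_eq_zero_iff, hpos.ne', or_false, mul_eq_zero] at hi
      exact hi.elim (hz.1.1 i) (hz.2.1 i)
    · simp only
      split_ifs with h1 h2
      · exact ⟨fun _ => h1.elim (hz.1.2 j).1 (hz.2.2 j).1, fun h => absurd h zero_ne_one⟩
      · exact ⟨fun h => absurd h one_ne_zero, fun _ => h2.elim (hz.1.2 j).2 (hz.2.2 j).2⟩
      · constructor <;> intro h <;> norm_num at h

end

end TorusFSR

namespace TorusFSR

variable {n : ℕ}

/-! ### Tile types -/

section Chart

variable {p : ℕ} {ρ : (Fin (n - 1) → ℝ) → Fin n → ℝ}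

lemma IsCellChart.image_eq_closedTile (hp : 1 ≤ p) (hρ : IsCellChart (stdPt n p) ρ) :
    ρ '' Metric.closedBall 0 1 = closedTile n p := by
  rw [hρ.image_closedBall, closure_torusCell_stdPt hp]

/-- A chart of the standard cell, as a homeomorphism from the closed ball to the closed tile. -/
noncomputable def IsCellChart.homeo (hp : 1 ≤ p) (hρ : IsCellChart (stdPt n p) ρ) :
    Metric.closedBall (0 : Fin (n - 1) → ℝ) 1 ≃ₜ closedTile n p :=
  haveI : CompactSpace (Metric.closedBall (0 : Fin (n - 1) → ℝ) 1) :=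
    isCompact_iff_compactSpace.1 (isCompact_closedBall _ _)
  Continuous.homeoOfEquivCompactToT2
    (f := Equiv.ofBijective
      (fun v => (⟨ρ v.1, (hρ.image_eq_closedTile hp) ▸ mem_image_of_mem ρ v.2⟩ : closedTile n p))
      ⟨fun v w h => Subtype.ext (hρ.injective (congrArg Subtype.val h)), fun y => by
        obtain ⟨v, hv, hvy⟩ := (hρ.image_eq_closedTile hp).ge y.2
        exact ⟨⟨v, hv⟩, Subtype.ext hvy⟩⟩)
    ((hρ.continuous.comp continuous_subtype_val).subtype_mk _)

lemma IsCellChart.coe_homeo (hp : 1 ≤ p) (hρ : IsCellChart (stdPt n p) ρ)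
    (v : Metric.closedBall (0 : Fin (n - 1) → ℝ) 1) : (hρ.homeo hp v).1 = ρ v.1 := rfl

lemma IsCellChart.apply_symm (hp : 1 ≤ p) (hρ : IsCellChart (stdPt n p) ρ) (y : closedTile n p) :
    ρ ((hρ.homeo hp).symm y).1 = y.1 := by
  rw [← hρ.coe_homeo hp, Homeomorph.apply_symm_apply]

variable (ρ) in
/-- The cells of a tile type, as classes. -/
def tileRel : Setoid (Fin (n - 1) → ℝ) := (torusSetoid n).comap ρ

variable (ρ) in
/-- The dimensions of the cells of a tile type. -/
noncomputable def tileDim (v : Fin (n - 1) → ℝ) : ℕ := cellDim (ρ v)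

lemma tileDim_congr (v w : Fin (n - 1) → ℝ) (h : tileRel ρ v w) : tileDim ρ v = tileDim ρ w :=
  SameTorusCell.cellDim_eq h

lemma bijOn_chart (hp : 1 ≤ p) (hρ : IsCellChart (stdPt n p) ρ)
    {v : Fin (n - 1) → ℝ} (hv : v ∈ Metric.closedBall (0 : Fin (n - 1) → ℝ) 1) :
    BijOn ρ (classIn (Metric.closedBall 0 1) (tileRel ρ) v) (torusCell (ρ v)) := by
  refine ⟨fun w hw => hw.2, hρ.injective.injOn, fun y hy => ?_⟩
  have h1 : ρ v ∈ closedTile n p := (hρ.image_eq_closedTile hp) ▸ mem_image_of_mem ρ hv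
  have h2 := mem_closedTile_of_same h1 hy
  rw [← hρ.image_eq_closedTile hp] at h2
  obtain ⟨w, hw, rfl⟩ := h2
  exact ⟨w, ⟨hw, hy⟩, rfl⟩

lemma hasCharMaps_tile (hp : 1 ≤ p) (hρ : IsCellChart (stdPt n p) ρ) :
    HasCharMaps (Metric.closedBall 0 1) (tileRel ρ) (tileDim ρ) fun _ _ _ => True := by
  rintro m ⟨_, v, hv, hm, rfl⟩
  obtain ⟨σ, hσ⟩ := exists_isCellChart (ρ v) (show cellDim (ρ v) = m from hm)
  have h1 : ρ v ∈ closedTile n p := (hρ.image_eq_closedTile hp) ▸ mem_image_of_mem ρ hv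
  obtain ⟨f, hf, -⟩ := hσ.exists_isCharMap (K := closedTile n p) (C := Metric.closedBall 0 1)
    (dim := tileDim ρ) (fun y => ((hρ.homeo hp).symm y).1)
    (continuous_subtype_val.comp (hρ.homeo hp).symm.continuous)
    (fun y => ⟨((hρ.homeo hp).symm y).2, by rw [tileDim, hρ.apply_symm hp]⟩)
    (closure_minimal (fun z hz => mem_closedTile_of_same h1 hz) (isClosed_closedTile n p))
    (fun y y' _ _ h => (hρ.homeo hp).symm.injective (Subtype.ext h))
  have him : (fun y : closedTile n p => ((hρ.homeo hp).symm y).1) '' {y | SameTorusCell (ρ v) y} =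
      classIn (Metric.closedBall 0 1) (tileRel ρ) v := by
    ext w
    constructor
    · rintro ⟨y, hy, rfl⟩
      refine ⟨((hρ.homeo hp).symm y).2, ?_⟩
      change SameTorusCell (ρ v) (ρ _)
      rw [hρ.apply_symm hp]
      exact hy
    · rintro ⟨hw, hvw⟩
      refine ⟨hρ.homeo hp ⟨w, hw⟩, hvw, ?_⟩
      simp only [Homeomorph.symm_apply_apply]
  rw [him] at hf
  exact ⟨f, hf, trivial⟩

lemma finite_tile_classes (hp : 1 ≤ p) (hρ : IsCellChart (stdPt n p) ρ) :
    Finite (Σ m, {s : Set (Fin (n - 1) → ℝ) //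
      IsClassOfDim (Metric.closedBall 0 1) (tileRel ρ) (tileDim ρ) m s}) := by
  refine finite_sigma_classes tileDim_congr ?_
  refine Set.Finite.subset ((finite_torusCell_image (n := n) (K := closedTile n p) (c := 2)
    fun y hy i => ?_).image fun s => Metric.closedBall 0 1 ∩ ρ ⁻¹' s) ?_
  · rcases Nat.lt_or_ge i p with hi | hi
    · have := mem_cube_stdBox_of_lt hy.1 hi
      push_cast; constructor <;> linarith
    · have := mem_cube_stdBox_of_le hy.1 hi
      push_cast; constructor <;> linarith
  · rintro _ ⟨v, hv, rfl⟩
    exact ⟨torusCell (ρ v), ⟨ρ v, (hρ.image_eq_closedTile hp) ▸ mem_image_of_mem ρ hv, rfl⟩, rfl⟩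

/-- The tile type. -/
@[reducible]
noncomputable def tileCW (hp : 1 ≤ p) (hρ : IsCellChart (stdPt n p) ρ) :
    CWComplex (Metric.closedBall (0 : Fin (n - 1) → ℝ) 1) :=
  (hasCharMaps_tile hp hρ).cw tileDim_congr (finite_tile_classes hp hρ)

variable (hp : 1 ≤ p) (hpn : p ≤ n) (hρ : IsCellChart (stdPt n p) ρ)

/-- The identification of the tile with a product of a simplex and a cube. -/
noncomputable def tilePolytope : Metric.closedBall (0 : Fin (n - 1) → ℝ) 1 ≃ₜ simplexCube p (n - p) :=
  (hρ.homeo hp).trans (tileHomeo hp hpn)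

lemma tileRel_iff (v w : Metric.closedBall (0 : Fin (n - 1) → ℝ) 1) :
    tileRel ρ v.1 w.1 ↔ SameOpenFace (tilePolytope hp hpn hρ v).1 (tilePolytope hp hpn hρ w).1 :=
  sameTorusCell_iff_sameOpenFace hp hpn (hρ.homeo hp v).2 (hρ.homeo hp w).2

lemma sameOpenCell_tileCW (v w : Metric.closedBall (0 : Fin (n - 1) → ℝ) 1) :
    SameOpenCell (tileCW hp hρ) v.1 w.1 ↔
      SameOpenFace (tilePolytope hp hpn hρ v).1 (tilePolytope hp hpn hρ w).1 := by
  rw [← tileRel_iff hp hpn hρ, tileCW, (hasCharMaps_tile hp hρ).sameOpenCell_cw]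
  exact ⟨fun h => h.2.2, fun h => ⟨v.2, w.2, h⟩⟩

lemma exists_openCell_tileCW {m : ℕ} (c : Cell (tileCW hp hρ) m) :
    ∃ v : Metric.closedBall (0 : Fin (n - 1) → ℝ) 1, tileDim ρ v.1 = m ∧
      openCell (tileCW hp hρ) m c = classIn (Metric.closedBall 0 1) (tileRel ρ) v.1 := by
  obtain ⟨v, hv, hm, hc⟩ := (hasCharMaps_tile hp hρ).exists_of_cell _ _ m c
  exact ⟨⟨v, hv⟩, hm, hc⟩

lemma exists_cell_tileCW (v : Metric.closedBall (0 : Fin (n - 1) → ℝ) 1) :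
    ∃ c : Cell (tileCW hp hρ) (tileDim ρ v.1), openCell (tileCW hp hρ) _ c =
      classIn (Metric.closedBall 0 1) (tileRel ρ) v.1 :=
  ⟨_, (hasCharMaps_tile hp hρ).openCell_cellOf tileDim_congr (finite_tile_classes hp hρ) v.2⟩

lemma classIn_tileRel (v : Metric.closedBall (0 : Fin (n - 1) → ℝ) 1) :
    classIn (Metric.closedBall 0 1) (tileRel ρ) v.1 = (↑) '' (tilePolytope hp hpn hρ ⁻¹'
      {y | SameOpenFace (tilePolytope hp hpn hρ v).1 y.1}) := by
  ext w
  constructor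
  · rintro ⟨hw, h⟩
    exact ⟨⟨w, hw⟩, (tileRel_iff hp hpn hρ v ⟨w, hw⟩).1 h, rfl⟩
  · rintro ⟨w, h, rfl⟩
    exact ⟨w.2, (tileRel_iff hp hpn hρ v w).2 h⟩

lemma closedCell_tileCW {m : ℕ} {c : Cell (tileCW hp hρ) m}
    {v : Metric.closedBall (0 : Fin (n - 1) → ℝ) 1}
    (hc : openCell (tileCW hp hρ) m c = classIn (Metric.closedBall 0 1) (tileRel ρ) v.1) :
    closedCell (tileCW hp hρ) m c = (↑) '' (tilePolytope hp hpn hρ ⁻¹'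
      {y | FaceLE y.1 (tilePolytope hp hpn hρ v).1}) := by
  rw [← closure_openCell, hc, classIn_tileRel hp hpn hρ,
    (Metric.isClosed_closedBall.isClosedEmbedding_subtypeVal).closure_image_eq,
    ← Homeomorph.preimage_closure, closure_sameOpenFace]

lemma closedTile_subset_sphereS (hp : 1 ≤ p) (hpn : p ≤ n) : closedTile n p ⊆ sphereS n (p - 1) := by
  rw [← closure_torusCell_stdPt hp]
  exact closure_torusCell_subset (stdPt_mem_sphereS hp hpn)

/-- The intersection property is transported from the faces of `Δ^{p-1} × I^q`, where two faces that
meet do so in a face. -/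
lemma isTileType_tileCW (hp : 1 ≤ p) (hpn : p ≤ n) (hρ : IsCellChart (stdPt n p) ρ) :
    IsTileType (n - 1) (tileCW hp hρ) := by
  constructor
  · have hmem : stdPt n p ∈ closedTile n p := stdPt_mem_closedTile hp
    let v₀ := (hρ.homeo hp).symm ⟨stdPt n p, hmem⟩
    have hv₀ : ρ v₀.1 = stdPt n p := hρ.apply_symm hp ⟨_, hmem⟩
    have hdim : tileDim ρ v₀.1 = n - 1 := by rw [tileDim, hv₀]; exact hρ.dim_eq
    obtain ⟨e, he⟩ := exists_cell_tileCW hp hρ v₀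
    have hball : classIn (Metric.closedBall 0 1) (tileRel ρ) v₀.1 = Metric.ball 0 1 := by
      ext w
      have : tileRel ρ v₀.1 w ↔ w ∈ Metric.ball (0 : Fin (n - 1) → ℝ) 1 := by
        change SameTorusCell (ρ v₀.1) (ρ w) ↔ _
        rw [hv₀, ← hρ.injective.mem_set_image, hρ.image_ball]
        rfl
      refine ⟨fun h => this.1 h.2, fun h => ⟨Metric.ball_subset_closedBall h, this.2 h⟩⟩
    rw [hball] at he
    -- The dimension of the top cell is only propositionally `n - 1`; generalizing it allows
    -- substitution in the type of `e`.
    generalize tileDim ρ v₀.1 = d at e hdim he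
    subst hdim
    refine ⟨e, he, fun m c hne w hw => ?_⟩
    have hwb := closedCell_subset _ _ _ hw
    rw [← Metric.closedBall_sdiff_ball]
    refine ⟨hwb, fun hb => ?_⟩
    rw [← he] at hb
    have h1 := dim_lt_of_mem_closedCell _ hw hb hne
    obtain ⟨v, hm, -⟩ := exists_openCell_tileCW hp hρ c
    have h2 : ρ v.1 ∈ closedTile n p := (hρ.homeo hp v).2
    have h4 := cellDim_le_of_mem (closedTile_subset_sphereS hp hpn h2)
    rw [tileDim] at hm
    omega
  · rintro m m' c c' hne ⟨w, hw, hw'⟩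
    obtain ⟨v, hm, hc⟩ := exists_openCell_tileCW hp hρ c
    obtain ⟨v', hm', hc'⟩ := exists_openCell_tileCW hp hρ c'
    have e1 := closedCell_tileCW hp hpn hρ hc
    have e2 := closedCell_tileCW hp hpn hρ hc'
    rw [e1] at hw
    rw [e2] at hw'
    obtain ⟨w, h1, rfl⟩ := hw
    obtain ⟨w', h2, h3⟩ := hw'
    obtain rfl := Subtype.ext h3
    obtain ⟨x'', hx'', hiff⟩ := exists_faceLE_inter (tilePolytope hp hpn hρ v).2
      (tilePolytope hp hpn hρ v').2 (tilePolytope hp hpn hρ w').2 h1 h2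
    let v'' := (tilePolytope hp hpn hρ).symm ⟨x'', hx''⟩
    have hv'' : (tilePolytope hp hpn hρ v'').1 = x'' := by
      simp only [v'', Homeomorph.apply_symm_apply]
    obtain ⟨c'', hc''⟩ := exists_cell_tileCW hp hρ v''
    have e3 := closedCell_tileCW hp hpn hρ hc''
    rw [hv''] at e3
    have hinter : closedCell (tileCW hp hρ) m c ∩ closedCell (tileCW hp hρ) m' c' =
        closedCell (tileCW hp hρ) _ c'' := by
      rw [e1, e2, e3, ← image_inter Subtype.val_injective, ← preimage_inter]
      congr 2
      ext y
      exact (hiff y.1).symm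
    have hself : v''.1 ∈ openCell (tileCW hp hρ) _ c'' := by
      rw [hc'']; exact mem_classIn_self v''.2
    have hmem : v''.1 ∈ closedCell (tileCW hp hρ) m c ∩ closedCell (tileCW hp hρ) m' c' := by
      rw [hinter]; exact openCell_subset_closedCell _ _ _ hself
    -- A point of the open cell `c''` is in both closed cells, and `c''` differs from at least one
    -- of `c`, `c'`; in that one it lies in the boundary, so its dimension is smaller.
    refine ⟨_, c'', ?_, hinter⟩
    by_cases h : (⟨m, c⟩ : Σ m, Cell (tileCW hp hρ) m) = ⟨_, c''⟩
    · exact lt_max_of_lt_right (dim_lt_of_mem_closedCell _ hmem.2 hself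
        fun h' => hne (h.trans h'.symm))
    · exact lt_max_of_lt_left (dim_lt_of_mem_closedCell _ hmem.1 hself h)

lemma homeoOnCells_tileCW (hn : 1 ≤ n) {f : (Fin (n - 1) → ℝ) → TypeSpace n}
    (hf : ContinuousOn f (Metric.closedBall 0 1))
    (h : ∀ v ∈ Metric.closedBall (0 : Fin (n - 1) → ℝ) 1, ∃ h, f v = toType n (p - 1) ⟨ρ v, h⟩) :
    HomeoOnCells (tileCW hp hρ) (typeCW hn) f := by
  refine homeoOnCells_of_bijOn _ _ hf fun m c => ?_
  obtain ⟨v, hm, hc⟩ := exists_openCell_tileCW hp hρ c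
  obtain ⟨hv, hfv⟩ := h v.1 v.2
  obtain ⟨c', hc'⟩ := exists_openCell_typeCW hn (toType n (p - 1) ⟨ρ v.1, hv⟩) (m := m) hm
  refine ⟨c', ?_⟩
  rw [hc, hc']
  have h1 := bijOn_toType ⟨ρ v.1, hv⟩
  have h2 := bijOn_chart hp hρ v.2
  refine ⟨fun w hw => ?_, fun w hw w' hw' he => ?_, fun s hs => ?_⟩
  · obtain ⟨h3, h4⟩ := h w hw.1
    rw [h4]
    exact h1.mapsTo (h2.mapsTo hw)
  · obtain ⟨h3, h4⟩ := h w hw.1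
    obtain ⟨h5, h6⟩ := h w' hw'.1
    rw [h4, h6] at he
    exact h2.injOn hw hw' (congrArg Subtype.val (h1.injOn (h2.mapsTo hw) (h2.mapsTo hw') he))
  · obtain ⟨y, hy, rfl⟩ := h1.surjOn hs
    obtain ⟨w, hw, hwy⟩ := h2.surjOn hy
    refine ⟨w, hw, ?_⟩
    obtain ⟨h3, h4⟩ := h w hw.1
    rw [h4]
    congr 1
    exact Subtype.ext hwy

end Chart

/-! ### The subdivision rule -/

lemma exists_tileChart (hn : 1 ≤ n) (e : Cell (typeCW hn) (n - 1)) :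
    ∃ p, 1 ≤ p ∧ p ≤ n ∧ ∃ ρ : (Fin (n - 1) → ℝ) → Fin n → ℝ, IsCellChart (stdPt n p) ρ ∧
      ∀ v ∈ Metric.closedBall (0 : Fin (n - 1) → ℝ) 1,
        ∃ h, charMap (typeCW hn) (n - 1) e v = toType n (p - 1) ⟨ρ v, h⟩ :=
  (hasCharMaps_type hn).extra_cw typeDim_congr (finite_type_classes n) (n - 1) e rfl

lemma exists_tile (hn : 1 ≤ n) (e : Cell (typeCW hn) (n - 1)) :
    ∃ K : CWComplex (Metric.closedBall (0 : Fin (n - 1) → ℝ) 1), FinitelyManyCells K ∧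
      IsTileType (n - 1) K ∧ HomeoOnCells K (typeCW hn) (charMap (typeCW hn) (n - 1) e) ∧
      ∀ p : Icc 1 n, tileEquiv hn p = e →
        ∃ h : Metric.closedBall (0 : Fin (n - 1) → ℝ) 1 ≃ₜ simplexCube p (n - p),
          ∀ v w : Metric.closedBall (0 : Fin (n - 1) → ℝ) 1,
            SameOpenCell K v.1 w.1 ↔ SameOpenFace (h v).1 (h w).1 := by
  obtain ⟨p, hp, hpn, ρ, hρ, h⟩ := exists_tileChart hn e
  refine ⟨tileCW hp hρ, (hasCharMaps_tile hp hρ).finitelyManyCells_cw _ _,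
    isTileType_tileCW hp hpn hρ, homeoOnCells_tileCW hp hρ hn
      (@CWComplex.continuousOn _ _ _ (typeCW hn) _ e) h, fun p' hp' => ?_⟩
  -- The chart passes through `stdPt n p`, whose type lies in the cell `e`, and this identifies the
  -- index of the tile.
  have hpp : p' = ⟨p, hp, hpn⟩ := by
    apply (tileEquiv hn).injective
    rw [hp']
    have h1 : stdPt n p ∈ ρ '' Metric.ball 0 1 := by
      rw [hρ.image_ball]; exact SameTorusCell.refl _
    obtain ⟨v, hv, hvp⟩ := h1
    obtain ⟨h2, h3⟩ := h v (Metric.ball_subset_closedBall hv)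
    have h4 : stdType n ⟨p, hp, hpn⟩ ∈ openCell (typeCW hn) (n - 1) e := by
      refine ⟨v, hv, h3.trans ?_⟩
      exact congrArg (toType n (p - 1)) (Subtype.ext hvp)
    have h5 : stdType n ⟨p, hp, hpn⟩ ∈
        openCell (typeCW hn) (n - 1) (tileEquiv hn ⟨p, hp, hpn⟩) := by
      rw [openCell_tileEquiv]; exact mem_classIn_self (mem_univ _)
    simpa using cell_eq_of_mem_openCell _ h4 h5
  subst hpp
  exact ⟨tilePolytope hp hpn hρ, sameOpenCell_tileCW hp hpn hρ⟩

lemma homeoOnCells_subFun (hn : 1 ≤ n) : HomeoOnCells (subCW n) (typeCW hn) subFun := by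
  refine homeoOnCells_of_bijOn _ _ continuous_subFun.continuousOn fun m c => ?_
  obtain ⟨s, -, hs, hc⟩ := (hasCharMaps_sub n).exists_of_cell _ _ m c
  obtain ⟨c', hc'⟩ := exists_openCell_typeCW hn (subFun s) hs
  refine ⟨c', ?_⟩
  rw [hc']
  exact (show openCell (subCW n) m c = _ from hc) ▸ bijOn_subFun s

/-- The subdivision rule of the torus. -/
noncomputable def torusRule (hn : 1 ≤ n) : FiniteSubdivisionRule (n - 1) where
  S := TypeSpace n
  cw := typeCW hn
  finite_cw := (hasCharMaps_type hn).finitelyManyCells_cw typeDim_congr (finite_type_classes n)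
  dim_cw := (hasCharMaps_type hn).dimLE_cw typeDim_congr (finite_type_classes n)
    fun s _ => typeDim_le s
  union_cw := unionOfClosed_typeCW hn
  tile e := Classical.choose (exists_tile hn e)
  finite_tile e := (Classical.choose_spec (exists_tile hn e)).1
  isTileType e := (Classical.choose_spec (exists_tile hn e)).2.1
  charMap_tile e := (Classical.choose_spec (exists_tile hn e)).2.2.1
  sub := subCW n
  finite_sub := (hasCharMaps_sub n).finitelyManyCells_cw subDim_congr (finite_sub_classes n)
  dim_sub := (hasCharMaps_sub n).dimLE_cw subDim_congr (finite_sub_classes n)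
    fun s _ => typeDim_le (subFun s)
  isSubdivision := isSubdivision_subCW hn
  subMap := ⟨subFun, continuous_subFun⟩
  homeo_subMap := homeoOnCells_subFun hn

lemma isSimplexCube_torusRule (hn : 1 ≤ n) (p : Icc 1 n) :
    IsSimplexCube (torusRule hn) (tileEquiv hn p) p (n - p) :=
  (Classical.choose_spec (exists_tile hn (tileEquiv hn p))).2.2.2 p rfl

lemma tileCount_torusRule (hn : 1 ≤ n) (p p' : Icc 1 n) :
    tileCount (torusRule hn) (tileEquiv hn p) (tileEquiv hn p') =
      if (p' : ℕ) = p then 1 else if (p' : ℕ) = p + 1 then 2 * (n - p) else 0 :=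
  card_subtiles hn p p'

end TorusFSR

namespace TorusFSR

variable {n : ℕ}

/-! ### The spheres as complexes -/

section

variable {X : Type} [TopologicalSpace X] {k : ℕ} (h : X ≃ₜ sphereS n k)

/-- The cell structure of a sphere, as classes. -/
def sphereRel : Setoid X := (torusSetoid n).comap fun x => (h x).1

/-- The dimensions of the cells of a sphere. -/
noncomputable def sphereDim (x : X) : ℕ := cellDim (h x).1

lemma sphereDim_congr (x y : X) (hxy : sphereRel h x y) : sphereDim h x = sphereDim h y :=
  SameTorusCell.cellDim_eq hxy

lemma bijOn_sphere_symm (x : X) :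
    BijOn h.symm {y | SameTorusCell (h x).1 y.1} (classIn univ (sphereRel h) x) := by
  refine ⟨fun y hy => ⟨mem_univ _, ?_⟩, h.symm.injective.injOn, fun y hy => ⟨h y, hy.2, by simp⟩⟩
  change SameTorusCell (h x).1 (h (h.symm y)).1
  rw [h.apply_symm_apply]
  exact hy

lemma bijOn_sphere (x : X) :
    BijOn h (classIn univ (sphereRel h) x) {y | SameTorusCell (h x).1 y.1} :=
  ⟨fun _ hy => hy.2, h.injective.injOn, fun y hy => ⟨h.symm y,
    (bijOn_sphere_symm h x).mapsTo hy, h.apply_symm_apply y⟩⟩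

lemma hasCharMaps_sphere : HasCharMaps univ (sphereRel h) (sphereDim h) fun _ _ _ => True := by
  rintro m ⟨_, x, -, hm, rfl⟩
  obtain ⟨ρ, hρ⟩ := exists_isCellChart (h x).1 (show cellDim (h x).1 = m from hm)
  obtain ⟨f, hf, -⟩ := hρ.exists_isCharMap (C := univ) (dim := sphereDim h) h.symm
    h.symm.continuous (fun y => ⟨mem_univ _, by rw [sphereDim, h.apply_symm_apply]⟩)
    (closure_torusCell_subset (h x).2) (fun y y' _ _ he => h.symm.injective he)
  rw [(bijOn_sphere_symm h x).image_eq] at hf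
  exact ⟨f, hf, trivial⟩

lemma exists_abs_le_of_mem_sphereS (n k : ℕ) :
    ∃ c : ℤ, ∀ y ∈ sphereS n k, ∀ i, -(c : ℝ) ≤ y i ∧ y i ≤ c := by
  obtain ⟨C, hC⟩ := (isCompact_sphereS n k).isBounded.exists_norm_le
  obtain ⟨c, hc⟩ := exists_nat_ge C
  refine ⟨c, fun y hy i => ?_⟩
  have h1 := (norm_le_pi_norm y i).trans ((hC y hy).trans hc)
  rw [Real.norm_eq_abs, abs_le] at h1
  simpa using h1

lemma finite_sphere_classes :
    Finite (Σ m, {s : Set X // IsClassOfDim univ (sphereRel h) (sphereDim h) m s}) := by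
  obtain ⟨c, hc⟩ := exists_abs_le_of_mem_sphereS n k
  refine finite_sigma_classes (sphereDim_congr h) (Set.Finite.subset
    ((finite_torusCell_image (n := n) hc).image fun s => {y : X | (h y).1 ∈ s}) ?_)
  rintro _ ⟨x, -, rfl⟩
  refine ⟨torusCell (h x).1, ⟨_, (h x).2, rfl⟩, ?_⟩
  ext y
  exact ⟨fun hy => ⟨mem_univ _, hy⟩, fun hy => hy.2⟩

variable [T2Space X]

/-- The cell structure of a sphere. -/
@[reducible]
noncomputable def sphereCW : CWComplex (univ : Set X) :=
  (hasCharMaps_sphere h).cw (sphereDim_congr h) (finite_sphere_classes h)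

lemma exists_openCell_sphereCW (x : X) {m : ℕ} (hm : cellDim (h x).1 = m) :
    ∃ c : Cell (sphereCW h) m, openCell (sphereCW h) m c = classIn univ (sphereRel h) x := by
  subst hm
  exact ⟨(hasCharMaps_sphere h).cellOf (sphereDim_congr h) (finite_sphere_classes h) (mem_univ x),
    (hasCharMaps_sphere h).openCell_cellOf _ _ _⟩

lemma exists_of_cell_sphereCW {m : ℕ} (c : Cell (sphereCW h) m) : ∃ x : X, cellDim (h x).1 = m ∧
    openCell (sphereCW h) m c = classIn univ (sphereRel h) x := by
  obtain ⟨x, -, hx, hc⟩ := (hasCharMaps_sphere h).exists_of_cell _ _ m c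
  exact ⟨x, hx, hc⟩

lemma sameOpenCell_sphereCW (x y : X) :
    SameOpenCell (sphereCW h) x y ↔ SameTorusCell (h x).1 (h y).1 := by
  rw [sphereCW, (hasCharMaps_sphere h).sameOpenCell_cw]
  exact ⟨fun h => h.2.2, fun h => ⟨mem_univ _, mem_univ _, h⟩⟩

lemma unionOfClosed_sphereCW (hn : 1 ≤ n) : UnionOfClosed (sphereCW h) (n - 1) := by
  refine unionOfClosed_of_dense (sphereCW h)
    ((hasCharMaps_sphere h).finitelyManyCells_cw _ (finite_sphere_classes h)) (n - 1) fun x _ => ?_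
  have h1 : h x ∈ closure {y : sphereS n k | cellDim y.1 = n - 1} := by
    rw [closure_subtype]
    refine closure_mono ?_ (mem_closure_top hn (h x).2)
    rintro y ⟨hy, hd⟩
    exact ⟨⟨y, hy⟩, hd, rfl⟩
  have h2 := map_mem_closure h.symm.continuous h1 (t := ⋃ c : Cell (sphereCW h) (n - 1),
      openCell (sphereCW h) (n - 1) c) fun y hy => by
    obtain ⟨c, hc⟩ := exists_openCell_sphereCW h (h.symm y) (m := n - 1)
      (by rw [h.apply_symm_apply]; exact hy)
    exact mem_iUnion.2 ⟨c, hc ▸ mem_classIn_self (mem_univ _)⟩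
  rwa [h.symm_apply_apply] at h2

lemma homeoOnCells_sphereCW (hn : 1 ≤ n) :
    HomeoOnCells (sphereCW h) (typeCW hn) fun x => toType n k (h x) := by
  refine homeoOnCells_of_bijOn _ _ ((continuous_toType n k).comp h.continuous).continuousOn
    fun m c => ?_
  obtain ⟨x, hx, hc⟩ := exists_of_cell_sphereCW h c
  obtain ⟨c', hc'⟩ := exists_openCell_typeCW hn (toType n k (h x)) (m := m) hx
  refine ⟨c', ?_⟩
  rw [hc, hc']
  exact (bijOn_toType (h x)).comp (bijOn_sphere h x)

/-- A space homeomorphic to a sphere, as a complex of the subdivision rule. -/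
noncomputable def sphereComplex (hn : 1 ≤ n) : RComplex (torusRule hn) X where
  cw := sphereCW h
  dim_cw := (hasCharMaps_sphere h).dimLE_cw _ _ fun x _ => cellDim_le_of_mem (h x).2
  union_cw := unionOfClosed_sphereCW h hn
  map := ⟨fun x => toType n k (h x), (continuous_toType n k).comp h.continuous⟩
  homeo_map := homeoOnCells_sphereCW h hn

/-- Keeping the space fixed and composing the identification with `stage` refines the cells exactly
as `sameTorusCell_stage_iff` says. The pullback condition is `bijOn_toType_stage_symm`, and the maps
agree by `subFun_toType`. -/
lemma isSubdivided_sphereComplex (hn : 1 ≤ n) :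
    IsSubdivided (torusRule hn) (sphereComplex h hn)
      (sphereComplex (h.trans (stage n k)) hn) where
  isSubdivision := by
    intro m c
    obtain ⟨x, -, hc⟩ := exists_of_cell_sphereCW (h.trans (stage n k)) c
    obtain ⟨c', hc'⟩ := exists_openCell_sphereCW h x rfl
    refine ⟨_, c', ?_⟩
    change openCell (sphereCW _) m c ⊆ openCell (sphereCW h) _ c'
    rw [hc, hc']
    exact fun y hy => ⟨mem_univ _, ((sameTorusCell_stage_iff _ _).1 hy.2).1⟩
  pullback := by
    refine homeoOnCells_of_bijOn _ _ ((continuous_toType n k).comp h.continuous).continuousOn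
      fun m c => ?_
    obtain ⟨x, hx, hc⟩ := exists_of_cell_sphereCW (h.trans (stage n k)) c
    obtain ⟨c', hc'⟩ := exists_openCell_subCW (toType n k (h x)) (m := m)
      ((subDim_toType _).trans hx)
    refine ⟨c', ?_⟩
    change BijOn (fun x => toType n k (h x)) (openCell (sphereCW (h.trans (stage n k))) m c)
      (openCell (subCW n) m c')
    rw [hc, hc']
    have h1 := (bijOn_toType_stage_symm (h x)).comp (bijOn_sphere (h.trans (stage n k)) x)
    refine h1.congr fun y _ => ?_
    simp only [Function.comp_apply, Homeomorph.trans_apply, Homeomorph.symm_apply_apply]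
  map_eq := by
    ext x
    exact (subFun_toType (h x)).symm

end

/-- The first sphere, identified with all the others. -/
noncomputable def sphereHomeo (n : ℕ) : ∀ k, sphereS n 0 ≃ₜ sphereS n k
  | 0 => Homeomorph.refl _
  | k + 1 => (sphereHomeo n k).trans (stage n k)

lemma sphereS_zero_eq (n : ℕ) : sphereS n 0 = frontier (cube (0 : Fin n → ℤ)) := by
  have : ballB n 0 = cube (0 : Fin n → ℤ) := by
    ext x
    simp only [ballB, mem_iUnion, mem_wordBall, Nat.le_zero, exists_prop]
    constructor
    · rintro ⟨b, hb, hx⟩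
      have : b = 0 := by
        funext i
        have := (Finset.sum_eq_zero_iff.1 hb) i (Finset.mem_univ i)
        simpa using this
      rwa [this] at hx
    · intro hx
      exact ⟨0, by simp [len], hx⟩
  rw [sphereS, this]

/-- `S(0)` is the boundary of the unit cube, a compact convex set with interior, so a homeomorphism
of the whole space carries it to the Euclidean unit sphere. -/
lemma nonempty_homeo_sphere (n : ℕ) :
    Nonempty (sphereS n 0 ≃ₜ Metric.sphere (0 : EuclideanSpace ℝ (Fin n)) 1) := by
  let e := EuclideanSpace.equiv (Fin n) ℝ
  let s : Set (EuclideanSpace ℝ (Fin n)) := e ⁻¹' cube 0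
  have hcube : cube (0 : Fin n → ℤ) = Icc 0 1 := by
    ext x
    simp [cube, Pi.le_def, forall_and]
  have hconv : Convex ℝ s := by
    refine Convex.linear_preimage (f := e.toLinearEquiv.toLinearMap) ?_
    rw [hcube]; exact convex_Icc 0 1
  have hint : (interior s).Nonempty := by
    have h1 : interior s = e.toHomeomorph ⁻¹' interior (cube (0 : Fin n → ℤ)) :=
      (e.toHomeomorph.preimage_interior _).symm
    have h2 : (fun _ => 1 / 2 : Fin n → ℝ) ∈ interior (cube (0 : Fin n → ℤ)) := by
      rw [hcube, ← pi_univ_Icc, interior_pi_set finite_univ]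
      intro i _
      change (1 / 2 : ℝ) ∈ interior (Icc (0 : ℝ) 1)
      rw [interior_Icc]
      norm_num
    rw [h1]
    exact ⟨e.symm (fun _ => 1 / 2), by simpa using h2⟩
  have hbd : Bornology.IsBounded s :=
    (e.toHomeomorph.isCompact_preimage.2 (isCompact_cube 0)).isBounded
  obtain ⟨H, -, -, h3⟩ := exists_homeomorph_image_interior_closure_frontier_eq_unitBall hconv hint hbd
  have hs : e.toHomeomorph ⁻¹' sphereS n 0 = frontier s := by
    rw [sphereS_zero_eq, e.toHomeomorph.preimage_frontier]; rfl
  have g1 : frontier s ≃ₜ sphereS n 0 :=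
    e.toHomeomorph.subtype fun x => by rw [← hs]; rfl
  have g2 : frontier s ≃ₜ Metric.sphere (0 : EuclideanSpace ℝ (Fin n)) 1 :=
    H.subtype fun x => by rw [← h3, H.injective.mem_set_image]
  exact ⟨g1.symm.trans g2⟩

/-- A point of a top-dimensional cell lies in one cube that is new in the next ball. -/
lemma exists_covering_cube (hn : 1 ≤ n) {k : ℕ} {x : Fin n → ℝ} (hx : x ∈ sphereS n k)
    (hd : cellDim x = n - 1) : ∃ b, len b = k + 1 ∧
      Nat.card {i // b i ≠ 0} + (nearFin x).card = n ∧ x ∈ cube b := by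
  classical
  -- The longest cube around the point is the new one, and its zero entries are exactly at the near
  -- coordinates.
  refine ⟨fun i => outerIdx (x i), (top_facts hn hx hd).2.2.2.2, ?_, mem_cube_outer x⟩
  rw [Nat.card_eq_fintype_card, Fintype.card_subtype]
  have : nearFin x = Finset.univ.filter fun i => outerIdx (x i) = 0 := by
    ext i
    rw [mem_nearFin, Finset.mem_filter, near_of_outerIdx_eq_zero]
    simp
  rw [this, add_comm]
  have h1 := Finset.card_filter_add_card_filter_not (s := (Finset.univ : Finset (Fin n)))
    (p := fun i => outerIdx (x i) = 0)
  rwa [Finset.card_univ, Fintype.card_fin] at h1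

lemma mem_wordBall_sdiff {k : ℕ} {b : Fin n → ℤ} :
    b ∈ wordBall (stdGens n) (k + 1) \ wordBall (stdGens n) k ↔ len b = k + 1 := by
  rw [mem_sdiff, mem_wordBall, mem_wordBall]
  omega

lemma realisesSpheres_torusRule (hn : 1 ≤ n) :
    RealisesSpheres n (torusRule hn) (tileEquiv hn) := by
  refine ⟨sphereS n 0, inferInstance, inferInstance, fun k => sphereComplex (sphereHomeo n k) hn,
    sphereHomeo n, nonempty_homeo_sphere n, fun k => isSubdivided_sphereComplex _ hn,
    fun k x y => sameOpenCell_sphereCW _ x y, fun k e p he => ?_, fun k x hx => ?_,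
    fun k x b hb hx => ?_⟩
  · obtain ⟨x, hx, hc⟩ := exists_of_cell_sphereCW (sphereHomeo n k) e
    have he' : (fun x => toType n k (sphereHomeo n k x)) ''
        openCell (sphereCW (sphereHomeo n k)) (n - 1) e =
        openCell (typeCW hn) (n - 1) (tileEquiv hn p) := he
    have h1 : typeRel n (stdType n p) (toType n k (sphereHomeo n k x)) := by
      have h2 : toType n k (sphereHomeo n k x) ∈ openCell (typeCW hn) (n - 1) (tileEquiv hn p) := by
        rw [← he', hc]
        exact ⟨x, mem_classIn_self (mem_univ _), rfl⟩
      rw [openCell_tileEquiv] at h2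
      exact h2.2
    have h3 := (typeRel_stdType_iff hn hx).1 h1
    obtain ⟨b, hb, hcard, hmem⟩ := exists_covering_cube hn (sphereHomeo n k x).2 hx
    refine ⟨b, mem_wordBall_sdiff.2 hb, by omega, fun y hy => ?_⟩
    have hy' : y ∈ classIn univ (sphereRel (sphereHomeo n k)) x := hc ▸ hy
    exact (SameTorusCell.mem_cube hy'.2).1 hmem
  · exact stageEquiv_of_mem hx
  · have hb' := mem_wordBall_sdiff.1 hb
    change (stageEquiv n k (sphereHomeo n k x)).1 ∈ cube b
    rw [stageEquiv_of_mem_cube hb' hx]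
    exact push_mem_cube hx (by omega)

end TorusFSR

theorem theorem1 (n : ℕ) (hn : 1 ≤ n) :
    ∃ (R : TorusFSR.FiniteSubdivisionRule (n - 1))
      (t : Set.Icc 1 n ≃ TorusFSR.Cell R.cw (n - 1)),
      (∀ p : Set.Icc 1 n, TorusFSR.IsSimplexCube R (t p) p (n - p)) ∧
      (∀ p p' : Set.Icc 1 n, TorusFSR.tileCount R (t p) (t p') =
        if (p' : ℕ) = p then 1 else if (p' : ℕ) = p + 1 then 2 * (n - p) else 0) ∧
      TorusFSR.RealisesSpheres n R t :=
  ⟨TorusFSR.torusRule hn, TorusFSR.tileEquiv hn, TorusFSR.isSimplexCube_torusRule hn,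
    TorusFSR.tileCount_torusRule hn, TorusFSR.realisesSpheres_torusRule hn⟩
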